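/- Let $k$ be a field, $S=k[x_1,\dots,x_n]$ with the degree-lexicographic order, $x_1\succ\dots\succ x_n$, and let $\mathfrak a=\langle f_1,\dots,f_s\rangle\subset S$, where $f_1,\dots,f_s$ is the reduced Gröbner basis of $\mathfrak a$, with leading monomials $m_1,\dots,m_s$. Suppose that the initial ideal $\mathrm{in}(\mathfrak a)=\langle m_1,\dots,m_s\rangle$ is a complete intersection (generated by a regular sequence) and that $\mathfrak a\subseteq\langle x_1,\dots,x_n\rangle$. Put $A=S/\mathfrak a$ and let $k=A/\langle x_1,\dots,x_n\rangle$ be the residue class field. For $g=\sum_\alpha g_\alpha x^\alpha\in S$ put $$T_p(g)=\sum_{\alpha\,:\,p=\max(\mathrm{supp}(\alpha))}g_\alpha\,\frac{x^\alpha}{x_p},$$ the sum being over all terms of $g$, including the leading one. For $i\ge 0$ let $F_i$ be the free $A$-module with basis the symbols $$e_{i_r}\cdots e_{i_1}\,t_1^{(l_1)}\cdots t_s^{(l_s)},\qquad 1\le i_1<\dots<i_r\le n,\quad l_1,\dots,l_s\ge 0,\quad i=r+2\sum_j l_j,$$ where $t_j^{(0)}=1$. Let $F_\bullet$ carry the associative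 $A$-bilinear product with unit the empty symbol determined by $e_ie_j=-e_je_i$, $e_ie_i=0$, $e_it_j^{(l)}=t_j^{(l)}e_i$, $t_i^{(a)}t_j^{(b)}=t_j^{(b)}t_i^{(a)}$ and $t_j^{(a)}t_j^{(b)}=\binom{a+b}{a}t_j^{(a+b)}$. Define $$\partial(e_{i_r}\cdots e_{i_1})=\sum_{m=1}^r(-1)^{\#\{j\,:\,i_j>i_m\}}x_{i_m}\,e_{i_r}\cdots\widehat{e_{i_m}}\cdots e_{i_1},$$ $$\partial(t_1^{(l_1)}\cdots t_s^{(l_s)})=\sum_{j\,:\,l_j>0}\ \sum_{p=1}^nT_p(f_j)\,e_p\,t_1^{(l_1)}\cdots t_j^{(l_j-1)}\cdots t_s^{(l_s)},$$ $$\partial(e_{i_r}\cdots e_{i_1}t_1^{(l_1)}\cdots t_s^{(l_s)})=\partial(e_{i_r}\cdots e_{i_1})\,t_1^{(l_1)}\cdots t_s^{(l_s)}+(-1)^r\,e_{i_r}\cdots e_{i_1}\,\partial(t_1^{(l_1)}\cdots t_s^{(l_s)}).$$ Then $(F_\bullet,\partial)$, with the augmentation $F_0=A\to k$, is an $A$-free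 resolution of $k$, and with the product above it is a differential graded algebra. If moreover no $f_j$ has a linear term, i.e. $\mathfrak a\subseteq\langle x_1,\dots,x_n\rangle^2$, then this resolution is minimal, i.e. $\partial(F_\bullet)\subseteq\langle x_1,\dots,x_n\rangle F_\bullet$; all $\mathrm{Tor}^A_i(k,k)$ are finite-dimensional over $k$, and $$\sum_{i\ge0}\dim_k\mathrm{Tor}^A_i(k,k)\,t^i=\frac{(1+t)^n}{(1-t^2)^s}.$$ More precisely, let $\Gamma$ be a commutative monoid and let $\deg x_i=w_i\in\Gamma$ be any grading of $S$ for which $\mathfrak a$ is homogeneous (for instance $\Gamma=\mathbb N^n$ with $w_i$ the $i$-th unit vector when $\mathfrak a$ is a monomial ideal). Write $x_i$ and $m_j$ also for the elements of the monoid ring $\mathbb Z[\Gamma]$ belonging to the degrees of $x_i$ and of $m_j$, and $x^\gamma$ for the element belonging to $\gamma\in\Gamma$. Then $F_\bullet$ is a $\Gamma$-graded resolution, with $e_i$ of degree $\deg x_i$ and $t_j^{(l)}$ of degree $l\deg m_j$, and the graded vector spaces $\mathrm{Tor}^A_i(k,k)$, computed from any $\Gamma$-graded free resolution of $k$, satisfy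 $$P^A_k(x,t)=\sum_{i\ge 0,\ \gamma\in\Gamma}\dim_k\mathrm{Tor}^A_i(k,k)_\gamma\;x^\gamma t^i=\frac{\prod_{i=1}^n(1+x_i\,t)}{\prod_{j=1}^s(1-m_j\,t^2)}\quad\text{in }\mathbb Z[\Gamma][[t]].$$ -/

import Mathlib

open scoped TensorProduct

universe u v w

noncomputable section

namespace BachComm

/-! ### Free complexes given by a basis of homogeneous symbols

A non-negatively graded complex of free `A`-modules with chosen basis is stored as one free module
`B →₀ A`, a homological degree `hdeg : B → ℕ` and an endomorphism `d`; the module in homological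
degree `i` is the span of the basis elements `b` with `hdeg b = i`. -/

section FreeComplexes

/-- The free module `F_i` on the basis elements of homological degree `i`. -/
def piece (A : Type*) [CommRing A] {B : Type*} (hdeg : B → ℕ) (i : ℕ) : Submodule A (B →₀ A) :=
  Finsupp.supported A A {b | hdeg b = i}

/-- `⋯ → F_2 → F_1 → F_0 → M → 0` is an exact complex, i.e. `(F_•, d)` with augmentation `ε` is a
free resolution of `M`. (`d` vanishes on `F_0`, `ε` vanishes on `F_i` for `i > 0`.) -/
structure IsFreeResolution {A B M : Type*} [CommRing A] [AddCommGroup M] [Module A M]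
    (hdeg : B → ℕ) (d : (B →₀ A) →ₗ[A] (B →₀ A)) (ε : (B →₀ A) →ₗ[A] M) : Prop where
  d_mem : ∀ i, ∀ z ∈ piece A hdeg (i + 1), d z ∈ piece A hdeg i
  d_zero : ∀ z ∈ piece A hdeg 0, d z = 0
  aug_pos : ∀ i, ∀ z ∈ piece A hdeg (i + 1), ε z = 0
  aug_surjective : ∀ m : M, ∃ z ∈ piece A hdeg 0, ε z = m
  exact_zero : ∀ z ∈ piece A hdeg 0, ε z = 0 ↔ ∃ y ∈ piece A hdeg 1, d y = z
  exact_succ : ∀ i, ∀ z ∈ piece A hdeg (i + 1), d z = 0 ↔ ∃ y ∈ piece A hdeg (i + 2), d y = z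

/-- Minimality: every entry of the matrix of the differential lies in the ideal `𝔪`, that is
`d(F) ⊆ 𝔪 F`. -/
def IsMinimal {A B : Type*} [CommRing A] (𝔪 : Ideal A) (d : (B →₀ A) →ₗ[A] (B →₀ A)) : Prop :=
  ∀ b c : B, d (Finsupp.single b 1) c ∈ 𝔪

/-- `(F_•, d)` together with the `A`-bilinear product `mul` and the element `one` is an
associative unital differential graded `A`-algebra, with differential of degree `-1`. -/
structure IsDGAlgebra {A B : Type*} [CommRing A] (hdeg : B → ℕ)
    (mul : (B →₀ A) →ₗ[A] (B →₀ A) →ₗ[A] (B →₀ A)) (one : B →₀ A)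
    (d : (B →₀ A) →ₗ[A] (B →₀ A)) : Prop where
  one_mem : one ∈ piece A hdeg 0
  mul_mem : ∀ i j, ∀ a ∈ piece A hdeg i, ∀ b ∈ piece A hdeg j, mul a b ∈ piece A hdeg (i + j)
  one_mul : ∀ a, mul one a = a
  mul_one : ∀ a, mul a one = a
  mul_assoc : ∀ a b c, mul (mul a b) c = mul a (mul b c)
  d_mem : ∀ i, ∀ a ∈ piece A hdeg (i + 1), d a ∈ piece A hdeg i
  d_zero : ∀ a ∈ piece A hdeg 0, d a = 0
  d_d : ∀ a, d (d a) = 0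
  leibniz : ∀ i, ∀ a ∈ piece A hdeg i, ∀ b, d (mul a b) = mul (d a) b + (-1 : A) ^ i • mul a (d b)

/-- The span of `M ⊗ e_b`, `b ∈ S`, inside `M ⊗ F`. -/
def tensorPart {A B : Type*} [CommRing A] (M : Type*) [AddCommGroup M] [Module A M]
    (S : Set B) : Submodule A (M ⊗[A] (B →₀ A)) :=
  LinearMap.range ((Finsupp.supported A A S).subtype.lTensor M)

variable {A B Γ : Type*} [CommRing A] (M : Type*) [AddCommGroup M] [Module A M]
  (hdeg : B → ℕ) (deg : B → Γ) (d : (B →₀ A) →ₗ[A] (B →₀ A)) (i : ℕ) (γ : Γ)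

/-- The cycles of `M ⊗ F` in homological degree `i` and internal degree `γ`. -/
def torCycles : Submodule A (M ⊗[A] (B →₀ A)) :=
  tensorPart M {b | hdeg b = i ∧ deg b = γ} ⊓ LinearMap.ker (d.lTensor M)

/-- The boundaries of `M ⊗ F` in homological degree `i` and internal degree `γ`. -/
def torBoundaries : Submodule A (M ⊗[A] (B →₀ A)) :=
  (tensorPart M {b | hdeg b = i + 1 ∧ deg b = γ}).map (d.lTensor M)

/-- `H_i(M ⊗ F)_γ`, where `M` sits in internal degree `0`. If `F` is a graded free resolution
of `N`, this is `Tor_i(M, N)_γ`. -/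
abbrev torPart : Type _ :=
  torCycles M hdeg deg d i γ ⧸
    (torBoundaries M hdeg deg d i γ).comap (torCycles M hdeg deg d i γ).subtype

end FreeComplexes

/-! ### Gröbner bases and the quotient algebra -/

section Groebner

open MvPolynomial

/-- The initial ideal of `I`. -/
def initialIdeal {k : Type*} [Field k] {σ : Type*} (m : MonomialOrder σ)
    (I : Ideal (MvPolynomial σ k)) : Ideal (MvPolynomial σ k) :=
  Ideal.span {p | ∃ g ∈ I, g ≠ 0 ∧ p = monomial (m.degree g) 1}

/-- `f_1, …, f_s` is the reduced Gröbner basis of the ideal it generates. -/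
structure IsReducedGroebnerBasis {k : Type*} [Field k] {σ : Type*} (m : MonomialOrder σ)
    {s : ℕ} (f : Fin s → MvPolynomial σ k) : Prop where
  monic : ∀ j, m.leadingCoeff (f j) = 1
  groebner : initialIdeal m (Ideal.span (Set.range f)) =
    Ideal.span (Set.range fun j => monomial (m.degree (f j)) (1 : k))
  reduced : ∀ i j, i ≠ j → ∀ α ∈ (f i).support, ¬ m.degree (f j) ≤ α

/-- An ideal is a complete intersection if it is generated by a regular sequence. -/
def IsCompleteIntersection {R : Type*} [CommRing R] (I : Ideal R) : Prop :=
  ∃ rs : List R, RingTheory.Sequence.IsRegular R rs ∧ Ideal.ofList rs = I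

variable {k : Type*} [Field k] {n s : ℕ}

/-- The algebra `A = k[x_1, …, x_n] / ⟨f_1, …, f_s⟩`. -/
abbrev QuotAlg (f : Fin s → MvPolynomial (Fin n) k) : Type _ :=
  MvPolynomial (Fin n) k ⧸ Ideal.span (Set.range f)

variable (f : Fin s → MvPolynomial (Fin n) k)

/-- The class of the variable `x_i` in `A`. -/
def var (i : Fin n) : QuotAlg f := Ideal.Quotient.mk _ (X i)

/-- The ideal `⟨x_1, …, x_n⟩` of `A`. -/
def augIdeal : Ideal (QuotAlg f) := Ideal.span (Set.range (var f))

/-- The residue class field `A / ⟨x_1, …, x_n⟩` (it is `k` when all `f_j` have constant term `0`). -/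
abbrev ResField : Type _ := QuotAlg f ⧸ augIdeal f

/-- `T_p(g)`: the sum of `c_α x^α / x_p` over all terms `c_α x^α` of `g` (the leading one
included) for which `x_p` is the last variable dividing `x^α`. -/
def lastVarPart (p : Fin n) (g : MvPolynomial (Fin n) k) : MvPolynomial (Fin n) k :=
  ∑ α ∈ g.support with α.support.max = (p : WithBot (Fin n)),
    monomial (α - Finsupp.single p 1) (coeff α g)

/-- For a weight `w`, the image in `A` of the polynomials that are homogeneous of degree `δ`
for the grading `deg x_i = w i`. -/
def homogeneousPart {Γ : Type*} [AddCommMonoid Γ] (w : Fin n → Γ) (δ : Γ) :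
    Submodule k (QuotAlg f) :=
  (weightedHomogeneousSubmodule k w δ).map
    (Ideal.Quotient.mkₐ k (Ideal.span (Set.range f))).toLinearMap

/-- The internal degrees `deg b` make `d` and `ε` (with values in the residue class field, placed
in degree `0`) homogeneous of degree `0`: the coefficient of `e_c` in `d e_b` is homogeneous of
degree `deg b - deg c`, and `ε e_b = 0` unless `deg b = 0`. -/
structure IsGradedBy {Γ : Type*} [AddCommMonoid Γ] (w : Fin n → Γ) {B : Type*} (deg : B → Γ)
    (d : (B →₀ QuotAlg f) →ₗ[QuotAlg f] (B →₀ QuotAlg f))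
    (ε : (B →₀ QuotAlg f) →ₗ[QuotAlg f] ResField f) : Prop where
  d_homogeneous : ∀ b c, d (Finsupp.single b 1) c ∈
    ⨆ (δ : Γ) (_ : δ + deg c = deg b), homogeneousPart f w δ
  aug_homogeneous : ∀ b, deg b ≠ 0 → ε (Finsupp.single b 1) = 0

end Groebner

/-! ### The complex -/

section Complex

/-- The pair `(I, l)` is the symbol `e_{i_r} ⋯ e_{i_1} t_1^{(l_1)} ⋯ t_s^{(l_s)}`, where
`I = {i_1 < ⋯ < i_r}`; a factor `t_j^{(0)}` is `1`. -/
abbrev Symb (n s : ℕ) : Type := Finset (Fin n) × (Fin s → ℕ)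

variable {n s : ℕ}

/-- The homological degree `r + 2 (l_1 + ⋯ + l_s)`. -/
def hdeg (b : Symb n s) : ℕ := b.1.card + 2 * ∑ j, b.2 j

/-- The internal degree in which `e_i` has degree `w i` and `t_j` has degree `v j`. -/
def intDeg {Γ : Type*} [AddCommMonoid Γ] (w : Fin n → Γ) (v : Fin s → Γ) (b : Symb n s) : Γ :=
  ∑ i ∈ b.1, w i + ∑ j, b.2 j • v j

/-- The product of two symbols, from `e_i e_j = - e_j e_i`, `e_i e_i = 0`, `e_i t_j = t_j e_i`
and `t_j^{(a)} t_j^{(b)} = (a+b choose a) t_j^{(a+b)}`. The sign is the one that brings the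
product of two decreasing words in the `e_i` into decreasing order. -/
def symbMul (A : Type*) [CommRing A] (b c : Symb n s) : Symb n s →₀ A :=
  if Disjoint b.1 c.1 then
    Finsupp.single (b.1 ∪ c.1, b.2 + c.2)
      ((-1) ^ ((b.1 ×ˢ c.1).filter fun q => q.1 < q.2).card *
        ((∏ j, (b.2 j + c.2 j).choose (b.2 j) : ℕ) : A))
  else 0

/-- The `A`-bilinear extension of the product of symbols. -/
def mul (A : Type*) [CommRing A] :
    (Symb n s →₀ A) →ₗ[A] (Symb n s →₀ A) →ₗ[A] (Symb n s →₀ A) :=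
  Finsupp.linearCombination A fun b => Finsupp.linearCombination A fun c => symbMul A b c

/-- The empty symbol, the unit of the product. -/
def one (A : Type*) [CommRing A] : Symb n s →₀ A := Finsupp.single (∅, 0) 1

variable {A : Type*} [CommRing A]

/-- `∂(e_{i_r} ⋯ e_{i_1}) = ∑_m (-1)^{#{i_j > i_m}} x_{i_m} e_{i_r} ⋯ ê_{i_m} ⋯ e_{i_1}`. -/
def diffE (x : Fin n → A) (I : Finset (Fin n)) : Symb n s →₀ A :=
  ∑ i ∈ I, Finsupp.single (I.erase i, 0) ((-1) ^ (I.filter fun i' => i < i').card * x i)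

/-- `∂(t_1^{(l_1)} ⋯ t_s^{(l_s)}) = ∑_{j, l_j > 0} ∑_p T_p(f_j) e_p t_1^{(l_1)} ⋯ t_j^{(l_j - 1)} ⋯`,
with `T p j` in place of `T_p(f_j)`. -/
def diffT (T : Fin n → Fin s → A) (l : Fin s → ℕ) : Symb n s →₀ A :=
  ∑ j with 0 < l j, ∑ p, Finsupp.single ({p}, l - Pi.single j 1) (T p j)

/-- The differential
`∂(e_I t^{(l)}) = ∂(e_I) t^{(l)} + (-1)^r e_I ∂(t^{(l)})`, `r` the number of elements of `I`. -/
def diffSymb (x : Fin n → A) (T : Fin n → Fin s → A) (b : Symb n s) : Symb n s →₀ A :=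
  mul A (diffE x b.1) (Finsupp.single (∅, b.2) 1) +
    (-1 : A) ^ b.1.card • mul A (Finsupp.single (b.1, 0) 1) (diffT T b.2)

variable {k : Type*} [Field k] (f : Fin s → MvPolynomial (Fin n) k)

/-- The differential of the complex attached to `f_1, …, f_s`. -/
def diff : (Symb n s →₀ QuotAlg f) →ₗ[QuotAlg f] (Symb n s →₀ QuotAlg f) :=
  Finsupp.linearCombination (QuotAlg f)
    (diffSymb (var f) fun p j => Ideal.Quotient.mk _ (lastVarPart p (f j)))

/-- The augmentation `F_0 = A → A / ⟨x_1, …, x_n⟩`, extended by `0`. -/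
def aug : (Symb n s →₀ QuotAlg f) →ₗ[QuotAlg f] ResField f :=
  Finsupp.linearCombination (QuotAlg f) fun b => if b = (∅, 0) then 1 else 0

end Complex

/-! ### Tor -/

section Tor

open CategoryTheory

variable {k : Type u} [Field k] {n s : ℕ} (f : Fin s → MvPolynomial (Fin n) k)

/-- `Tor_i^A(k, k)` as a `k`-vector space. -/
def torResField (i : ℕ) : ModuleCat.{u} k :=
  (ModuleCat.restrictScalars (algebraMap k (QuotAlg f))).obj
    (((Tor (ModuleCat.{u} (QuotAlg f)) i).obj (ModuleCat.of _ (ResField f))).obj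
      (ModuleCat.of _ (ResField f)))

end Tor

end BachComm

end

/-! Over `S` the differential reads `d = κ + ∑ Z_j λ_j`. Here `κ` is the Koszul differential of the
variables, `λ_j` lowers the divided power of `t_j`, and `Z_j` is left multiplication by the chain `∑
T_p(f_j) e_p`. The Koszul boundary of that chain is `f_j`, because every non-constant monomial has
exactly one last variable. The anticommutation relations between contractions and exterior
multiplications give `d² = ∑ f_j λ_j` (`genDiff_sq`), which vanishes over `A`. Contractions are odd
derivations and the `λ_j` are derivations, so `d` satisfies the Leibniz rule (`genDiff_mul`).

Exactness is Tate's killing of cycles. The Koszul complex over `S` is exact in positive degrees, by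
an explicit homotopy. When the nonzerodivisor `f_i` is divided out, new homology appears in degree
one only: it is generated by the class of `∑ T_p(f_i) e_p` and is isomorphic to `H_0`. Adjoining the
divided power variable `t_i` kills this class and creates nothing else (`StageExact.succ`).

The `f_j` do form a regular sequence. Minimal monomial generators of a complete intersection are
pairwise coprime, by a determinant argument (`disjoint_of_isCompleteIntersection`). Polynomials with
pairwise coprime leading monomials form a regular sequence, since leading terms cannot cancel
(`mem_idealLT_of_mul_mem`).

Without linear terms in the `f_j` the matrix of `d` has entries in the maximal ideal, so the
differential of `k ⊗ F` is zero and `Tor` is counted by the symbols, whose generating function is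
the stated product. For another graded resolution `G`, a graded comparison map `F → G` is
constructed and its mapping cone is contracted. The resulting homotopy inverse need not be graded;
it is enough to project onto a graded part after tensoring with `k` (`exists_torPart_equiv`).
Nothing requires `Γ` to be cancellative. -/

namespace BachComm

/-! ### Signs, divided powers and the product of symbols -/

section Algebra

variable {n s : ℕ}

/-- The sign that brings the product of two decreasing words into decreasing order. -/
def sgn (A : Type*) [CommRing A] (I J : Finset (Fin n)) : A :=
  (-1) ^ ((I ×ˢ J).filter fun q => q.1 < q.2).card

section Sign

variable {A : Type*} [CommRing A]

lemma sgn_union_left {I I' : Finset (Fin n)} (h : Disjoint I I') (J : Finset (Fin n)) :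
    sgn A (I ∪ I') J = sgn A I J * sgn A I' J := by
  rw [sgn, sgn, sgn, ← pow_add, Finset.union_product, Finset.filter_union,
    Finset.card_union_of_disjoint]
  rw [Finset.disjoint_left] at h ⊢
  simp only [Finset.mem_filter, Finset.mem_product]
  rintro ⟨a, b⟩ h1 h2
  exact h h1.1.1 h2.1.1

lemma sgn_union_right {J J' : Finset (Fin n)} (h : Disjoint J J') (I : Finset (Fin n)) :
    sgn A I (J ∪ J') = sgn A I J * sgn A I J' := by
  rw [sgn, sgn, sgn, ← pow_add, Finset.product_union, Finset.filter_union,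
    Finset.card_union_of_disjoint]
  rw [Finset.disjoint_left] at h ⊢
  simp only [Finset.mem_filter, Finset.mem_product]
  rintro ⟨a, b⟩ h1 h2
  exact h h1.1.2 h2.1.2

lemma sgn_mul_self (I J : Finset (Fin n)) : sgn A I J * sgn A I J = 1 := by
  rw [sgn, ← pow_add, ← two_mul, pow_mul]; simp

@[simp] lemma sgn_empty_left (J : Finset (Fin n)) : sgn A ∅ J = 1 := by simp [sgn]

@[simp] lemma sgn_empty_right (J : Finset (Fin n)) : sgn A J ∅ = 1 := by simp [sgn]

@[simp] lemma sgn_singleton_self (i : Fin n) : sgn A {i} {i} = 1 := by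
  simp [sgn, Finset.filter_singleton]

lemma sgn_singleton_left (i : Fin n) (I : Finset (Fin n)) :
    sgn A {i} I = (-1) ^ (I.filter fun i' => i < i').card := by
  rw [sgn, Finset.singleton_product, Finset.filter_map, Finset.card_map]
  rfl

/-- Swapping coordinates turns the pairs counted by the second sign into the pairs of `I ×ˢ J` not
counted by the first, as disjointness excludes equal coordinates. Together they exhaust `I ×ˢ J`. -/
lemma sgn_comm {I J : Finset (Fin n)} (h : Disjoint I J) :
    sgn A I J * sgn A J I = (-1) ^ (I.card * J.card) := by
  have h1 : ((J ×ˢ I).filter fun q => q.1 < q.2).card =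
      ((I ×ˢ J).filter fun q => ¬ q.1 < q.2).card := by
    refine Finset.card_bij (fun q _ => (q.2, q.1)) ?_ ?_ ?_
    · rintro ⟨a, b⟩ hab
      simp only [Finset.mem_filter, Finset.mem_product] at hab ⊢
      exact ⟨⟨hab.1.2, hab.1.1⟩, not_lt.2 hab.2.le⟩
    · rintro ⟨a, b⟩ _ ⟨c, d⟩ _ h
      simp only [Prod.mk.injEq] at h ⊢
      exact ⟨h.2, h.1⟩
    · rintro ⟨a, b⟩ hab
      simp only [Finset.mem_filter, Finset.mem_product] at hab
      refine ⟨(b, a), ?_, rfl⟩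
      simp only [Finset.mem_filter, Finset.mem_product]
      refine ⟨⟨hab.1.2, hab.1.1⟩, lt_of_le_of_ne (not_lt.1 hab.2) ?_⟩
      rintro rfl
      exact Finset.disjoint_left.1 h hab.1.1 hab.1.2
  rw [sgn, sgn, ← pow_add, h1, Finset.card_filter_add_card_filter_not, Finset.card_product]

lemma sgn_comm' {I J : Finset (Fin n)} (h : Disjoint I J) :
    sgn A I J = (-1) ^ (I.card * J.card) * sgn A J I := by
  rw [← sgn_comm h, mul_assoc, sgn_mul_self, mul_one]

lemma sgn_erase_right {i : Fin n} {J : Finset (Fin n)} (h : i ∈ J) (I : Finset (Fin n)) :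
    sgn A I (J.erase i) = sgn A I {i} * sgn A I J := by
  have h1 : sgn A I J = sgn A I {i} * sgn A I (J.erase i) := by
    rw [← sgn_union_right (by simp)]
    congr 1
    rw [← Finset.insert_eq, Finset.insert_erase h]
  rw [h1, ← mul_assoc, sgn_mul_self, one_mul]

lemma sgn_erase_left {i : Fin n} {J : Finset (Fin n)} (h : i ∈ J) (I : Finset (Fin n)) :
    sgn A (J.erase i) I = sgn A {i} I * sgn A J I := by
  have h1 : sgn A J I = sgn A {i} I * sgn A (J.erase i) I := by
    rw [← sgn_union_left (by simp)]
    congr 1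
    rw [← Finset.insert_eq, Finset.insert_erase h]
  rw [h1, ← mul_assoc, sgn_mul_self, one_mul]

end Sign

section Product

variable (A : Type*) [CommRing A]

lemma finsupp_hom_ext {A B N : Type*} [CommRing A] [AddCommMonoid N] [Module A N]
    {φ ψ : (B →₀ A) →ₗ[A] N}
    (h : ∀ b, φ (Finsupp.single b 1) = ψ (Finsupp.single b 1)) : φ = ψ := by
  ext b; exact h b

lemma mul_single (b c : Symb n s) (r t : A) :
    mul A (Finsupp.single b r) (Finsupp.single c t) = (r * t) • symbMul A b c := by
  simp [mul, mul_smul]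

lemma mul_single_one (b c : Symb n s) :
    mul A (Finsupp.single b 1) (Finsupp.single c 1) = symbMul A b c := by
  simp [mul_single]

/-- The binomial coefficient in a product of two divided power monomials. -/
def binom (l m : Fin s → ℕ) : ℕ := ∏ j, (l j + m j).choose (l j)

lemma symbMul_eq (b c : Symb n s) : symbMul A b c = if Disjoint b.1 c.1 then
    Finsupp.single (b.1 ∪ c.1, b.2 + c.2) (sgn A b.1 c.1 * (binom b.2 c.2 : A)) else 0 := rfl

/-- In each coordinate both sides are the multinomial coefficient of `l j, m j, q j`; multiplying by
the three factorials gives `(l j + m j + q j)!` on either side. -/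
lemma binom_assoc (l m q : Fin s → ℕ) :
    binom l m * binom (l + m) q = binom m q * binom l (m + q) := by
  unfold binom
  rw [← Finset.prod_mul_distrib, ← Finset.prod_mul_distrib]
  refine Finset.prod_congr rfl fun j _ => ?_
  simp only [Pi.add_apply]
  have key : ∀ a b : ℕ, (a + b).choose a * a.factorial * b.factorial = (a + b).factorial :=
    fun a b => by rw [Nat.choose_symm_add, Nat.add_choose_mul_factorial_mul_factorial]
  have h1 := key (l j) (m j)
  have h2 := key (l j + m j) (q j)
  have h3 := key (m j) (q j)
  have h4 := key (l j) (m j + q j)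
  have p1 := Nat.factorial_pos (l j)
  have p2 := Nat.factorial_pos (m j)
  have p3 := Nat.factorial_pos (q j)
  have p4 := Nat.factorial_pos (l j + m j)
  have p5 := Nat.factorial_pos (m j + q j)
  refine Nat.eq_of_mul_eq_mul_right (Nat.mul_pos (Nat.mul_pos p1 p2) p3) ?_
  rw [← add_assoc] at h4
  have e1 : (l j + m j).choose (l j) * (l j + m j + q j).choose (l j + m j) *
      ((l j).factorial * (m j).factorial * (q j).factorial) = (l j + m j + q j).factorial := by
    rw [← h2, ← h1]; ring
  have e2 : (m j + q j).choose (m j) * (l j + m j + q j).choose (l j) *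
      ((l j).factorial * (m j).factorial * (q j).factorial) = (l j + m j + q j).factorial := by
    rw [← h4, ← h3]; ring
  rw [← add_assoc, e1, e2]

@[simp] lemma binom_zero_left (l : Fin s → ℕ) : binom 0 l = 1 := by simp [binom]

@[simp] lemma binom_zero_right (l : Fin s → ℕ) : binom l 0 = 1 := by simp [binom]

lemma mul_one' (a : Symb n s →₀ A) : mul A a (one A) = a := by
  suffices h : (mul A).flip (one A) = LinearMap.id from LinearMap.congr_fun h a
  refine finsupp_hom_ext fun b => ?_
  simp [one, mul_single, symbMul_eq]

lemma one_mul' (a : Symb n s →₀ A) : mul A (one A) a = a := by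
  suffices h : mul A (one A) = LinearMap.id from LinearMap.congr_fun h a
  refine finsupp_hom_ext fun b => ?_
  simp [one, mul_single, symbMul_eq]

/-- The sign is multiplicative under disjoint unions in either argument, so both bracketings carry
the sign `sgn I J * sgn I K * sgn J K`; the divided powers are handled by `binom_assoc`. -/
lemma mul_assoc' (a b c : Symb n s →₀ A) :
    mul A (mul A a b) c = mul A a (mul A b c) := by
  induction a using Finsupp.induction_linear with
  | zero => simp
  | add a a' ha ha' => simp [ha, ha']
  | single a r =>
  induction b using Finsupp.induction_linear with
  | zero => simp
  | add b b' ha ha' => simp [ha, ha']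
  | single b t =>
  induction c using Finsupp.induction_linear with
  | zero => simp
  | add b b' ha ha' => simp [ha, ha']
  | single c q =>
  obtain ⟨I, l⟩ := a
  obtain ⟨J, m⟩ := b
  obtain ⟨K, o⟩ := c
  simp only [mul_single, symbMul_eq, map_smul, LinearMap.smul_apply]
  by_cases h1 : Disjoint I J <;> by_cases h2 : Disjoint J K <;> by_cases h3 : Disjoint I K <;>
    simp only [h1, h2, h3, if_true, if_false, mul_single, symbMul_eq, map_zero,
      LinearMap.zero_apply, smul_zero, Finset.disjoint_union_left, Finset.disjoint_union_right,
      and_true, and_false, Finset.union_assoc, add_assoc]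
  rw [Finsupp.smul_single, Finsupp.smul_single, Finsupp.smul_single, Finsupp.smul_single,
    sgn_union_left h1, sgn_union_right h2]
  congr 1
  have := congrArg (Nat.cast : ℕ → A) (binom_assoc l m o)
  push_cast at this
  simp only [smul_eq_mul]
  linear_combination (r * t * q * sgn A I J * sgn A I K * sgn A J K) * this

variable {A}

lemma single_mem_piece {B : Type*} {hd : B → ℕ} {b : B} {i : ℕ} (h : hd b = i) (r : A) :
    Finsupp.single b r ∈ piece A hd i :=
  Finsupp.single_mem_supported A r h

/-- To prove a property, closed under sums, for all elements of a piece it is enough to do this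
for multiples of basis elements. -/
lemma piece_induction {B : Type*} {hd : B → ℕ} {i : ℕ} {P : (B →₀ A) → Prop} (h0 : P 0)
    (hadd : ∀ y z, P y → P z → P (y + z))
    (hs : ∀ b r, hd b = i → P (Finsupp.single b r)) {z : B →₀ A} (hz : z ∈ piece A hd i) :
    P z := by
  rw [piece, Finsupp.mem_supported] at hz
  rw [← Finsupp.sum_single z]
  refine Finset.sum_induction _ P (fun a b ha hb => hadd a b ha hb) h0 fun b hb => ?_
  exact hs b _ (hz hb)

lemma hom_piece {B C : Type*} {hd : B → ℕ} {hd' : C → ℕ} {i j : ℕ}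
    {φ : (B →₀ A) →ₗ[A] (C →₀ A)}
    (h : ∀ b, hd b = i → φ (Finsupp.single b 1) ∈ piece A hd' j) {z : B →₀ A}
    (hz : z ∈ piece A hd i) : φ z ∈ piece A hd' j := by
  refine piece_induction (P := fun z => φ z ∈ piece A hd' j) (by simp)
    (fun y z hy hz => by rw [map_add]; exact add_mem hy hz) (fun b r hb => ?_) hz
  rw [← mul_one r, ← smul_eq_mul, ← Finsupp.smul_single, map_smul]
  exact Submodule.smul_mem _ _ (h b hb)

lemma hom_piece_eq {B N : Type*} [AddCommGroup N] [Module A N] {hd : B → ℕ} {i : ℕ}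
    {φ ψ : (B →₀ A) →ₗ[A] N}
    (h : ∀ b, hd b = i → φ (Finsupp.single b 1) = ψ (Finsupp.single b 1)) {z : B →₀ A}
    (hz : z ∈ piece A hd i) : φ z = ψ z := by
  refine piece_induction (P := fun z => φ z = ψ z) (by simp)
    (fun y z hy hz => by rw [map_add, map_add, hy, hz]) (fun b r hb => ?_) hz
  rw [← mul_one r, ← smul_eq_mul, ← Finsupp.smul_single, map_smul, map_smul, h b hb]

lemma mul_mem_piece {i j : ℕ} {a b : Symb n s →₀ A} (ha : a ∈ piece A hdeg i)
    (hb : b ∈ piece A hdeg j) : mul A a b ∈ piece A hdeg (i + j) := by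
  refine hom_piece (fun c hc => ?_) hb
  refine hom_piece (φ := (mul A).flip (Finsupp.single c 1)) (fun d hd => ?_) ha
  rw [LinearMap.flip_apply, mul_single_one, symbMul_eq]
  split_ifs with h
  · refine single_mem_piece ?_ _
    rw [← hc, ← hd]
    simp only [hdeg, Finset.card_union_of_disjoint h, Pi.add_apply, Finset.sum_add_distrib]
    ring
  · exact zero_mem _

end Product

/-! ### Contractions, lowering operators and exterior multiplications -/

section Operators

variable (A : Type*) [CommRing A]

/-- Contraction with the dual of `e_i`. -/
noncomputable def contr (i : Fin n) : Module.End A (Symb n s →₀ A) :=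
  Finsupp.linearCombination A fun b =>
    if i ∈ b.1 then Finsupp.single (b.1.erase i, b.2) (sgn A {i} b.1) else 0

/-- The derivation `t_j^{(l)} ↦ t_j^{(l-1)}`. -/
noncomputable def lower (j : Fin s) : Module.End A (Symb n s →₀ A) :=
  Finsupp.linearCombination A fun b =>
    if 0 < b.2 j then Finsupp.single (b.1, b.2 - Pi.single j 1) 1 else 0

/-- Left multiplication by `e_p`. -/
noncomputable def extMul (p : Fin n) : Module.End A (Symb n s →₀ A) :=
  mul A (Finsupp.single ({p}, 0) 1)

lemma contr_single (i : Fin n) (b : Symb n s) : contr A i (Finsupp.single b 1) =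
    if i ∈ b.1 then Finsupp.single (b.1.erase i, b.2) (sgn A {i} b.1) else 0 := by
  simp [contr]

lemma lower_single (j : Fin s) (b : Symb n s) : lower A j (Finsupp.single b 1) =
    if 0 < b.2 j then Finsupp.single (b.1, b.2 - Pi.single j 1) 1 else 0 := by
  simp [lower]

lemma extMul_single (p : Fin n) (b : Symb n s) : extMul A p (Finsupp.single b 1) =
    if p ∉ b.1 then Finsupp.single (insert p b.1, b.2) (sgn A {p} b.1) else 0 := by
  simp [extMul, mul_single, symbMul_eq]

/-- The differential, with general coefficients. -/
noncomputable def genDiff {A : Type*} [CommRing A] (x : Fin n → A) (T : Fin n → Fin s → A) :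
    Module.End A (Symb n s →₀ A) :=
  ∑ i, x i • contr A i + ∑ j, ∑ p, T p j • (extMul A p * lower A j)

lemma single_eq_smul {A B : Type*} [CommRing A] (b : B) (r : A) :
    Finsupp.single b r = r • Finsupp.single b (1 : A) := by simp

/-- The definition multiplies `e_p` from the right of `e_I` with the factor `(-1)^r`; moving `e_p`
to the left of the `r` letters absorbs exactly this sign. In operator form, identities for the
differential follow from those of three simple families of operators. -/
lemma genDiff_single {A : Type*} [CommRing A] (x : Fin n → A) (T : Fin n → Fin s → A)
    (b : Symb n s) : genDiff x T (Finsupp.single b 1) = diffSymb x T b := by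
  obtain ⟨I, l⟩ := b
  rw [genDiff, diffSymb, LinearMap.add_apply]
  congr 1
  · rw [LinearMap.sum_apply, diffE, map_sum, LinearMap.sum_apply,
      ← Finset.sum_subset (Finset.subset_univ I)]
    · refine Finset.sum_congr rfl fun i hi => ?_
      rw [LinearMap.smul_apply, contr_single, if_pos hi, mul_single, symbMul_eq]
      simp [sgn_singleton_left, mul_comm]
    · intro i _ hi
      simp [contr_single, hi]
  · rw [LinearMap.sum_apply, diffT, map_sum, Finset.smul_sum,
      ← Finset.sum_subset (Finset.subset_univ ({j | 0 < l j} : Finset (Fin s)))]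
    · refine Finset.sum_congr rfl fun j hj => ?_
      rw [LinearMap.sum_apply, map_sum, Finset.smul_sum]
      refine Finset.sum_congr rfl fun p _ => ?_
      rw [Finset.mem_filter] at hj
      rw [LinearMap.smul_apply, Module.End.mul_apply, lower_single, if_pos hj.2, extMul_single,
        mul_single, symbMul_eq]
      by_cases hp : p ∈ I
      · simp [hp]
      · rw [if_pos hp, if_pos (by simpa using hp), sgn_comm' (by simpa using hp)]
        simp only [Finsupp.smul_single, Finset.insert_eq, Finset.union_comm, zero_add,
          binom_zero_left]
        congr 1
        simp
        ring
    · intro j _ hj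
      have : ¬ 0 < l j := by simpa using hj
      simp [lower_single, this]

variable {A}

lemma contr_mem {i : Fin n} {m : ℕ} {z : Symb n s →₀ A} (hz : z ∈ piece A hdeg (m + 1)) :
    contr A i z ∈ piece A hdeg m := by
  refine hom_piece (fun b hb => ?_) hz
  rw [contr_single]
  split_ifs with h
  · refine single_mem_piece ?_ _
    simp only [hdeg] at hb ⊢
    have := Finset.card_erase_add_one h
    omega
  · exact zero_mem _

lemma contr_zero {i : Fin n} {z : Symb n s →₀ A} (hz : z ∈ piece A hdeg 0) :
    contr A i z = 0 := by
  rw [hom_piece_eq (ψ := 0) (fun b hb => ?_) hz]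
  · rfl
  rw [contr_single, if_neg, LinearMap.zero_apply]
  intro h
  have := Finset.card_pos.2 ⟨i, h⟩
  simp only [hdeg] at hb
  omega

lemma sum_sub_single {l : Fin s → ℕ} {j : Fin s} (h : 0 < l j) :
    ∑ i, (l - Pi.single j 1 : Fin s → ℕ) i + 1 = ∑ i, l i := by
  have h1 : l = (l - Pi.single j 1) + Pi.single j 1 := by
    ext i
    by_cases hi : i = j
    · subst hi; simp; omega
    · simp [hi]
  conv_rhs => rw [h1]
  simp [Finset.sum_add_distrib]

lemma lower_mem {j : Fin s} {m : ℕ} {z : Symb n s →₀ A} (hz : z ∈ piece A hdeg (m + 2)) :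
    lower A j z ∈ piece A hdeg m := by
  refine hom_piece (fun b hb => ?_) hz
  rw [lower_single]
  split_ifs with h
  · refine single_mem_piece ?_ _
    simp only [hdeg] at hb ⊢
    have := sum_sub_single h
    omega
  · exact zero_mem _

lemma lower_zero {j : Fin s} {m : ℕ} (hm : m < 2) {z : Symb n s →₀ A}
    (hz : z ∈ piece A hdeg m) : lower A j z = 0 := by
  rw [hom_piece_eq (ψ := 0) (fun b hb => ?_) hz]
  · rfl
  rw [lower_single, if_neg, LinearMap.zero_apply]
  intro h
  have := sum_sub_single h
  simp only [hdeg] at hb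
  omega

lemma extMul_mem {p : Fin n} {m : ℕ} {z : Symb n s →₀ A} (hz : z ∈ piece A hdeg m) :
    extMul A p z ∈ piece A hdeg (m + 1) := by
  rw [add_comm]
  exact mul_mem_piece (single_mem_piece (by simp [hdeg]) _) hz

lemma genDiff_mem {x : Fin n → A} {T : Fin n → Fin s → A} {m : ℕ} {z : Symb n s →₀ A}
    (hz : z ∈ piece A hdeg (m + 1)) : genDiff x T z ∈ piece A hdeg m := by
  simp only [genDiff, LinearMap.add_apply, LinearMap.sum_apply, LinearMap.smul_apply,
    Module.End.mul_apply]
  refine add_mem (sum_mem fun i _ => Submodule.smul_mem _ _ (contr_mem hz))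
    (sum_mem fun j _ => sum_mem fun p _ => Submodule.smul_mem _ _ ?_)
  cases m with
  | zero => rw [lower_zero (by omega) hz, map_zero]; exact zero_mem _
  | succ m => exact extMul_mem (lower_mem hz)

lemma genDiff_zero {x : Fin n → A} {T : Fin n → Fin s → A} {z : Symb n s →₀ A}
    (hz : z ∈ piece A hdeg 0) : genDiff x T z = 0 := by
  simp [genDiff, contr_zero hz, lower_zero (by omega : 0 < 2) hz]

lemma contr_add_contr (i j : Fin n) :
    contr A i * contr A j + contr A j * contr A i = (0 : Module.End A (Symb n s →₀ A)) := by
  refine finsupp_hom_ext fun b => ?_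
  obtain ⟨I, l⟩ := b
  simp only [Module.End.mul_apply, LinearMap.add_apply, contr_single]
  by_cases hij : i = j
  · subst hij
    by_cases hi : i ∈ I
    · rw [if_pos hi, single_eq_smul, map_smul, contr_single]
      simp
    · simp [hi]
  by_cases hi : i ∈ I <;> by_cases hj : j ∈ I
  · rw [if_pos hi, if_pos hj, single_eq_smul, map_smul, contr_single, if_pos (by simp [hi, hij]),
      single_eq_smul (I.erase i, l), map_smul, contr_single, if_pos (by simp [hj, Ne.symm hij]),
      sgn_erase_right hj, sgn_erase_right hi, Finset.erase_right_comm, Finsupp.smul_single,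
      Finsupp.smul_single, ← Finsupp.single_add, sgn_comm' (I := {i}) (J := {j}) (by simp [hij]),
      LinearMap.zero_apply, Finsupp.single_eq_zero]
    simp
    ring
  · rw [if_pos hi, if_neg hj, single_eq_smul, map_smul, contr_single, if_neg (by simp [hj])]
    simp
  · rw [if_neg hi, if_pos hj, single_eq_smul, map_smul, contr_single, if_neg (by simp [hi])]
    simp
  · simp [hi, hj]

lemma contr_sq (i : Fin n) :
    contr A i * contr A i = (0 : Module.End A (Symb n s →₀ A)) := by
  refine finsupp_hom_ext fun b => ?_
  simp only [Module.End.mul_apply, contr_single]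
  split_ifs with hi
  · rw [single_eq_smul, map_smul, contr_single]
    simp
  · simp

/-- Neither sign sees the pair `(i, i)`, so `i` may be erased from `I`. The sets are then disjoint
and the exponent is `I.card - 1`, whence the extra minus sign. -/
lemma sgn_singleton_mem {i : Fin n} {I : Finset (Fin n)} (h : i ∈ I) :
    sgn A {i} I = -(-1) ^ I.card * sgn A I {i} := by
  have h1 := sgn_erase_right (A := A) h {i}
  have h2 := sgn_erase_left (A := A) h {i}
  rw [sgn_singleton_self, one_mul] at h1 h2
  rw [← h1, ← h2, sgn_comm' (by simp), ← Finset.card_erase_add_one h, pow_succ]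
  simp

/-- The delicate case is `i` in both factors: the product vanishes, while the two terms on the right
are supported on the same symbol and cancel by `sgn_singleton_mem`. In the other cases at most one
term on the right survives. -/
lemma contr_symbMul (i : Fin n) (b c : Symb n s) : contr A i (mul A (Finsupp.single b 1)
      (Finsupp.single c 1)) =
    mul A (contr A i (Finsupp.single b 1)) (Finsupp.single c 1) +
      (-1 : A) ^ b.1.card • mul A (Finsupp.single b 1) (contr A i (Finsupp.single c 1)) := by
  obtain ⟨I, l⟩ := b
  obtain ⟨J, q⟩ := c
  simp only [contr_single, mul_single_one, symbMul_eq]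
  by_cases hi : i ∈ I <;> by_cases hj : i ∈ J
  · have hd : ¬ Disjoint I J := fun h => Finset.disjoint_left.1 h hi hj
    rw [if_neg hd, if_pos hi, if_pos hj, mul_single, mul_single, symbMul_eq, symbMul_eq]
    simp only [Finset.disjoint_erase_comm, map_zero]
    by_cases h : Disjoint I (J.erase i)
    · have h1 : I.erase i ∪ J = I ∪ J := by
        ext a; by_cases ha : a = i <;> simp [ha, hi, hj]
      have h2 : I ∪ J.erase i = I ∪ J := by
        ext a; by_cases ha : a = i <;> simp [ha, hi, hj]
      rw [if_pos h, if_pos h, h1, h2, sgn_erase_left hi, sgn_erase_right hj, sgn_singleton_mem hi]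
      simp only [Finsupp.smul_single, ← Finsupp.single_add]
      symm
      rw [Finsupp.single_eq_zero]
      simp
      ring
    · simp [h]
  · rw [if_pos hi, if_neg hj, mul_single, symbMul_eq, map_zero, smul_zero, add_zero]
    have h0 : Disjoint (I.erase i) J ↔ Disjoint I J := by
      rw [Finset.disjoint_erase_comm, Finset.erase_eq_of_notMem hj]
    simp only [h0]
    split_ifs with h
    · rw [single_eq_smul, map_smul, contr_single, if_pos (by simp [hi]), sgn_union_right h,
        Finset.erase_union_distrib, Finset.erase_eq_of_notMem hj, sgn_erase_left hi]
      simp only [Finsupp.smul_single]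
      congr 1
      simp
      ring
    · simp
  · rw [if_neg hi, if_pos hj, mul_single, symbMul_eq, map_zero, LinearMap.zero_apply, zero_add]
    have h0 : Disjoint I (J.erase i) ↔ Disjoint I J := by
      rw [← Finset.disjoint_erase_comm, Finset.erase_eq_of_notMem hi]
    simp only [h0]
    split_ifs with h
    · rw [single_eq_smul, map_smul, contr_single, if_pos (by simp [hj]), sgn_union_right h,
        Finset.erase_union_distrib, Finset.erase_eq_of_notMem hi, sgn_erase_right hj,
        sgn_comm' (I := {i}) (J := I) (by simpa using hi)]
      simp only [Finsupp.smul_single]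
      congr 1
      simp
      ring
    · simp
  · rw [if_neg hi, if_neg hj]
    split_ifs
    · rw [single_eq_smul, map_smul, contr_single, if_neg (by simp [hi, hj])]
      simp
    · simp

/-- `contr i` is an odd derivation. -/
lemma contr_mul (i : Fin n) {m : ℕ} {a : Symb n s →₀ A} (ha : a ∈ piece A hdeg m)
    (c : Symb n s →₀ A) :
    contr A i (mul A a c) = mul A (contr A i a) c + (-1 : A) ^ m • mul A a (contr A i c) := by
  revert c
  refine piece_induction (P := fun a => ∀ c, contr A i (mul A a c) =
    mul A (contr A i a) c + (-1 : A) ^ m • mul A a (contr A i c)) (by simp) ?_ ?_ ha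
  · intro y z hy hz c
    simp only [map_add, LinearMap.add_apply, hy, hz, smul_add]
    abel
  · intro b r hb c
    rw [single_eq_smul]
    simp only [map_smul, LinearMap.smul_apply]
    rw [smul_comm ((-1 : A) ^ m) r, ← smul_add]
    congr 1
    suffices h : (contr A i) ∘ₗ (mul A (Finsupp.single b 1)) =
        mul A (contr A i (Finsupp.single b 1)) +
          (-1 : A) ^ m • (mul A (Finsupp.single b 1)) ∘ₗ contr A i from
      LinearMap.congr_fun h c
    refine finsupp_hom_ext fun c => ?_
    -- The variables `t_j` have even degree, so only the number of letters `e_i` matters for the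
    -- parity.
    have hs : (-1 : A) ^ m = (-1) ^ b.1.card := by
      rw [← hb, hdeg, pow_add, pow_mul]; simp
    rw [hs]
    exact contr_symbMul i b c

/-- When `t_j` occurs in both factors this is Pascal's rule in the coordinate `j`; the remaining
factors of the binomial product are unchanged. -/
lemma lower_symbMul (j : Fin s) (b c : Symb n s) : lower A j (symbMul A b c) =
    mul A (lower A j (Finsupp.single b 1)) (Finsupp.single c 1) +
      mul A (Finsupp.single b 1) (lower A j (Finsupp.single c 1)) := by
  obtain ⟨I, l⟩ := b
  obtain ⟨J, q⟩ := c
  simp only [lower_single, symbMul_eq]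
  by_cases hd : Disjoint I J
  swap
  · rw [if_neg hd, map_zero]
    split_ifs <;> simp [mul_single, symbMul_eq, hd]
  rw [if_pos hd, single_eq_smul, map_smul, lower_single]
  have hb : ∀ l q : Fin s → ℕ, binom l q =
      (l j + q j).choose (l j) * ∏ i ∈ Finset.univ.erase j, (l i + q i).choose (l i) :=
    fun l q => (Finset.mul_prod_erase _ _ (Finset.mem_univ j)).symm
  have he : ∀ l q l' q' : Fin s → ℕ, (∀ i ≠ j, l i = l' i) → (∀ i ≠ j, q i = q' i) →
      ∏ i ∈ Finset.univ.erase j, (l i + q i).choose (l i) =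
      ∏ i ∈ Finset.univ.erase j, (l' i + q' i).choose (l' i) := by
    intro l q l' q' h1 h2
    refine Finset.prod_congr rfl fun i hi => ?_
    rw [h1 i (Finset.ne_of_mem_erase hi), h2 i (Finset.ne_of_mem_erase hi)]
  have hne : ∀ l : Fin s → ℕ, ∀ i ≠ j, (l - Pi.single j 1 : Fin s → ℕ) i = l i := by
    intro l i hi; simp [hi]
  have hl : 0 < l j → l + q - Pi.single j 1 = l - Pi.single j 1 + q := by
    intro h
    ext i
    by_cases hi : i = j
    · subst hi; simp; omega
    · simp [hi]
  have hq : 0 < q j → l + q - Pi.single j 1 = l + (q - Pi.single j 1) := by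
    intro h
    ext i
    by_cases hi : i = j
    · subst hi; simp; omega
    · simp [hi]
  by_cases h1 : 0 < l j <;> by_cases h2 : 0 < q j
  · rw [if_pos (by simp; omega), if_pos h1, if_pos h2, mul_single, mul_single, symbMul_eq,
      symbMul_eq, if_pos hd, if_pos hd, ← hl h1, ← hq h2]
    simp only [Finsupp.smul_single, ← Finsupp.single_add]
    congr 1
    have : binom l q = binom (l - Pi.single j 1) q + binom l (q - Pi.single j 1) := by
      rw [hb, hb, hb, he (l - Pi.single j 1) q l q (hne l) (fun _ _ => rfl),
        he l (q - Pi.single j 1) l q (fun _ _ => rfl) (hne q), ← add_mul]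
      congr 1
      simp only [Pi.sub_apply, Pi.single_eq_same]
      obtain ⟨a, ha⟩ : ∃ a, l j = a + 1 := ⟨l j - 1, by omega⟩
      obtain ⟨b, hb⟩ : ∃ b, q j = b + 1 := ⟨q j - 1, by omega⟩
      rw [ha, hb, ← add_assoc, Nat.choose_succ_succ]
      congr 2
      simp; omega
    rw [this]
    push_cast
    simp
    ring
  · rw [if_pos (by simp; omega), if_pos h1, if_neg h2, mul_single, symbMul_eq, if_pos hd, ← hl h1,
      map_zero, add_zero]
    simp only [Finsupp.smul_single]
    have : binom l q = binom (l - Pi.single j 1) q := by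
      rw [hb, hb, he (l - Pi.single j 1) q l q (hne l) (fun _ _ => rfl)]
      simp [(by omega : q j = 0)]
    rw [this]
    simp
  · rw [if_pos (by simp; omega), if_neg h1, if_pos h2, mul_single, symbMul_eq, if_pos hd, ← hq h2,
      map_zero, LinearMap.zero_apply, zero_add]
    simp only [Finsupp.smul_single]
    have : binom l q = binom l (q - Pi.single j 1) := by
      rw [hb, hb, he l (q - Pi.single j 1) l q (fun _ _ => rfl) (hne q)]
      simp [(by omega : l j = 0)]
    rw [this]
    simp
  · rw [if_neg (by simp; omega), if_neg h1, if_neg h2]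
    simp

/-- `lower j` is a derivation. -/
lemma lower_mul (j : Fin s) (a c : Symb n s →₀ A) :
    lower A j (mul A a c) = mul A (lower A j a) c + mul A a (lower A j c) := by
  suffices h : (mul A).compr₂ (lower A j) = (mul A) ∘ₗ lower A j + (mul A).compl₂ (lower A j) from
    LinearMap.congr_fun (LinearMap.congr_fun h a) c
  refine finsupp_hom_ext fun b => finsupp_hom_ext fun c => ?_
  simp only [LinearMap.compr₂_apply, mul_single_one, LinearMap.add_apply, LinearMap.comp_apply,
    LinearMap.compl₂_apply]
  exact lower_symbMul j b c

/-- `e_p` commutes with homogeneous elements up to the sign of the degree. -/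
lemma extMul_eq (p : Fin n) {m : ℕ} {a : Symb n s →₀ A} (ha : a ∈ piece A hdeg m) :
    extMul A p a = (-1 : A) ^ m • mul A a (Finsupp.single ({p}, 0) 1) := by
  refine hom_piece_eq (φ := extMul A p)
    (ψ := (-1 : A) ^ m • (mul A).flip (Finsupp.single ({p}, 0) 1)) (fun b hb => ?_) ha
  have hs : (-1 : A) ^ m = (-1) ^ b.1.card := by
    rw [← hb, hdeg, pow_add, pow_mul]; simp
  rw [hs, LinearMap.smul_apply, LinearMap.flip_apply, extMul_single, mul_single_one, symbMul_eq]
  obtain ⟨I, l⟩ := b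
  by_cases hp : p ∈ I
  · simp [hp]
  · rw [if_pos hp, if_pos (by simpa using hp), Finsupp.smul_single, binom_zero_right,
      Finset.union_comm, ← Finset.insert_eq, add_zero, sgn_comm' (by simpa using hp)]
    simp

lemma extMul_mul (p : Fin n) (a c : Symb n s →₀ A) :
    extMul A p (mul A a c) = mul A (extMul A p a) c := by
  exact (mul_assoc' A _ _ _).symm

lemma mul_extMul (p : Fin n) {m : ℕ} {a : Symb n s →₀ A} (ha : a ∈ piece A hdeg m)
    (c : Symb n s →₀ A) : mul A (extMul A p a) c = (-1 : A) ^ m • mul A a (extMul A p c) := by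
  rw [extMul_eq p ha, map_smul, LinearMap.smul_apply, mul_assoc']
  rfl

/-- The Leibniz rule. -/
lemma genDiff_mul (x : Fin n → A) (T : Fin n → Fin s → A) {m : ℕ} {a : Symb n s →₀ A}
    (ha : a ∈ piece A hdeg m) (c : Symb n s →₀ A) : genDiff x T (mul A a c) =
      mul A (genDiff x T a) c + (-1 : A) ^ m • mul A a (genDiff x T c) := by
  simp only [genDiff, LinearMap.add_apply, LinearMap.sum_apply, LinearMap.smul_apply,
    Module.End.mul_apply, map_add, map_sum, map_smul, smul_add, Finset.smul_sum, lower_mul,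
    contr_mul _ ha, extMul_mul, mul_extMul _ ha, Finset.sum_add_distrib]
  simp only [smul_comm _ ((-1 : A) ^ m)]
  abel

/-- This is the odd derivation rule for `contr i` applied to the product `e_p · a`. -/
lemma contr_mul_extMul (i p : Fin n) : contr A i * extMul A p + extMul A p * contr A i =
    if i = p then 1 else (0 : Module.End A (Symb n s →₀ A)) := by
  refine LinearMap.ext fun a => ?_
  simp only [LinearMap.add_apply, Module.End.mul_apply]
  rw [extMul, contr_mul i (single_mem_piece (i := 1) (by simp [hdeg]) _), contr_single]
  by_cases h : i = p
  · subst h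
    simp only [Finset.mem_singleton, if_true, Finset.erase_singleton, sgn_singleton_self]
    change mul A (one A) _ + _ + _ = _
    rw [one_mul']
    simp
  · simp [h]

lemma extMul_add_extMul (p q : Fin n) :
    extMul A p * extMul A q + extMul A q * extMul A p =
      (0 : Module.End A (Symb n s →₀ A)) := by
  refine LinearMap.ext fun a => ?_
  simp only [LinearMap.add_apply, Module.End.mul_apply]
  rw [show extMul A q a = mul A (Finsupp.single ({q}, 0) 1) a from rfl, extMul_mul p,
    extMul_eq p (single_mem_piece (i := 1) (by simp [hdeg]) _)]
  simp only [pow_one, neg_smul, one_smul, map_neg, LinearMap.neg_apply, mul_assoc']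
  exact neg_add_cancel _

lemma extMul_sq (p : Fin n) : extMul A p * extMul A p = (0 : Module.End A (Symb n s →₀ A)) := by
  refine LinearMap.ext fun a => ?_
  simp only [Module.End.mul_apply]
  nth_rw 2 [extMul]
  rw [extMul_mul p, extMul_single]
  simp

lemma commute_lower_extMul (j : Fin s) (p : Fin n) :
    Commute (lower A j : Module.End A (Symb n s →₀ A)) (extMul A p) := by
  refine LinearMap.ext fun a => ?_
  simp only [Module.End.mul_apply]
  rw [extMul, lower_mul, lower_single]
  simp

lemma commute_lower_contr (j : Fin s) (i : Fin n) :
    Commute (lower A j : Module.End A (Symb n s →₀ A)) (contr A i) := by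
  refine finsupp_hom_ext fun b => ?_
  simp only [Module.End.mul_apply]
  rw [contr_single, lower_single]
  by_cases h1 : i ∈ b.1 <;> by_cases h2 : 0 < b.2 j
  · rw [if_pos h1, if_pos h2, single_eq_smul, map_smul, contr_single, if_pos h1, lower_single,
      if_pos h2]
    simp
  · rw [if_pos h1, if_neg h2, single_eq_smul, map_smul, lower_single, if_neg h2]
    simp
  · rw [if_neg h1, if_pos h2, contr_single, if_neg h1]
    simp
  · rw [if_neg h1, if_neg h2]
    simp

lemma commute_lower_lower (j j' : Fin s) :
    Commute (lower A j : Module.End A (Symb n s →₀ A)) (lower A j') := by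
  rcases eq_or_ne j j' with rfl | hj
  · exact Commute.refl _
  refine finsupp_hom_ext fun b => ?_
  simp only [Module.End.mul_apply]
  rw [lower_single, lower_single]
  by_cases h1 : 0 < b.2 j' <;> by_cases h2 : 0 < b.2 j
  · rw [if_pos h1, if_pos h2, lower_single, lower_single, if_pos (by simp [h2, hj]),
      if_pos (by simp [h1, hj.symm]), tsub_right_comm]
  · rw [if_pos h1, if_neg h2, lower_single, if_neg (by simp; omega)]
    simp
  · rw [if_neg h1, if_pos h2, lower_single, if_neg (by simp; omega)]
    simp
  · rw [if_neg h1, if_neg h2]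
    simp

end Operators

end Algebra

end BachComm

namespace BachComm

/-! ### The square of the differential -/

section Square

variable {n s : ℕ} {A : Type*} [CommRing A]

/-- The diagonal needs its own hypothesis, since `g i i + g i i = 0` says nothing when two is not
invertible. -/
lemma sum_sum_eq_zero_of_antisymm {ι M : Type*} [Fintype ι] [DecidableEq ι] [AddCommMonoid M]
    (g : ι → ι → M) (h : ∀ i j, g i j + g j i = 0) (h0 : ∀ i, g i i = 0) :
    ∑ i, ∑ j, g i j = 0 := by
  rw [← Finset.sum_product']
  refine Finset.sum_involution (fun q _ => (q.2, q.1)) ?_ ?_ ?_ ?_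
  · rintro ⟨i, j⟩ _
    exact h i j
  · rintro ⟨i, j⟩ _ hij he
    simp only [Prod.mk.injEq] at he
    obtain ⟨rfl, -⟩ := he
    exact hij (h0 _)
  · simp
  · simp

/-- Left multiplication by `∑ p, T p • e_p`. -/
noncomputable def leftMul (T : Fin n → A) : Module.End A (Symb n s →₀ A) :=
  ∑ p, T p • extMul A p

/-- The Koszul part of the differential. -/
noncomputable def koszul (x : Fin n → A) : Module.End A (Symb n s →₀ A) :=
  ∑ i, x i • contr A i

lemma genDiff_eq (x : Fin n → A) (T : Fin n → Fin s → A) : genDiff x T =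
    (koszul x + ∑ j, leftMul (fun p => T p j) * lower A j : Module.End A (Symb n s →₀ A)) := by
  rw [genDiff, koszul]
  congr 1
  refine Finset.sum_congr rfl fun j _ => ?_
  rw [leftMul, Finset.sum_mul]
  simp

lemma koszul_mul_koszul (x : Fin n → A) :
    koszul x * koszul x = (0 : Module.End A (Symb n s →₀ A)) := by
  rw [koszul, Finset.sum_mul_sum]
  apply sum_sum_eq_zero_of_antisymm <;> [intro i j; intro i]
  · rw [smul_mul_smul_comm, smul_mul_smul_comm, mul_comm (x j), ← smul_add, contr_add_contr, smul_zero]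
  · rw [smul_mul_smul_comm, contr_sq, smul_zero]

/-- Multiplication by the chain `∑ T_p e_p` is a homotopy on the Koszul complex for multiplication
by its boundary `∑ T_p x_p`. -/
lemma koszul_mul_leftMul (x : Fin n → A) (T : Fin n → A) :
    koszul x * leftMul T + leftMul T * koszul x =
      ((∑ p, T p * x p) • 1 : Module.End A (Symb n s →₀ A)) := by
  rw [koszul, leftMul, Finset.sum_mul_sum, Finset.sum_mul_sum, Finset.sum_comm,
    ← Finset.sum_add_distrib, Finset.sum_smul]
  refine Finset.sum_congr rfl fun p _ => ?_
  rw [← Finset.sum_add_distrib]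
  rw [Finset.sum_eq_single p]
  · rw [smul_mul_smul_comm, smul_mul_smul_comm, mul_comm (x p), ← smul_add, contr_mul_extMul,
      if_pos rfl]
  · intro i _ hi
    rw [smul_mul_smul_comm, smul_mul_smul_comm, mul_comm (x i), ← smul_add, contr_mul_extMul,
      if_neg hi, smul_zero]
  · simp

lemma leftMul_add_leftMul (T U : Fin n → A) :
    leftMul T * leftMul U + leftMul U * leftMul T = (0 : Module.End A (Symb n s →₀ A)) := by
  rw [leftMul, leftMul, Finset.sum_mul_sum, Finset.sum_mul_sum, Finset.sum_comm,
    ← Finset.sum_add_distrib]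
  refine Finset.sum_eq_zero fun p _ => ?_
  rw [← Finset.sum_add_distrib]
  refine Finset.sum_eq_zero fun q _ => ?_
  rw [smul_mul_smul_comm, smul_mul_smul_comm, mul_comm (U p), ← smul_add, extMul_add_extMul,
    smul_zero]

lemma leftMul_sq (T : Fin n → A) :
    leftMul T * leftMul T = (0 : Module.End A (Symb n s →₀ A)) := by
  rw [leftMul, Finset.sum_mul_sum]
  apply sum_sum_eq_zero_of_antisymm <;> [intro i j; intro i]
  · rw [smul_mul_smul_comm, smul_mul_smul_comm, mul_comm (T j), ← smul_add, extMul_add_extMul, smul_zero]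
  · rw [smul_mul_smul_comm, extMul_sq, smul_zero]

lemma commute_lower_leftMul (j : Fin s) (T : Fin n → A) :
    Commute (lower A j : Module.End A (Symb n s →₀ A)) (leftMul T) :=
  Commute.sum_right _ _ _ fun p _ => (commute_lower_extMul j p).smul_right _

lemma commute_lower_koszul (j : Fin s) (x : Fin n → A) :
    Commute (lower A j : Module.End A (Symb n s →₀ A)) (koszul x) :=
  Commute.sum_right _ _ _ fun p _ => (commute_lower_contr j p).smul_right _

lemma commute_lower_genDiff (j : Fin s) (x : Fin n → A) (T : Fin n → Fin s → A) :
    Commute (lower A j) (genDiff x T) := by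
  rw [genDiff_eq]
  exact (commute_lower_koszul j x).add_right (Commute.sum_right _ _ _ fun i _ =>
    (commute_lower_leftMul j _).mul_right (commute_lower_lower j i))

/-- The `λ_j` commute with everything. The Koszul part squares to zero, the `Z_j` square to zero and
anticommute, and so only the cross terms `(κ Z_j + Z_j κ) λ_j` remain. -/
lemma genDiff_sq (x : Fin n → A) (T : Fin n → Fin s → A) : genDiff x T * genDiff x T =
    ∑ j, (∑ p, T p j * x p) • lower A j := by
  set Z : Fin s → Module.End A (Symb n s →₀ A) := fun j => leftMul fun p => T p j with hZ
  have h1 : (∑ j, Z j * lower A j) * (∑ j, Z j * lower A j) = 0 := by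
    rw [Finset.sum_mul_sum]
    have key : ∀ i j, Z i * lower A i * (Z j * lower A j) =
        (Z i * Z j) * (lower A i * lower A j) := fun i j => by
      rw [mul_assoc, mul_assoc, ← mul_assoc (lower A i), (commute_lower_leftMul i _).eq,
        mul_assoc]
    apply sum_sum_eq_zero_of_antisymm <;> [intro i j; intro i]
    · rw [key, key, (commute_lower_lower i j).eq, ← add_mul, leftMul_add_leftMul, zero_mul]
    · rw [key, leftMul_sq, zero_mul]
  rw [genDiff_eq, add_mul, mul_add, mul_add, koszul_mul_koszul, h1, zero_add, add_zero,
    Finset.mul_sum, Finset.sum_mul, ← Finset.sum_add_distrib]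
  refine Finset.sum_congr rfl fun j _ => ?_
  rw [mul_assoc (Z j), (commute_lower_koszul j x).eq, ← mul_assoc, ← mul_assoc, ← add_mul,
    koszul_mul_leftMul, smul_mul_assoc, one_mul]

/-- The product with the differential is a DG algebra as soon as the differential squares to
zero. -/
lemma isDGAlgebra_genDiff (x : Fin n → A) (T : Fin n → Fin s → A)
    (h : ∀ j, ∑ p, T p j * x p = 0) :
    IsDGAlgebra hdeg (mul A) (one A) (genDiff x T) where
  one_mem := single_mem_piece (by simp [hdeg]) _
  mul_mem _ _ _ ha _ hb := mul_mem_piece ha hb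
  one_mul := one_mul' A
  mul_one := mul_one' A
  mul_assoc := mul_assoc' A
  d_mem _ _ ha := genDiff_mem ha
  d_zero _ ha := genDiff_zero ha
  d_d a := by
    rw [← Module.End.mul_apply, genDiff_sq]
    simp [h]
  leibniz _ _ ha b := genDiff_mul x T ha b

end Square

end BachComm

namespace BachComm

/-! ### The subcomplexes involving only some of the divided power variables -/

section Stages

variable {n s : ℕ} {A : Type*} [CommRing A]

/-- To prove a property, closed under sums, for all elements supported on a set it is enough to do
this for multiples of basis elements. -/
lemma supported_induction {B : Type*} {t : Set B} {P : (B →₀ A) → Prop} (h0 : P 0)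
    (hadd : ∀ y z, P y → P z → P (y + z))
    (hs : ∀ b ∈ t, ∀ r, P (Finsupp.single b r)) {z : B →₀ A} (hz : z ∈ Finsupp.supported A A t) :
    P z := by
  rw [Finsupp.mem_supported] at hz
  rw [← Finsupp.sum_single z]
  refine Finset.sum_induction _ P (fun a b ha hb => hadd a b ha hb) h0 fun b hb => ?_
  exact hs b (hz hb) _

lemma hom_supported {B N : Type*} [AddCommGroup N] [Module A N] {t : Set B}
    {q : Submodule A N} {φ : (B →₀ A) →ₗ[A] N}
    (h : ∀ b ∈ t, φ (Finsupp.single b 1) ∈ q) {z : B →₀ A}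
    (hz : z ∈ Finsupp.supported A A t) : φ z ∈ q := by
  refine supported_induction (P := fun z => φ z ∈ q) (by simp)
    (fun y z hy hz => by rw [map_add]; exact add_mem hy hz) (fun b hb r => ?_) hz
  rw [single_eq_smul, map_smul]
  exact Submodule.smul_mem _ _ (h b hb)

lemma hom_supported_eq {B N : Type*} [AddCommGroup N] [Module A N] {t : Set B}
    {φ ψ : (B →₀ A) →ₗ[A] N}
    (h : ∀ b ∈ t, φ (Finsupp.single b 1) = ψ (Finsupp.single b 1)) {z : B →₀ A}
    (hz : z ∈ Finsupp.supported A A t) : φ z = ψ z := by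
  have := hom_supported (q := ⊥) (φ := φ - ψ) (fun b hb => by simp [h b hb]) hz
  simpa [sub_eq_zero] using this

/-- The elements of degree `m` in which only the variables `t_j` with `j < i` occur. -/
def stage (A : Type*) [CommRing A] (n s i m : ℕ) : Submodule A (Symb n s →₀ A) :=
  Finsupp.supported A A {b | hdeg b = m ∧ ∀ j : Fin s, i ≤ j → b.2 j = 0}

lemma single_mem_stage {i : ℕ} {m : ℕ} {b : Symb n s} (h : hdeg b = m)
    (h' : ∀ j : Fin s, i ≤ j → b.2 j = 0) (r : A) : Finsupp.single b r ∈ stage A n s i m :=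
  Finsupp.single_mem_supported A r ⟨h, h'⟩

lemma stage_le_piece (i m : ℕ) : stage A n s i m ≤ piece A hdeg m :=
  Finsupp.supported_mono fun _ h => h.1

lemma stage_mono {i i' : ℕ} (h : i ≤ i') (m : ℕ) : stage A n s i m ≤ stage A n s i' m :=
  Finsupp.supported_mono fun _ hb => ⟨hb.1, fun j hj => hb.2 j (h.trans hj)⟩

lemma stage_eq_piece {i : ℕ} (hi : s ≤ i) (m : ℕ) : stage A n s i m = piece A hdeg m := by
  refine le_antisymm (stage_le_piece i m) (Finsupp.supported_mono fun b hb => ⟨hb, fun j hj => ?_⟩)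
  omega

lemma lower_eq_zero {i m : ℕ} {z : Symb n s →₀ A} (hz : z ∈ stage A n s i m) {j : Fin s}
    (hj : i ≤ j) : lower A j z = 0 := by
  refine hom_supported_eq (ψ := 0) (fun b hb => ?_) hz
  rw [lower_single, if_neg (by simp [hb.2 j hj]), LinearMap.zero_apply]

lemma koszul_mem_stage {i m : ℕ} {x : Fin n → A} {z : Symb n s →₀ A}
    (hz : z ∈ stage A n s i (m + 1)) : koszul x z ∈ stage A n s i m := by
  rw [koszul, LinearMap.sum_apply]
  refine sum_mem fun p _ => Submodule.smul_mem _ _ ?_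
  refine hom_supported (fun b hb => ?_) hz
  rw [contr_single]
  split_ifs with h
  · refine single_mem_stage ?_ (by exact hb.2) _
    have := Finset.card_erase_add_one h
    have h1 := hb.1
    simp only [hdeg] at h1 ⊢
    omega
  · exact zero_mem _

lemma leftMul_mem_stage {i m : ℕ} {T : Fin n → A} {z : Symb n s →₀ A}
    (hz : z ∈ stage A n s i m) : leftMul T z ∈ stage A n s i (m + 1) := by
  rw [leftMul, LinearMap.sum_apply]
  refine sum_mem fun p _ => Submodule.smul_mem _ _ ?_
  refine hom_supported (fun b hb => ?_) hz
  rw [extMul_single]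
  split_ifs with h
  · exact zero_mem _
  · refine single_mem_stage ?_ (by exact hb.2) _
    have := Finset.card_insert_of_notMem h
    have h1 := hb.1
    simp only [hdeg] at h1 ⊢
    omega

lemma lower_mem_stage {i m : ℕ} {j : Fin s} {z : Symb n s →₀ A}
    (hz : z ∈ stage A n s i (m + 2)) : lower A j z ∈ stage A n s i m := by
  refine hom_supported (fun b hb => ?_) hz
  rw [lower_single]
  split_ifs with h
  · refine single_mem_stage ?_ (fun j' hj' => by simp [hb.2 j' hj']) _
    have := sum_sub_single h
    have h1 := hb.1
    simp only [hdeg] at h1 ⊢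
    omega
  · exact zero_mem _

lemma genDiff_mem_stage {i m : ℕ} {x : Fin n → A} {T : Fin n → Fin s → A} {z : Symb n s →₀ A}
    (hz : z ∈ stage A n s i (m + 1)) : genDiff x T z ∈ stage A n s i m := by
  rw [genDiff_eq, LinearMap.add_apply, LinearMap.sum_apply]
  refine add_mem (koszul_mem_stage hz) (sum_mem fun j _ => ?_)
  rw [Module.End.mul_apply]
  cases m with
  | zero => rw [lower_zero (by omega) (stage_le_piece _ _ hz), map_zero]; exact zero_mem _
  | succ m => exact leftMul_mem_stage (lower_mem_stage hz)

variable (A) in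
/-- `e_I t^{(l)} ↦ e_I t^{(l + 1_j)}`. -/
noncomputable def raise (j : Fin s) : Module.End A (Symb n s →₀ A) :=
  Finsupp.lmapDomain A A fun b => (b.1, b.2 + Pi.single j 1)

lemma raise_single (j : Fin s) (b : Symb n s) (r : A) :
    raise A j (Finsupp.single b r) = Finsupp.single (b.1, b.2 + Pi.single j 1) r := by
  simp [raise]

lemma lower_mul_raise (j : Fin s) :
    lower A j * raise A j = (1 : Module.End A (Symb n s →₀ A)) := by
  refine finsupp_hom_ext fun b => ?_
  rw [Module.End.mul_apply, raise_single, lower_single, if_pos (by simp)]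
  simp

lemma commute_raise_contr (j : Fin s) (i : Fin n) :
    Commute (raise A j : Module.End A (Symb n s →₀ A)) (contr A i) := by
  refine finsupp_hom_ext fun b => ?_
  simp only [Module.End.mul_apply]
  rw [contr_single, raise_single, contr_single]
  split_ifs with h
  · rw [raise_single]
  · simp

lemma commute_raise_extMul (j : Fin s) (p : Fin n) :
    Commute (raise A j : Module.End A (Symb n s →₀ A)) (extMul A p) := by
  refine finsupp_hom_ext fun b => ?_
  simp only [Module.End.mul_apply]
  rw [extMul_single, raise_single, extMul_single]
  split_ifs with h
  · simp
  · rw [raise_single]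

lemma commute_raise_lower {j j' : Fin s} (h : j ≠ j') :
    Commute (raise A j : Module.End A (Symb n s →₀ A)) (lower A j') := by
  refine finsupp_hom_ext fun b => ?_
  simp only [Module.End.mul_apply]
  rw [lower_single, raise_single, lower_single]
  by_cases h1 : 0 < b.2 j'
  · rw [if_pos h1, if_pos (by simp; omega), raise_single]
    congr 2
    ext q
    by_cases hq : q = j'
    · subst hq; simp [h]
    · simp [hq]
  · rw [if_neg h1, if_neg (by simpa [h.symm] using h1), map_zero]

lemma raise_mem_stage {i m : ℕ} {j : Fin s} (hj : (j : ℕ) < i) {z : Symb n s →₀ A}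
    (hz : z ∈ stage A n s i m) : raise A j z ∈ stage A n s i (m + 2) := by
  refine hom_supported (fun b hb => ?_) hz
  rw [raise_single]
  refine single_mem_stage ?_ (fun j' hj' => ?_) _
  · have h1 := hb.1
    simp only [hdeg, Pi.add_apply, Finset.sum_add_distrib] at h1 ⊢
    simp
    omega
  · have : j' ≠ j := by rintro rfl; omega
    simp [hb.2 j' hj', this]

/-- Raising `t_j` commutes with every summand of the differential except `Z_j λ_j`. There `λ_j` is
only a left inverse of `raise j`, which is why a correction stands on the left-hand side. -/
lemma genDiff_mul_raise (x : Fin n → A) (T : Fin n → Fin s → A) (j : Fin s) :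
    genDiff x T * raise A j + raise A j * (leftMul (fun p => T p j) * lower A j) =
      raise A j * genDiff x T + leftMul (fun p => T p j) := by
  have h1 : koszul x * raise A j = (raise A j * koszul x : Module.End A (Symb n s →₀ A)) :=
    (Commute.sum_right _ _ _ fun p _ => (commute_raise_contr j p).smul_right _ :
      Commute (raise A j) (koszul x)).eq.symm
  have h2 : ∀ T : Fin n → A,
      leftMul T * raise A j = (raise A j * leftMul T : Module.End A (Symb n s →₀ A)) := fun T =>
    (Commute.sum_right _ _ _ fun p _ => (commute_raise_extMul j p).smul_right _ :
      Commute (raise A j) (leftMul T)).eq.symm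
  rw [genDiff_eq, add_mul, mul_add, h1, ← Finset.add_sum_erase _ _ (Finset.mem_univ j), add_mul,
    mul_add, Finset.sum_mul, Finset.mul_sum, mul_assoc, lower_mul_raise, mul_one]
  have h3 : ∀ j' ∈ Finset.univ.erase j, leftMul (fun p => T p j') * lower A j' * raise A j =
      (raise A j * (leftMul (fun p => T p j') * lower A j') :
        Module.End A (Symb n s →₀ A)) := by
    intro j' hj'
    rw [mul_assoc, ← (commute_raise_lower (Finset.ne_of_mem_erase hj').symm).eq, ← mul_assoc, h2,
      mul_assoc]
  rw [Finset.sum_congr rfl h3]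
  abel

/-- On elements not involving `t_j`. -/
lemma genDiff_raise {x : Fin n → A} {T : Fin n → Fin s → A} {j : Fin s} {z : Symb n s →₀ A}
    (hz : lower A j z = 0) : genDiff x T (raise A j z) =
      raise A j (genDiff x T z) + leftMul (fun p => T p j) z := by
  have := LinearMap.congr_fun (genDiff_mul_raise x T j) z
  simpa [hz] using this

end Stages

/-! ### Exactness of the Koszul complex of the variables -/

section Koszul

open MvPolynomial

variable {k : Type*} [Field k] {n s : ℕ}

/-- The contracting homotopy of the Koszul complex on `x^α e_I t^{(l)}`: multiplication by
`e_p / x_p`, where `p` is the largest index occurring. -/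
noncomputable def koszulHomotopyVal (b : Symb n s) (α : Fin n →₀ ℕ) :
    Symb n s →₀ MvPolynomial (Fin n) k :=
  if h : (α.support ∪ b.1).Nonempty then
    if (α.support ∪ b.1).max' h ∈ b.1 then 0 else
      Finsupp.single (insert ((α.support ∪ b.1).max' h) b.1, b.2)
        (monomial (α - Finsupp.single ((α.support ∪ b.1).max' h) 1) 1)
  else 0

variable (k n s) in
/-- The contracting homotopy of the Koszul complex. -/
noncomputable def koszulHomotopy :
    (Symb n s →₀ MvPolynomial (Fin n) k) →ₗ[k] (Symb n s →₀ MvPolynomial (Fin n) k) :=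
  Finsupp.lsum k fun b => (basisMonomials (Fin n) k).constr k fun α => koszulHomotopyVal b α

lemma koszulHomotopy_single (b : Symb n s) (α : Fin n →₀ ℕ) :
    koszulHomotopy k n s (Finsupp.single b (monomial α 1)) = koszulHomotopyVal b α := by
  have := (basisMonomials (Fin n) k).constr_basis k (fun α => koszulHomotopyVal (k := k) b α) α
  rw [coe_basisMonomials] at this
  simpa [koszulHomotopy] using this

lemma koszulHomotopy_of_mem {b : Symb n s} {α : Fin n →₀ ℕ} {p : Fin n}
    (hp : p ∈ b.1) (h1 : ∀ q ∈ b.1, q ≤ p) (h2 : ∀ q ∈ α.support, q ≤ p) :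
    koszulHomotopy k n s (Finsupp.single b (monomial α 1)) = 0 := by
  have hne : (α.support ∪ b.1).Nonempty := ⟨p, Finset.mem_union_right _ hp⟩
  have hm : (α.support ∪ b.1).max' hne = p := by
    refine le_antisymm (Finset.max'_le _ _ _ fun q hq => ?_) (Finset.le_max' _ _ (by simp [hp]))
    rcases Finset.mem_union.1 hq with hq | hq
    exacts [h2 q hq, h1 q hq]
  rw [koszulHomotopy_single, koszulHomotopyVal, dif_pos hne, hm, if_pos hp]

lemma koszulHomotopy_of_notMem {b : Symb n s} {α : Fin n →₀ ℕ} {p : Fin n}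
    (hp : p ∉ b.1) (hα : p ∈ α.support) (h1 : ∀ q ∈ b.1, q ≤ p) (h2 : ∀ q ∈ α.support, q ≤ p) :
    koszulHomotopy k n s (Finsupp.single b (monomial α 1)) =
      Finsupp.single (insert p b.1, b.2) (monomial (α - Finsupp.single p 1) 1) := by
  have hne : (α.support ∪ b.1).Nonempty := ⟨p, Finset.mem_union_left _ hα⟩
  have hm : (α.support ∪ b.1).max' hne = p := by
    refine le_antisymm (Finset.max'_le _ _ _ fun q hq => ?_) (Finset.le_max' _ _ (by simp [hα]))
    rcases Finset.mem_union.1 hq with hq | hq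
    exacts [h2 q hq, h1 q hq]
  rw [koszulHomotopy_single, koszulHomotopyVal, dif_pos hne, hm, if_neg hp]

/-- The homotopy is only `k`-linear, but the signs are scalars `±1` of the polynomial ring. -/
lemma koszulHomotopy_sgn_smul (I J : Finset (Fin n)) (y : Symb n s →₀ MvPolynomial (Fin n) k) :
    koszulHomotopy k n s (sgn (MvPolynomial (Fin n) k) I J • y) = sgn (MvPolynomial (Fin n) k) I J •
      koszulHomotopy k n s y := by
  rw [sgn]
  rcases neg_one_pow_eq_or (MvPolynomial (Fin n) k)
    ((I ×ˢ J).filter fun q => q.1 < q.2).card with h | h <;> simp [h]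

lemma koszul_single (b : Symb n s) (α : Fin n →₀ ℕ) :
    koszul (X : Fin n → MvPolynomial (Fin n) k) (Finsupp.single b (monomial α 1)) =
      ∑ i ∈ b.1, sgn (MvPolynomial (Fin n) k) {i} b.1 •
        Finsupp.single (b.1.erase i, b.2) (monomial (α + Finsupp.single i 1) 1) := by
  rw [koszul, LinearMap.sum_apply, ← Finset.sum_subset (Finset.subset_univ b.1)]
  · refine Finset.sum_congr rfl fun i hi => ?_
    rw [LinearMap.smul_apply, single_eq_smul, map_smul, contr_single, if_pos hi]
    simp only [Finsupp.smul_single, smul_eq_mul]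
    congr 1
    rw [X, ← mul_assoc, mul_comm _ (monomial α (1 : k)), monomial_mul, mul_comm, one_mul]
  · intro i _ hi
    rw [LinearMap.smul_apply, single_eq_smul, map_smul, contr_single, if_neg hi]
    simp

lemma sgn_singleton_max {p : Fin n} {I : Finset (Fin n)} (h : ∀ q ∈ I, q ≤ p) {A : Type*}
    [CommRing A] : sgn A {p} I = 1 := by
  rw [sgn_singleton_left, Finset.filter_false_of_mem]
  · simp
  · intro q hq
    exact not_lt.2 (h q hq)

/-- Let `p` be the largest index occurring; replacing an `e_i` by `x_i` with `i ≠ p` does not change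
it. If `e_p` occurs, the homotopy kills the element and also every term of its boundary except that
for `p`, from which it restores the element. If `e_p` does not occur, the boundary of `e_p x^α / x_p
e_I` contains the element itself, and its other terms cancel because a contraction changes sign in
passing `e_p`. As `p` is maximal, `e_p` stands at the left end of a decreasing word and contributes
no further sign. -/
lemma koszul_homotopy_single {b : Symb n s} {α : Fin n →₀ ℕ} (h : (α.support ∪ b.1).Nonempty) :
    koszul X (koszulHomotopy k n s (Finsupp.single b (monomial α 1))) +
      koszulHomotopy k n s (koszul X (Finsupp.single b (monomial α 1))) =
        Finsupp.single b (monomial α 1) := by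
  obtain ⟨I, l⟩ := b
  obtain ⟨p, hp⟩ : ∃ p, p = (α.support ∪ I).max' h := ⟨_, rfl⟩
  have hpm : p ∈ α.support ∪ I := hp ▸ Finset.max'_mem _ h
  have h1 : ∀ q ∈ I, q ≤ p := fun q hq => hp ▸ Finset.le_max' _ _ (by simp [hq])
  have h2 : ∀ q ∈ α.support, q ≤ p := fun q hq =>
    hp ▸ Finset.le_max' _ _ (Finset.mem_union_left _ hq)
  have h2' : ∀ i ∈ I, ∀ q ∈ (α + Finsupp.single i 1).support, q ≤ p := by
    intro i hi q hq
    rcases Finset.mem_union.1 (Finsupp.support_add hq) with hq | hq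
    · exact h2 q hq
    · rw [Finset.mem_singleton.1 (Finsupp.support_single_subset hq)]
      exact h1 i hi
  rw [koszul_single, map_sum]
  by_cases hpI : p ∈ I
  · rw [koszulHomotopy_of_mem (p := p) hpI h1 h2, map_zero, zero_add, Finset.sum_eq_single p]
    · rw [koszulHomotopy_sgn_smul, sgn_singleton_max h1, one_smul,
        koszulHomotopy_of_notMem (p := p) (by simp) (by simp)
          (fun q hq => h1 q (Finset.mem_of_mem_erase hq)) (h2' p hpI)]
      simp [Finset.insert_erase hpI]
    · intro i hi hip
      rw [koszulHomotopy_sgn_smul, koszulHomotopy_of_mem (p := p)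
        (Finset.mem_erase.2 ⟨hip.symm, hpI⟩)
        (fun q hq => h1 q (Finset.mem_of_mem_erase hq)) (h2' i hi), smul_zero]
    · simp [hpI]
  · have hpα : p ∈ α.support := (Finset.mem_union.1 hpm).resolve_right hpI
    have hle : Finsupp.single p 1 ≤ α := by
      rw [Finsupp.single_le_iff]
      exact Nat.one_le_iff_ne_zero.2 (Finsupp.mem_support_iff.1 hpα)
    rw [koszulHomotopy_of_notMem (p := p) hpI hpα h1 h2, koszul_single, Finset.sum_insert hpI,
      add_assoc, ← Finset.sum_add_distrib, Finset.sum_eq_zero, add_zero]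
    · rw [sgn_singleton_max (by simpa using h1), one_smul, Finset.erase_insert hpI,
        tsub_add_cancel_of_le hle]
    · intro i hi
      have hip : i < p := lt_of_le_of_ne (h1 i hi) (by rintro rfl; exact hpI hi)
      rw [koszulHomotopy_sgn_smul, koszulHomotopy_of_notMem (p := p) (by simp [hpI])
        (by simp [Finsupp.mem_support_iff.1 hpα])
        (fun q hq => h1 q (Finset.mem_of_mem_erase hq)) (h2' i hi)]
      simp only
      rw [Finset.erase_insert_of_ne hip.ne', tsub_add_eq_add_tsub hle, Finset.insert_eq p I,
        sgn_union_right (by simpa using hpI), sgn_singleton_left (A := MvPolynomial (Fin n) k) i {p},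
        Finset.filter_true_of_mem (by simpa using hip)]
      simp

lemma koszulHomotopy_mem {m : ℕ} {z : Symb n s →₀ MvPolynomial (Fin n) k}
    (hz : z ∈ stage _ n s 0 m) : koszulHomotopy k n s z ∈ stage _ n s 0 (m + 1) := by
  refine supported_induction (P := fun z => koszulHomotopy k n s z ∈ stage _ n s 0 (m + 1))
    (by simp) (fun y z hy hz => by rw [map_add]; exact add_mem hy hz) (fun b hb r => ?_) hz
  induction r using MvPolynomial.induction_on' with
  | add p q hp hq => rw [Finsupp.single_add, map_add]; exact add_mem hp hq
  | monomial α c =>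
    have : Finsupp.single b (monomial α c) = c • Finsupp.single b (monomial α (1 : k)) := by
      simp [Finsupp.smul_single, smul_monomial]
    rw [this, map_smul]
    refine Submodule.smul_of_tower_mem _ _ ?_
    rw [koszulHomotopy_single, koszulHomotopyVal]
    split_ifs with h1 h2
    · exact zero_mem _
    · refine single_mem_stage ?_ (by exact hb.2) _
      have h3 := hb.1
      simp only [hdeg, Finset.card_insert_of_notMem h2] at h3 ⊢
      omega
    · exact zero_mem _

lemma koszul_homotopy {m : ℕ} {z : Symb n s →₀ MvPolynomial (Fin n) k}
    (hz : z ∈ stage _ n s 0 (m + 1)) : koszul X (koszulHomotopy k n s z) +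
      koszulHomotopy k n s (koszul X z) = z := by
  refine supported_induction (P := fun z => koszul X (koszulHomotopy k n s z) +
      koszulHomotopy k n s (koszul X z) = z)
    (by simp) (fun y z hy hz => by
      simp only [map_add]
      nth_rw 3 [← hy]
      nth_rw 3 [← hz]
      abel) (fun b hb r => ?_) hz
  induction r using MvPolynomial.induction_on' with
  | add p q hp hq =>
    rw [Finsupp.single_add]
    simp only [map_add]
    nth_rw 3 [← hp]
    nth_rw 3 [← hq]
    abel
  | monomial α c =>
    have : Finsupp.single b (monomial α c) = c • Finsupp.single b (monomial α (1 : k)) := by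
      simp [Finsupp.smul_single, smul_monomial]
    rw [this, map_smul, LinearMap.map_smul_of_tower, LinearMap.map_smul_of_tower, map_smul,
      ← smul_add, koszul_homotopy_single]
    have h1 := hb.1
    have h2 : ∑ j, b.2 j = 0 := Finset.sum_eq_zero fun j _ => hb.2 j (Nat.zero_le _)
    rw [hdeg, h2] at h1
    -- Without variables `t_j` a positive degree forces some `e_i`, so a largest index exists even
    -- for a constant coefficient.
    have : b.1.Nonempty := Finset.card_pos.1 (by omega)
    exact this.mono Finset.subset_union_right

/-- The Koszul complex of the variables is exact in positive degrees. -/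
lemma koszul_exact {m : ℕ} {z : Symb n s →₀ MvPolynomial (Fin n) k}
    (hz : z ∈ stage _ n s 0 (m + 1)) (h : koszul X z = 0) :
    ∃ y ∈ stage _ n s 0 (m + 2), koszul X y = z := by
  refine ⟨_, koszulHomotopy_mem hz, ?_⟩
  have := koszul_homotopy hz
  rwa [h, map_zero, add_zero] at this

end Koszul

end BachComm

namespace BachComm

/-! ### Relations between the elements of a regular sequence -/

section RegularSequences

/-- The coefficients of a relation between the elements of a weakly regular sequence lie in the
ideal generated by the sequence. -/
lemma mem_span_of_sum_mul_eq_zero {R : Type*} [CommRing R] (r : ℕ → R) (N : ℕ)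
    (hr : ∀ t < N, ∀ a, a * r t ∈ Ideal.span (r '' (Finset.range t)) →
      a ∈ Ideal.span (r '' (Finset.range t))) :
    ∀ t ≤ N, ∀ c : ℕ → R, ∑ i ∈ Finset.range t, c i * r i = 0 →
      ∀ i < t, c i ∈ Ideal.span (r '' (Finset.range t)) := by
  intro t
  induction t with
  | zero => intro _ _ _ i hi; omega
  | succ t ih =>
    intro ht c hc i hi
    have hmono : Ideal.span (r '' (Finset.range t)) ≤ Ideal.span (r '' (Finset.range (t + 1))) := by
      refine Ideal.span_mono (Set.image_mono ?_)
      intro a ha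
      simp only [Finset.coe_range, Set.mem_Iio] at ha ⊢
      omega
    rw [Finset.sum_range_succ] at hc
    have h1 : c t ∈ Ideal.span (r '' (Finset.range t)) := by
      refine hr t (by omega) _ ?_
      rw [eq_neg_of_add_eq_zero_right hc]
      refine neg_mem (sum_mem fun j hj => Ideal.mul_mem_left _ _ (Ideal.subset_span ⟨j, hj, rfl⟩))
    rcases (Nat.lt_succ_iff_lt_or_eq.1 hi) with hi | rfl
    · obtain ⟨b, hb⟩ := (Submodule.mem_span_image_finset_iff_exists_fun' R).1 h1
      -- Substituting `c t = ∑ b j * r j` turns the relation into one between the first `t`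
      -- elements, with coefficients `c j + b j * r t`. The second summand lies in the larger ideal,
      -- so the conclusion passes to `c j`.
      have h2 := ih (by omega) (fun j => c j + b j * r t) (by
        rw [← hc]
        simp only [add_mul, Finset.sum_add_distrib]
        rw [← hb, Finset.sum_mul]
        congr 1
        refine Finset.sum_congr rfl fun j _ => ?_
        simp only [smul_eq_mul]
        ring) i hi
      have h3 : b i * r t ∈ Ideal.span (r '' (Finset.range (t + 1))) :=
        Ideal.mul_mem_left _ _ (Ideal.subset_span ⟨t, by simp, rfl⟩)
      have := sub_mem (hmono h2) h3
      simpa using this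
    · exact hmono h1

lemma mem_ofList_of_sum_mul_eq_zero {R : Type*} [CommRing R] {rs : List R}
    (h : RingTheory.Sequence.IsWeaklyRegular R rs) (c : Fin rs.length → R)
    (hc : ∑ i, c i * rs[i] = 0) (i : Fin rs.length) : c i ∈ Ideal.ofList rs := by
  have hspan : ∀ t ≤ rs.length, Ideal.span ((fun i => rs.getD i 0) '' (Finset.range t)) =
      Ideal.ofList (rs.take t) := by
    intro t ht
    congr 1
    ext x
    simp only [Finset.coe_range, Set.mem_image, Set.mem_Iio, Set.mem_ofPred_eq,
      List.mem_take_iff_getElem]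
    constructor
    · rintro ⟨j, hj, rfl⟩
      exact ⟨j, by omega, by rw [List.getD_eq_getElem]⟩
    · rintro ⟨j, hj, rfl⟩
      exact ⟨j, by omega, by rw [List.getD_eq_getElem]⟩
  have := mem_span_of_sum_mul_eq_zero (fun i => rs.getD i 0) rs.length (by
    intro t ht a ha
    have h1 := h.regular_mod_prev t ht
    rw [hspan t ht.le] at ha ⊢
    rw [isSMulRegular_quotient_iff_mem_of_smul_mem] at h1
    have h2 := h1 a
    simp only [smul_eq_mul, Ideal.mul_top] at h2
    refine h2 ?_
    simpa [ht, mul_comm] using ha) rs.length le_rfl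
    (fun i => if h : i < rs.length then c ⟨i, h⟩ else 0) (by
      rw [Finset.sum_range, ← hc]
      refine Finset.sum_congr rfl fun j _ => ?_
      simp) i i.2
  rw [hspan _ le_rfl] at this
  simpa using this

end RegularSequences

/-! ### Monomial complete intersections have coprime generators -/

section Coprime

open MvPolynomial

variable {k σ : Type*} [Field k] {s : ℕ}

lemma mem_span_range_monomial_iff (α : Fin s → σ →₀ ℕ) (p : MvPolynomial σ k) :
    p ∈ Ideal.span (Set.range fun j => monomial (α j) (1 : k)) ↔
      ∀ β ∈ p.support, ∃ j, α j ≤ β := by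
  have : (Set.range fun j => monomial (α j) (1 : k)) =
      (fun s => monomial s (1 : k)) '' Set.range α := by
    rw [← Set.range_comp]; rfl
  rw [this, mem_ideal_span_monomial_image]
  simp

/-- A syzygy of a minimal set of monomials has no constant coefficients. -/
lemma constantCoeff_eq_zero_of_sum_mul_monomial (α : Fin s → σ →₀ ℕ)
    (hα : ∀ i j, i ≠ j → ¬ α j ≤ α i) (c : Fin s → MvPolynomial σ k)
    (hc : ∑ j, c j * monomial (α j) (1 : k) = 0) (i : Fin s) : constantCoeff (c i) = 0 := by
  classical
  have h1 := congrArg (coeff (α i)) hc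
  rw [coeff_sum, Finset.sum_eq_single i] at h1
  · simpa [coeff_mul_monomial', constantCoeff_eq] using h1
  · intro j _ hj
    rw [coeff_mul_monomial', if_neg (hα i j hj.symm)]
  · simp

/-- The minimal generators of a monomial complete intersection are pairwise coprime. -/
lemma disjoint_of_isCompleteIntersection (α : Fin s → σ →₀ ℕ)
    (hα : ∀ i j, i ≠ j → ¬ α j ≤ α i)
    (h : IsCompleteIntersection (Ideal.span (Set.range fun j => monomial (α j) (1 : k)))) :
    ∀ i j, i ≠ j → α i ⊓ α j = 0 := by
  classical
  intro i j hij
  obtain ⟨rs, hrs, hI⟩ := h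
  have hm : ∀ j, ∃ c : Fin rs.length → MvPolynomial σ k,
      ∑ a, c a * rs[a] = monomial (α j) (1 : k) := by
    intro j
    have h1 : monomial (α j) (1 : k) ∈ Ideal.ofList rs := by
      rw [hI]; exact Ideal.subset_span ⟨j, rfl⟩
    have h2 : {r | r ∈ rs} = Set.range fun a : Fin rs.length => rs[a] := by
      ext x
      simp [List.mem_iff_get]
    rw [Ideal.ofList, h2] at h1
    exact (Ideal.mem_span_range_iff_exists_fun).1 h1
  have hr : ∀ a : Fin rs.length, ∃ c : Fin s → MvPolynomial σ k,
      ∑ j, c j * monomial (α j) (1 : k) = rs[a] := by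
    intro a
    have h1 : rs[a] ∈ Ideal.ofList rs := Ideal.subset_span (List.getElem_mem _)
    rw [hI] at h1
    exact (Ideal.mem_span_range_iff_exists_fun).1 h1
  choose M hM using hm
  choose N hN using hr
  -- `P` is the composite change of generators, from the monomials to the regular sequence and back.
  -- No comparison of the two numbers of generators is needed.
  set P : Matrix (Fin s) (Fin s) (MvPolynomial σ k) := Matrix.of fun l j => ∑ a, N a l * M j a
    with hP
  have hPm : ∀ j, ∑ l, P l j * monomial (α l) (1 : k) = monomial (α j) (1 : k) := by
    intro j
    rw [← hM j]
    simp only [hP, Matrix.of_apply, Finset.sum_mul]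
    rw [Finset.sum_comm]
    refine Finset.sum_congr rfl fun a _ => ?_
    rw [← hN a, Finset.mul_sum]
    exact Finset.sum_congr rfl fun l _ => by ring
  -- The columns of `P - 1` are syzygies of a minimal set of monomials, so they have no constant
  -- terms. Thus `det P` has constant term one.
  have hPc : P.map constantCoeff = (1 : Matrix (Fin s) (Fin s) k) := by
    ext l j
    have := constantCoeff_eq_zero_of_sum_mul_monomial α hα
      (fun l => P l j - (1 : Matrix _ _ (MvPolynomial σ k)) l j) (by
        simp only [sub_mul, Finset.sum_sub_distrib, hPm]
        simp [Matrix.one_apply]) l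
    rw [map_sub, sub_eq_zero] at this
    rw [Matrix.map_apply, this, Matrix.one_apply, Matrix.one_apply]
    split_ifs <;> simp
  have hdet : constantCoeff P.det = 1 := by
    rw [RingHom.map_det, RingHom.mapMatrix_apply, hPc, Matrix.det_one]
  -- A syzygy `c` of the monomials is transported to a relation of the regular sequence, whose
  -- coefficients lie in the ideal. Transporting back puts the entries of `P c` in the ideal, and
  -- the adjugate of `P` then yields those of `det P • c`.
  have key : ∀ c : Fin s → MvPolynomial σ k, ∑ j, c j * monomial (α j) (1 : k) = 0 →
      ∀ i, P.det * c i ∈ Ideal.span (Set.range fun j => monomial (α j) (1 : k)) := by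
    intro c hc i
    have h1 : ∀ a, ∑ j, c j * M j a ∈ Ideal.ofList rs := by
      refine fun a => mem_ofList_of_sum_mul_eq_zero hrs.toIsWeaklyRegular
        (fun a => ∑ j, c j * M j a) ?_ a
      rw [← hc]
      simp only [Finset.sum_mul]
      rw [Finset.sum_comm]
      refine Finset.sum_congr rfl fun j _ => ?_
      rw [← hM j, Finset.mul_sum]
      exact Finset.sum_congr rfl fun l _ => by ring
    rw [hI] at h1
    have h2 : ∀ l, (P.mulVec c) l ∈ Ideal.span (Set.range fun j => monomial (α j) (1 : k)) := by
      intro l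
      have : (P.mulVec c) l = ∑ a, N a l * ∑ j, c j * M j a := by
        simp only [Matrix.mulVec, dotProduct, hP, Matrix.of_apply, Finset.sum_mul, Finset.mul_sum]
        rw [Finset.sum_comm]
        exact Finset.sum_congr rfl fun a _ => Finset.sum_congr rfl fun j _ => by ring
      rw [this]
      exact sum_mem fun a _ => Ideal.mul_mem_left _ _ (h1 a)
    have h3 : P.adjugate.mulVec (P.mulVec c) = P.det • c := by
      rw [Matrix.mulVec_mulVec, Matrix.adjugate_mul, Matrix.smul_mulVec, Matrix.one_mulVec]
    have h4 := congrFun h3 i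
    rw [Pi.smul_apply, smul_eq_mul] at h4
    rw [← h4]
    change ∑ a, P.adjugate i a * P.mulVec c a ∈ _
    exact sum_mem fun a _ => Ideal.mul_mem_left _ _ (h2 a)
  -- This is the syzygy `m_j / g, -m_i / g` with `g = gcd(m_i, m_j)`. Since `det P` has constant
  -- term one, the monomial `m_j / g` occurs in `det P · m_j / g`, and hence is divisible by a
  -- generator. By minimality this can only be `m_j`, so `g = 1`.
  have h5 := key (Pi.single i (monomial (α j - α i ⊓ α j) 1) -
    Pi.single j (monomial (α i - α i ⊓ α j) 1)) (by
      simp only [Pi.sub_apply, sub_mul, Finset.sum_sub_distrib, Pi.single_apply, ite_mul, zero_mul,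
        Finset.sum_ite_eq', Finset.mem_univ, if_true, monomial_mul, mul_one, sub_eq_zero]
      congr 1
      rw [tsub_add_eq_add_tsub inf_le_right, tsub_add_eq_add_tsub inf_le_left, add_comm]) i
  simp only [Pi.sub_apply, Pi.single_eq_same, Pi.single_eq_of_ne hij, sub_zero] at h5
  rw [mem_span_range_monomial_iff] at h5
  obtain ⟨l, hl⟩ := h5 (α j - α i ⊓ α j) (by
    rw [mem_support_iff, coeff_mul_monomial', if_pos le_rfl, tsub_self, ← constantCoeff_eq, hdet]
    simp)
  have hlj : l = j := by
    by_contra hne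
    exact hα j l (Ne.symm hne) (hl.trans tsub_le_self)
  subst hlj
  ext q
  have h6 := hl q
  simp only [Finsupp.coe_tsub, Pi.sub_apply, Finsupp.inf_apply, Finsupp.coe_zero,
    Pi.zero_apply] at h6 ⊢
  omega

end Coprime

/-! ### Coprime leading monomials give a regular sequence -/

section CoprimeLeading

open MvPolynomial

variable {k σ : Type*} [Field k] {s : ℕ}

/-- The ideal generated by the `f_j` with `j < i`. -/
def idealLT {R : Type*} [CommRing R] (f : Fin s → R) (i : ℕ) : Ideal R :=
  Ideal.span (f '' {j | (j : ℕ) < i})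

lemma idealLT_zero {R : Type*} [CommRing R] (f : Fin s → R) : idealLT f 0 = ⊥ := by
  simp [idealLT]

lemma idealLT_succ {R : Type*} [CommRing R] (f : Fin s → R) (i : Fin s) :
    idealLT f (i + 1) = idealLT f i ⊔ Ideal.span {f i} := by
  rw [idealLT, idealLT, ← Ideal.span_union, ← Set.image_singleton, ← Set.image_union]
  congr 2
  ext j
  simp only [Set.mem_ofPred_eq, Set.mem_union, Set.mem_singleton_iff, Fin.ext_iff]
  omega

lemma idealLT_eq {R : Type*} [CommRing R] (f : Fin s → R) : idealLT f s = Ideal.span (Set.range f) := by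
  rw [idealLT, ← Set.image_univ]
  congr 2
  ext j
  simp

lemma le_of_inf_eq_zero {a b c : σ →₀ ℕ} (h : a ⊓ b = 0) (hle : a ≤ c + b) : a ≤ c := by
  intro q
  have h1 := DFunLike.congr_fun h q
  have h2 := hle q
  simp only [Finsupp.inf_apply, Finsupp.coe_zero, Pi.zero_apply, Finsupp.coe_add,
    Pi.add_apply] at h1 h2
  omega

variable (m : MonomialOrder σ) {f : Fin s → MvPolynomial σ k}

lemma exists_reduced (hf : ∀ j, m.leadingCoeff (f j) = 1) (i : ℕ) (g : MvPolynomial σ k) :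
    ∃ q ∈ idealLT f i, ∃ r, g = q + r ∧ (r ≠ 0 → ∀ j : Fin s, (j : ℕ) < i →
      ¬ m.degree (f j) ≤ m.degree r) := by
  obtain ⟨c, r, h1, -, h3⟩ := m.div_set (B := f '' {j | (j : ℕ) < i})
    (by rintro _ ⟨j, -, rfl⟩; rw [hf j]; exact isUnit_one) g
  refine ⟨_, ?_, r, h1, fun hr j hj => h3 _ (m.degree_mem_support hr) _ ⟨j, hj, rfl⟩⟩
  rw [Finsupp.linearCombination_apply]
  exact sum_mem fun b _ => Ideal.mul_mem_left _ _ (Ideal.subset_span b.2)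

lemma ne_zero_of_leadingCoeff (hf : ∀ j, m.leadingCoeff (f j) = 1) (j : Fin s) : f j ≠ 0 := by
  intro h
  have := hf j
  simp [h] at this

/-- This is Buchberger's coprimality criterion for the initial segments of the family. Write an
element as `a' + r * f i`, with `a'` in the previous ideal and `r` reduced modulo the previous
generators. If `a'` and `r * f i` had the same leading monomial, an earlier leading monomial would
divide that of `r * f i`; being coprime to that of `f i`, it would divide that of `r`. So the
leading terms do not cancel. -/
lemma exists_degree_le (hf : ∀ j, m.leadingCoeff (f j) = 1)
    (hd : ∀ i j, i ≠ j → m.degree (f i) ⊓ m.degree (f j) = 0) (i : ℕ) (hi : i ≤ s) :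
    ∀ h ∈ idealLT f i, h ≠ 0 → ∃ j : Fin s, (j : ℕ) < i ∧ m.degree (f j) ≤ m.degree h := by
  induction i with
  | zero =>
    intro h hh h0
    rw [idealLT_zero] at hh
    exact absurd hh h0
  | succ i ih =>
    intro h hh h0
    obtain ⟨i, rfl⟩ : ∃ i' : Fin s, (i' : ℕ) = i := ⟨⟨i, hi⟩, rfl⟩
    have ih := ih (by omega)
    rw [idealLT_succ, Submodule.mem_sup] at hh
    obtain ⟨a, ha, b, hb, rfl⟩ := hh
    obtain ⟨g, rfl⟩ := Ideal.mem_span_singleton'.1 hb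
    obtain ⟨q, hq, r, rfl, hr⟩ := exists_reduced m hf i g
    have hq' : a + q * f i ∈ idealLT f i := add_mem ha (Ideal.mul_mem_right _ _ hq)
    rw [add_mul, ← add_assoc] at h0 ⊢
    set a' := a + q * f i
    by_cases hr0 : r = 0
    · simp only [hr0, zero_mul, add_zero] at h0 ⊢
      obtain ⟨j, hj, hj'⟩ := ih a' hq' h0
      exact ⟨j, by omega, hj'⟩
    have hdeg : m.degree (r * f i) = m.degree r + m.degree (f i) :=
      m.degree_mul hr0 (ne_zero_of_leadingCoeff m hf i)
    by_cases ha0 : a' = 0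
    · rw [ha0, zero_add, hdeg]
      exact ⟨i, by omega, le_add_self⟩
    obtain ⟨j, hj, hj'⟩ := ih a' hq' ha0
    have hne : m.degree a' ≠ m.degree (r * f i) := by
      intro he
      rw [he, hdeg] at hj'
      refine hr hr0 j hj (le_of_inf_eq_zero (hd j i ?_) hj')
      rintro rfl
      omega
    have := m.degree_add_of_ne hne
    rcases le_total (m.toSyn (m.degree a')) (m.toSyn (m.degree (r * f i))) with hle | hle
    · rw [sup_eq_right.2 hle] at this
      rw [m.toSyn.injective this, hdeg]
      exact ⟨i, by omega, le_add_self⟩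
    · rw [sup_eq_left.2 hle] at this
      rw [m.toSyn.injective this]
      exact ⟨j, by omega, hj'⟩

/-- Polynomials with pairwise coprime leading monomials form a regular sequence. -/
lemma mem_idealLT_of_mul_mem (hf : ∀ j, m.leadingCoeff (f j) = 1)
    (hd : ∀ i j, i ≠ j → m.degree (f i) ⊓ m.degree (f j) = 0) (i : Fin s)
    (g : MvPolynomial σ k) (hg : g * f i ∈ idealLT f i) : g ∈ idealLT f i := by
  obtain ⟨q, hq, r, rfl, hr⟩ := exists_reduced m hf i g
  have hr' : r * f i ∈ idealLT f i := by
    rw [add_mul] at hg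
    exact (Submodule.add_mem_iff_right _ (Ideal.mul_mem_right _ _ hq)).1 hg
  by_cases hr0 : r = 0
  · simpa [hr0] using hq
  have hfi := ne_zero_of_leadingCoeff m hf i
  -- An earlier leading monomial divides that of `r * f i`, hence by coprimality that of the reduced
  -- remainder `r`, which is impossible.
  obtain ⟨j, hj, hj'⟩ := exists_degree_le m hf hd i i.2.le _ hr' (mul_ne_zero hr0 hfi)
  rw [m.degree_mul hr0 hfi] at hj'
  refine absurd (le_of_inf_eq_zero (hd j i ?_) hj') (hr hr0 j hj)
  rintro rfl
  omega

lemma IsReducedGroebnerBasis.degree_inf (hf : IsReducedGroebnerBasis m f)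
    (hci : IsCompleteIntersection (initialIdeal m (Ideal.span (Set.range f)))) :
    ∀ i j, i ≠ j → m.degree (f i) ⊓ m.degree (f j) = 0 := by
  rw [hf.groebner] at hci
  exact disjoint_of_isCompleteIntersection _ (fun i j hij => hf.reduced i j hij _
    (m.degree_mem_support (ne_zero_of_leadingCoeff m hf.monic i))) hci

end CoprimeLeading

end BachComm

namespace BachComm

/-! ### Free modules modulo an ideal of coefficients -/

section CoeffSub

variable {R B C : Type*} [CommRing R]

/-- The elements of the free module all of whose coefficients lie in `J`. -/
def coeffSub (B : Type*) (J : Ideal R) : Submodule R (B →₀ R) where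
  carrier := {z | ∀ b, z b ∈ J}
  zero_mem' b := by simp
  add_mem' hy hz b := add_mem (hy b) (hz b)
  smul_mem' r z hz b := Ideal.mul_mem_left _ r (hz b)

lemma mem_coeffSub {J : Ideal R} {z : B →₀ R} : z ∈ coeffSub B J ↔ ∀ b, z b ∈ J := Iff.rfl

lemma coeffSub_mono {J J' : Ideal R} (h : J ≤ J') : coeffSub B J ≤ coeffSub B J' :=
  fun _ hz b => h (hz b)

lemma coeffSub_bot {z : B →₀ R} : z ∈ coeffSub B (⊥ : Ideal R) ↔ z = 0 := by
  rw [mem_coeffSub, Finsupp.ext_iff]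
  rfl

lemma smul_mem_coeffSub {J : Ideal R} {r : R} (hr : r ∈ J) (z : B →₀ R) :
    r • z ∈ coeffSub B J := fun _ => Ideal.mul_mem_right _ _ hr

lemma map_mem_coeffSub {J : Ideal R} (φ : (B →₀ R) →ₗ[R] (C →₀ R)) {z : B →₀ R}
    (hz : z ∈ coeffSub B J) : φ z ∈ coeffSub C J := by
  rw [← Finsupp.sum_single z, Finsupp.sum, map_sum]
  refine sum_mem fun b _ => ?_
  rw [single_eq_smul, map_smul]
  exact smul_mem_coeffSub (hz b) _

/-- Division by `f` modulo `J` is done coefficientwise. Setting the quotient to zero off the support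
of `z` keeps it finitely supported and in the same stage. -/
lemma exists_smul_sub_mem_coeffSub {J : Ideal R} {f : R} {t : Set B} {z : B →₀ R}
    (hz : z ∈ coeffSub B (J ⊔ Ideal.span {f})) (ht : z ∈ Finsupp.supported R R t) :
    ∃ w ∈ Finsupp.supported R R t, z - f • w ∈ coeffSub B J := by
  classical
  have h1 : ∀ b, ∃ g, z b - f * g ∈ J := by
    intro b
    obtain ⟨a, ha, c, hc, hac⟩ := Submodule.mem_sup.1 (hz b)
    obtain ⟨g, rfl⟩ := Ideal.mem_span_singleton'.1 hc
    refine ⟨g, ?_⟩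
    rw [← hac, mul_comm]
    simpa using ha
  choose g hg using h1
  refine ⟨Finsupp.onFinset z.support (fun b => if b ∈ z.support then g b else 0) (by
    intro b hb
    by_contra h
    simp [h] at hb), ?_, fun b => ?_⟩
  · rw [Finsupp.mem_supported] at ht ⊢
    exact (Finset.coe_subset.2 Finsupp.support_onFinset_subset).trans ht
  · rw [Finsupp.sub_apply, Finsupp.smul_apply, Finsupp.onFinset_apply, smul_eq_mul]
    split_ifs with h
    · exact hg b
    · rw [Finsupp.notMem_support_iff.1 h]
      simp

lemma mem_coeffSub_of_smul_mem {J : Ideal R} {f : R} (hf : ∀ g, g * f ∈ J → g ∈ J) {w : B →₀ R}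
    (hw : f • w ∈ coeffSub B J) : w ∈ coeffSub B J := fun b => hf _ <| by
  have := hw b
  rwa [Finsupp.smul_apply, smul_eq_mul, mul_comm] at this

end CoeffSub

/-! ### Killing cycles by divided power variables -/

section Tate

variable {n s : ℕ} {R : Type*} [CommRing R] {x : Fin n → R} {T : Fin n → Fin s → R}

lemma genDiff_mul_leftMul (x : Fin n → R) (T : Fin n → Fin s → R) (U : Fin n → R) :
    genDiff x T * leftMul U + leftMul U * genDiff x T =
      ((∑ p, U p * x p) • 1 : Module.End R (Symb n s →₀ R)) := by
  rw [genDiff_eq, add_mul, mul_add, ← koszul_mul_leftMul, Finset.sum_mul, Finset.mul_sum]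
  have : ∑ j, leftMul (fun p => T p j) * lower R j * leftMul U +
      ∑ j, leftMul U * (leftMul (fun p => T p j) * lower R j) =
        (0 : Module.End R (Symb n s →₀ R)) := by
    rw [← Finset.sum_add_distrib]
    refine Finset.sum_eq_zero fun j _ => ?_
    rw [mul_assoc, (commute_lower_leftMul j U).eq, ← mul_assoc, ← mul_assoc, ← add_mul,
      leftMul_add_leftMul, zero_mul]
  rw [add_add_add_comm, this, add_zero]

lemma genDiff_leftMul (x : Fin n → R) (T : Fin n → Fin s → R) (U : Fin n → R)
    (z : Symb n s →₀ R) : genDiff x T (leftMul U z) =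
      (∑ p, U p * x p) • z - leftMul U (genDiff x T z) := by
  have := LinearMap.congr_fun (genDiff_mul_leftMul x T U) z
  simp only [LinearMap.add_apply, Module.End.mul_apply, LinearMap.smul_apply,
    Module.End.one_apply] at this
  rw [← this]
  abel

variable {f : Fin s → R}

lemma genDiff_genDiff_mem (hf : ∀ j, ∑ p, T p j * x p = f j) {i m : ℕ} {y : Symb n s →₀ R}
    (hy : y ∈ stage R n s i m) : genDiff x T (genDiff x T y) ∈ coeffSub _ (idealLT f i) := by
  rw [← Module.End.mul_apply, genDiff_sq, LinearMap.sum_apply]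
  refine sum_mem fun j _ => ?_
  rw [hf, LinearMap.smul_apply]
  by_cases hj : (j : ℕ) < i
  · refine smul_mem_coeffSub (Ideal.subset_span ?_) _
    exact ⟨j, hj, rfl⟩
  · rw [lower_eq_zero hy (not_lt.1 hj), smul_zero]
    exact zero_mem _

variable (x T f) in
/-- Exactness in positive degrees, modulo `f_j` for `j < i`, of the part of the complex in which
only the variables `t_j` with `j < i` occur. -/
def StageExact (i : ℕ) : Prop :=
  ∀ m, ∀ y ∈ stage R n s i (m + 1), genDiff x T y ∈ coeffSub _ (idealLT f i) →
    ∃ u ∈ stage R n s i (m + 2), y - genDiff x T u ∈ coeffSub _ (idealLT f i)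

/-- This and the next two lemmas are the long exact sequence of multiplication by `f i` modulo the
earlier generators, before `t_i` is adjoined. In degree at least two, `d y = f_i w` modulo the
earlier ideal. Regularity makes `w` a cycle of positive degree, say `w = d u`, and then `y - f_i u`
is a cycle and therefore a boundary. -/
lemma exact_mod_of_two_le (hf : ∀ j, ∑ p, T p j * x p = f j) {i : Fin s}
    (hreg : ∀ g, g * f i ∈ idealLT f i → g ∈ idealLT f i) (he : StageExact x T f i) {m : ℕ}
    {y : Symb n s →₀ R} (hy : y ∈ stage R n s i (m + 2))
    (hd : genDiff x T y ∈ coeffSub _ (idealLT f (i + 1))) :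
    ∃ u ∈ stage R n s i (m + 3), y - genDiff x T u ∈ coeffSub _ (idealLT f (i + 1)) := by
  have hle : idealLT f i ≤ idealLT f (i + 1) := by rw [idealLT_succ]; exact le_sup_left
  have hfi : f i ∈ idealLT f (i + 1) := Ideal.subset_span ⟨i, by simp, rfl⟩
  rw [idealLT_succ] at hd
  obtain ⟨w, hw, hwr⟩ := exists_smul_sub_mem_coeffSub hd
    (genDiff_mem_stage hy : _ ∈ stage R n s i (m + 1))
  have h1 : genDiff x T w ∈ coeffSub _ (idealLT f i) := by
    refine mem_coeffSub_of_smul_mem hreg ?_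
    have h2 := sub_mem (genDiff_genDiff_mem hf hy) (map_mem_coeffSub (genDiff x T) hwr)
    simpa using h2
  obtain ⟨u, hu, hwu⟩ := he m w hw h1
  obtain ⟨v, hv, hyv⟩ := he (m + 1) (y - f i • u) (sub_mem hy (Submodule.smul_mem _ _ hu)) (by
    have h2 := add_mem hwr (Submodule.smul_mem _ (f i) hwu)
    simpa [smul_sub] using h2)
  refine ⟨v, hv, ?_⟩
  have := add_mem (coeffSub_mono hle hyv) (smul_mem_coeffSub hfi u)
  convert this using 1
  abel

/-- Here the quotient `c` has degree zero and need not be a boundary. Instead `f_i c` is the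
boundary of `Z_i c`, so the first homology is generated by the class of `∑ T_p e_p`. -/
lemma exact_mod_one (hf : ∀ j, ∑ p, T p j * x p = f j) {i : Fin s} (he : StageExact x T f i)
    {y : Symb n s →₀ R} (hy : y ∈ stage R n s i 1)
    (hd : genDiff x T y ∈ coeffSub _ (idealLT f (i + 1))) :
    ∃ c ∈ stage R n s i 0, ∃ u ∈ stage R n s i 2,
      y - leftMul (fun p => T p i) c - genDiff x T u ∈ coeffSub _ (idealLT f (i + 1)) := by
  have hle : idealLT f i ≤ idealLT f (i + 1) := by rw [idealLT_succ]; exact le_sup_left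
  rw [idealLT_succ] at hd
  obtain ⟨c, hc, hcr⟩ := exists_smul_sub_mem_coeffSub hd
    (genDiff_mem_stage hy : _ ∈ stage R n s i 0)
  obtain ⟨u, hu, hyu⟩ := he 0 (y - leftMul (fun p => T p i) c)
    (sub_mem hy (leftMul_mem_stage hc)) (by
      rw [map_sub, genDiff_leftMul, genDiff_zero (stage_le_piece _ _ hc), hf, map_zero, sub_zero]
      exact hcr)
  exact ⟨c, hc, u, hu, coeffSub_mono hle hyu⟩

/-- A multiple `Z_i c` of the new class bounds only if `c` itself does. Applying `d` to `Z_i c - d v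
= f_i w` gives `f_i c = f_i d w` modulo the earlier ideal, and `f_i` cancels there. -/
lemma exact_mod_zero (hf : ∀ j, ∑ p, T p j * x p = f j) {i : Fin s}
    (hreg : ∀ g, g * f i ∈ idealLT f i → g ∈ idealLT f i)
    {c v : Symb n s →₀ R} (hc : c ∈ stage R n s i 0) (hv : v ∈ stage R n s i 2)
    (hd : leftMul (fun p => T p i) c - genDiff x T v ∈ coeffSub _ (idealLT f (i + 1))) :
    ∃ u ∈ stage R n s i 1, c - genDiff x T u ∈ coeffSub _ (idealLT f (i + 1)) := by
  have hle : idealLT f i ≤ idealLT f (i + 1) := by rw [idealLT_succ]; exact le_sup_left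
  rw [idealLT_succ] at hd
  obtain ⟨w, hw, hwr⟩ := exists_smul_sub_mem_coeffSub hd
    (sub_mem (leftMul_mem_stage hc) (genDiff_mem_stage hv) : _ ∈ stage R n s i 1)
  refine ⟨w, hw, coeffSub_mono hle (mem_coeffSub_of_smul_mem hreg ?_)⟩
  have h1 := add_mem (map_mem_coeffSub (genDiff x T) hwr) (genDiff_genDiff_mem hf hv)
  rw [map_sub, map_sub, genDiff_leftMul, genDiff_zero (stage_le_piece _ _ hc), hf, map_zero,
    sub_zero, map_smul] at h1
  convert h1 using 1
  rw [smul_sub]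
  abel

lemma lower_pow_mul_raise_pow (j : Fin s) (L : ℕ) :
    lower R j ^ L * raise R j ^ L = (1 : Module.End R (Symb n s →₀ R)) := by
  induction L with
  | zero => simp
  | succ L ih => rw [pow_succ, pow_succ', mul_assoc, ← mul_assoc (lower R j), lower_mul_raise,
      one_mul, ih]

lemma raise_pow_mem_stage {i m : ℕ} {j : Fin s} (hj : (j : ℕ) < i) (L : ℕ) {z : Symb n s →₀ R}
    (hz : z ∈ stage R n s i m) : (raise R j ^ L) z ∈ stage R n s i (m + 2 * L) := by
  induction L with
  | zero => simpa using hz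
  | succ L ih =>
    rw [pow_succ', Module.End.mul_apply]
    exact raise_mem_stage hj ih

lemma lower_pow_mem_stage {i m : ℕ} {j : Fin s} (L : ℕ) {z : Symb n s →₀ R}
    (hz : z ∈ stage R n s i (m + 2 * L)) : (lower R j ^ L) z ∈ stage R n s i m := by
  induction L generalizing m with
  | zero => simpa using hz
  | succ L ih =>
    rw [pow_succ', Module.End.mul_apply]
    exact lower_mem_stage (ih ((by ring : m + 2 * (L + 1) = m + 2 + 2 * L) ▸ hz))

lemma lower_pow_eq_zero {i m : ℕ} {j : Fin s} {L : ℕ} (h : m < 2 * L) {z : Symb n s →₀ R}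
    (hz : z ∈ stage R n s i m) : (lower R j ^ L) z = 0 := by
  induction L generalizing m z with
  | zero => omega
  | succ L ih =>
    rw [pow_succ, Module.End.mul_apply]
    rcases Nat.lt_or_ge m 2 with hm | hm
    · rw [lower_zero hm (stage_le_piece _ _ hz), map_zero]
    · obtain ⟨m, rfl⟩ := Nat.exists_eq_add_of_le' hm
      exact ih (by omega) (lower_mem_stage hz)

/-- The part of `z` not involving `t_j`. -/
lemma sub_raise_lower_mem {m : ℕ} {i : Fin s} {z : Symb n s →₀ R}
    (hz : z ∈ stage R n s (i + 1) m) : z - raise R i (lower R i z) ∈ stage R n s i m := by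
  change (1 - raise R i * lower R i : Module.End R (Symb n s →₀ R)) z ∈ _
  refine hom_supported (fun b hb => ?_) hz
  simp only [LinearMap.sub_apply, Module.End.one_apply, Module.End.mul_apply]
  rw [lower_single]
  split_ifs with h
  · have h1 : (b.2 - Pi.single i 1 : Fin s → ℕ) + Pi.single i 1 = b.2 := by
      ext q
      by_cases hq : q = i
      · subst hq; simp; omega
      · simp [hq]
    rw [raise_single]
    simp [h1]
  · rw [map_zero, sub_zero]
    refine single_mem_stage hb.1 (fun j hj => ?_) _
    rcases eq_or_lt_of_le hj with hj | hj
    · rw [← Fin.ext hj]; omega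
    · exact hb.2 j hj

lemma genDiff_lower_pow (j : Fin s) (L : ℕ) (z : Symb n s →₀ R) :
    (lower R j ^ L) (genDiff x T z) = genDiff x T ((lower R j ^ L) z) :=
  LinearMap.congr_fun ((commute_lower_genDiff j x T).pow_left L).eq z

lemma lower_pow_raise_pow (j : Fin s) (L : ℕ) (z : Symb n s →₀ R) :
    (lower R j ^ L) ((raise R j ^ L) z) = z :=
  LinearMap.congr_fun (lower_pow_mul_raise_pow j L) z

/-- Subtracting a boundary from a cycle. -/
lemma stageExact_reduce {i : ℕ} {m : ℕ} {P : (Symb n s →₀ R) → Prop}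
    (hf : ∀ j, ∑ p, T p j * x p = f j)
    (ih : ∀ y ∈ stage R n s i (m + 1), genDiff x T y ∈ coeffSub _ (idealLT f i) → P y →
      ∃ u ∈ stage R n s i (m + 2), y - genDiff x T u ∈ coeffSub _ (idealLT f i))
    {y v : Symb n s →₀ R} (hy : y ∈ stage R n s i (m + 1))
    (hd : genDiff x T y ∈ coeffSub _ (idealLT f i)) (hv : v ∈ stage R n s i (m + 2))
    (h : P (y - genDiff x T v)) :
    ∃ u ∈ stage R n s i (m + 2), y - genDiff x T u ∈ coeffSub _ (idealLT f i) := by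
  obtain ⟨u, hu, hyu⟩ := ih (y - genDiff x T v) (sub_mem hy (genDiff_mem_stage hv)) (by
    rw [map_sub]
    exact sub_mem hd (genDiff_genDiff_mem hf hv)) h
  refine ⟨v + u, add_mem hv hu, ?_⟩
  rwa [map_add, ← sub_sub]

/-- Induction on a bound `L` for the power of `t_i` in the cycle, modulo the ideal. The coefficient
of the top power is again a cycle, now without `t_i`. A boundary with the same top coefficient is
subtracted; since `λ_i` commutes with `d` and `λ_i ∘ raise = 1`, such boundaries come from raising
chains. -/
lemma StageExact.succ (hf : ∀ j, ∑ p, T p j * x p = f j) {i : Fin s}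
    (hreg : ∀ g, g * f i ∈ idealLT f i → g ∈ idealLT f i) (he : StageExact x T f i) :
    StageExact x T f (i + 1) := by
  intro m
  have hlt : (i : ℕ) < i + 1 := Nat.lt_succ_self _
  have hmono := fun m => stage_mono (A := R) (n := n) (s := s) hlt.le m
  set J := coeffSub (Symb n s) (idealLT f (i + 1)) with hJ
  suffices key : ∀ L, ∀ y ∈ stage R n s (i + 1) (m + 1), genDiff x T y ∈ J →
      (lower R i ^ L) y ∈ J → ∃ u ∈ stage R n s (i + 1) (m + 2), y - genDiff x T u ∈ J by
    intro y hy hd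
    refine key (m + 1) y hy hd ?_
    rw [lower_pow_eq_zero (by omega) hy]
    exact zero_mem _
  intro L
  induction L with
  | zero =>
    intro y _ _ hy
    exact ⟨0, zero_mem _, by simpa using hy⟩
  | succ L ih =>
    intro y hy hd hL
    rcases Nat.lt_or_ge (m + 1) (2 * L) with hlt' | hge
    · refine ih y hy hd ?_
      rw [lower_pow_eq_zero hlt' hy]
      exact zero_mem _
    obtain ⟨q, hq⟩ := Nat.exists_eq_add_of_le' hge
    have hz : (lower R i ^ L) y ∈ stage R n s (i + 1) q := lower_pow_mem_stage L (hq ▸ hy)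
    set z := (lower R i ^ L) y with hzdef
    have hzd : genDiff x T z ∈ J := by
      rw [hzdef, ← genDiff_lower_pow]
      exact map_mem_coeffSub _ hd
    have hlz : lower R i z ∈ J := by
      rw [hzdef, ← Module.End.mul_apply, ← pow_succ']
      exact hL
    set u₁ := z - raise R i (lower R i z) with hu₁
    have hu₁s : u₁ ∈ stage R n s i q := sub_raise_lower_mem hz
    have hzu : z - u₁ ∈ J := by
      rw [hu₁, sub_sub_cancel]
      exact map_mem_coeffSub _ hlz
    have hu₁d : genDiff x T u₁ ∈ J := by
      have := sub_mem hzd (map_mem_coeffSub (genDiff x T) hzu)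
      rwa [← map_sub, sub_sub_cancel] at this
    clear_value u₁
    rcases q with _ | _ | q
    · -- degree zero
      -- The cycle has positive degree, so a top coefficient of degree zero stands before a positive
      -- power of `t_i`. The next lower coefficient `v` then satisfies `Z_i u₁ + d v = 0` modulo the
      -- ideal, which forces `u₁` to be a boundary.
      rcases L with _ | L
      · omega
      have hw : (lower R i ^ L) y ∈ stage R n s (i + 1) 2 :=
        lower_pow_mem_stage L ((by omega : m + 1 = 2 + 2 * L) ▸ hy)
      set w := (lower R i ^ L) y with hwdef
      have hwz : lower R i w = z := by
        rw [hzdef, hwdef, ← Module.End.mul_apply, ← pow_succ']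
      set v := w - raise R i (lower R i w) with hvdef
      have hv : v ∈ stage R n s i 2 := sub_raise_lower_mem hw
      have hwd : genDiff x T w ∈ J := by
        rw [hwdef, ← genDiff_lower_pow]
        exact map_mem_coeffSub _ hd
      have h1 : genDiff x T (raise R i u₁) = leftMul (fun p => T p i) u₁ := by
        rw [genDiff_raise (lower_eq_zero hu₁s le_rfl), genDiff_zero (stage_le_piece _ _ hu₁s),
          map_zero, zero_add]
      obtain ⟨v', hv', huv⟩ := exact_mod_zero hf hreg hu₁s (neg_mem hv) (by
        rw [← h1, map_neg, sub_neg_eq_add, ← map_add]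
        have h2 := sub_mem hwd (map_mem_coeffSub (genDiff x T)
          (map_mem_coeffSub (raise R i) hzu))
        rw [← map_sub] at h2
        convert h2 using 2
        rw [hvdef, hwz, map_sub]
        generalize raise R i z = a
        abel)
      refine stageExact_reduce hf ih hy hd (v := (raise R i ^ (L + 1)) v') ?_ ?_
      · exact (by omega : 1 + 2 * (L + 1) = m + 2) ▸ raise_pow_mem_stage hlt (L + 1) (hmono _ hv')
      · rw [map_sub, genDiff_lower_pow, lower_pow_raise_pow]
        have := add_mem hzu huv
        convert this using 1
        abel
    · -- degree one
      -- The class `Z_i c` is removed by a chain with one more power of `t_i`, because `d (raise c)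
      -- = Z_i c` for `c` of degree zero.
      obtain ⟨c, hc, v, hv, hcv⟩ := exact_mod_one hf he hu₁s hu₁d
      refine stageExact_reduce hf ih hy hd
        (v := (raise R i ^ (L + 1)) c + (raise R i ^ L) v) (add_mem ?_ ?_) ?_
      · exact (by omega : 0 + 2 * (L + 1) = m + 2) ▸ raise_pow_mem_stage hlt (L + 1) (hmono _ hc)
      · exact (by omega : 2 + 2 * L = m + 2) ▸ raise_pow_mem_stage hlt L (hmono _ hv)
      · rw [map_sub, genDiff_lower_pow, map_add, lower_pow_raise_pow, pow_succ,
          Module.End.mul_apply, lower_pow_raise_pow, map_add,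
          genDiff_raise (lower_eq_zero hc le_rfl), genDiff_zero (stage_le_piece _ _ hc),
          map_zero, zero_add]
        have := add_mem hzu hcv
        convert this using 1
        abel
    · obtain ⟨v, hv, huv⟩ := exact_mod_of_two_le hf hreg he hu₁s hu₁d
      refine stageExact_reduce hf ih hy hd (v := (raise R i ^ L) v) ?_ ?_
      · exact (by omega : q + 3 + 2 * L = m + 2) ▸ raise_pow_mem_stage hlt L (hmono _ hv)
      · rw [map_sub, genDiff_lower_pow, lower_pow_raise_pow]
        have := add_mem hzu huv
        convert this using 1
        abel

lemma stageExact (hf : ∀ j, ∑ p, T p j * x p = f j)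
    (hreg : ∀ i : Fin s, ∀ g, g * f i ∈ idealLT f i → g ∈ idealLT f i)
    (h0 : StageExact x T f 0) (i : ℕ) (hi : i ≤ s) : StageExact x T f i := by
  induction i with
  | zero => exact h0
  | succ i ih => exact StageExact.succ (i := ⟨i, hi⟩) hf (hreg _) (ih (by omega))

lemma stageExact_zero (h : ∀ m, ∀ z ∈ stage R n s 0 (m + 1), koszul x z = 0 →
    ∃ y ∈ stage R n s 0 (m + 2), koszul x y = z) : StageExact x T f 0 := by
  have hk : ∀ m, ∀ z ∈ stage R n s 0 m, genDiff x T z = koszul x z := by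
    intro m z hz
    rw [genDiff_eq, LinearMap.add_apply, LinearMap.sum_apply, Finset.sum_eq_zero, add_zero]
    intro j _
    rw [Module.End.mul_apply, lower_eq_zero hz (Nat.zero_le _), map_zero]
  intro m y hy hd
  rw [idealLT_zero, coeffSub_bot, hk _ _ hy] at hd
  obtain ⟨u, hu, rfl⟩ := h m y hy hd
  refine ⟨u, hu, ?_⟩
  rw [hk _ _ hu, sub_self]
  exact zero_mem _

end Tate

end BachComm

namespace BachComm

/-! ### Passage from the polynomial ring to the quotient -/

section MapCoeff

variable {n s : ℕ} {R R' : Type*} [CommRing R] [CommRing R'] (φ : R →+* R')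

/-- Change of coefficients. -/
noncomputable def mapCoeff (B : Type*) : (B →₀ R) →+ (B →₀ R') :=
  Finsupp.mapRange.addMonoidHom φ.toAddMonoidHom

@[simp] lemma mapCoeff_single {B : Type*} (b : B) (r : R) :
    mapCoeff φ B (Finsupp.single b r) = Finsupp.single b (φ r) := by
  simp [mapCoeff]

@[simp] lemma mapCoeff_apply {B : Type*} (z : B →₀ R) (b : B) : mapCoeff φ B z b = φ (z b) := rfl

lemma mapCoeff_smul {B : Type*} (r : R) (z : B →₀ R) :
    mapCoeff φ B (r • z) = φ r • mapCoeff φ B z := by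
  ext b
  simp

lemma mapCoeff_hom {B C : Type*} {Φ : (B →₀ R) →ₗ[R] (C →₀ R)}
    {Ψ : (B →₀ R') →ₗ[R'] (C →₀ R')}
    (h : ∀ b, mapCoeff φ C (Φ (Finsupp.single b 1)) = Ψ (Finsupp.single b 1)) (z : B →₀ R) :
    mapCoeff φ C (Φ z) = Ψ (mapCoeff φ B z) := by
  induction z using Finsupp.induction_linear with
  | zero => simp
  | add y z hy hz => simp [hy, hz]
  | single b r =>
    rw [mapCoeff_single, single_eq_smul, map_smul, mapCoeff_smul, h, ← map_smul, ← single_eq_smul]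

lemma mapCoeff_sgn (I J : Finset (Fin n)) : φ (sgn R I J) = sgn R' I J := by
  simp [sgn]

lemma mapCoeff_genDiff (x : Fin n → R) (T : Fin n → Fin s → R) (z : Symb n s →₀ R) :
    mapCoeff φ _ (genDiff x T z) =
      genDiff (fun i => φ (x i)) (fun p j => φ (T p j)) (mapCoeff φ _ z) := by
  have h1 : ∀ i, ∀ z : Symb n s →₀ R, mapCoeff φ _ (contr R i z) =
      contr R' i (mapCoeff φ _ z) := fun i => mapCoeff_hom φ fun b => by
    rw [contr_single, contr_single]
    split_ifs <;> simp [mapCoeff_sgn]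
  have h2 : ∀ i, ∀ z : Symb n s →₀ R, mapCoeff φ _ (extMul R i z) =
      extMul R' i (mapCoeff φ _ z) := fun i => mapCoeff_hom φ fun b => by
    rw [extMul_single, extMul_single]
    split_ifs <;> simp [mapCoeff_sgn]
  have h3 : ∀ i, ∀ z : Symb n s →₀ R, mapCoeff φ _ (lower R i z) =
      lower R' i (mapCoeff φ _ z) := fun i => mapCoeff_hom φ fun b => by
    rw [lower_single, lower_single]
    split_ifs <;> simp
  simp only [genDiff, LinearMap.add_apply, LinearMap.sum_apply, LinearMap.smul_apply,
    Module.End.mul_apply, map_add, map_sum, mapCoeff_smul, h1, h2, h3]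

lemma mapCoeff_eq_zero_iff {B : Type*} (z : B →₀ R) :
    mapCoeff φ B z = 0 ↔ z ∈ coeffSub B (RingHom.ker φ) := by
  rw [Finsupp.ext_iff, mem_coeffSub]
  rfl

lemma mapCoeff_mem {B : Type*} {t : Set B} {z : B →₀ R} (hz : z ∈ Finsupp.supported R R t) :
    mapCoeff φ B z ∈ Finsupp.supported R' R' t := by
  rw [Finsupp.mem_supported'] at hz ⊢
  intro b hb
  rw [mapCoeff_apply, hz b hb, map_zero]

lemma exists_mapCoeff_eq (hφ : Function.Surjective φ) {B : Type*} {t : Set B} {z : B →₀ R'}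
    (hz : z ∈ Finsupp.supported R' R' t) :
    ∃ y ∈ Finsupp.supported R R t, mapCoeff φ B y = z := by
  refine supported_induction (P := fun z => ∃ y ∈ Finsupp.supported R R t, mapCoeff φ B y = z)
    ⟨0, zero_mem _, map_zero _⟩ ?_ ?_ hz
  · rintro _ _ ⟨y, hy, rfl⟩ ⟨z, hz, rfl⟩
    exact ⟨y + z, add_mem hy hz, map_add _ _ _⟩
  · intro b hb r
    obtain ⟨r, rfl⟩ := hφ r
    exact ⟨_, Finsupp.single_mem_supported R r hb, mapCoeff_single _ _ _⟩

end MapCoeff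

/-! ### The complex over `A` is a resolution -/

section Resolution

open MvPolynomial

variable {k : Type*} [Field k] {n s : ℕ}

lemma sum_lastVarPart_mul_X {g : MvPolynomial (Fin n) k} (hg : constantCoeff g = 0) :
    ∑ p, lastVarPart p g * X p = g := by
  have h1 : ∀ p, lastVarPart p g * X p =
      ∑ α ∈ g.support, if α.support.max = (p : WithBot (Fin n)) then monomial α (coeff α g) else 0 := by
    intro p
    rw [lastVarPart, Finset.sum_mul, Finset.sum_filter]
    refine Finset.sum_congr rfl fun α _ => ?_
    split_ifs with h
    · rw [X, monomial_mul, mul_one, tsub_add_cancel_of_le]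
      rw [Finsupp.single_le_iff]
      exact Nat.one_le_iff_ne_zero.2 (Finsupp.mem_support_iff.1 (Finset.mem_of_max h))
    · rfl
  conv_rhs => rw [g.as_sum]
  rw [Finset.sum_congr rfl fun p _ => h1 p, Finset.sum_comm]
  refine Finset.sum_congr rfl fun α hα => ?_
  have hne : α.support.Nonempty := by
    rw [Finsupp.support_nonempty_iff]
    rintro rfl
    rw [mem_support_iff] at hα
    exact hα hg
  obtain ⟨p, hp⟩ := Finset.max_of_nonempty hne
  rw [hp, Finset.sum_eq_single p]
  · simp
  · intro q _ hq
    rw [if_neg]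
    intro h
    exact hq (WithBot.coe_injective h).symm
  · simp

variable (f : Fin s → MvPolynomial (Fin n) k)

lemma diff_eq : diff f =
    genDiff (var f) fun p j => Ideal.Quotient.mk _ (lastVarPart p (f j)) := by
  refine finsupp_hom_ext fun b => ?_
  rw [genDiff_single, diff]
  simp

lemma mapCoeff_diff (z : Symb n s →₀ MvPolynomial (Fin n) k) :
    diff f (mapCoeff (Ideal.Quotient.mk _) _ z) =
      mapCoeff (Ideal.Quotient.mk _) _ (genDiff X (fun p j => lastVarPart p (f j)) z) := by
  rw [diff_eq, mapCoeff_genDiff]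
  rfl

lemma aug_single (b : Symb n s) (r : QuotAlg f) : aug f (Finsupp.single b r) =
    if b = (∅, 0) then Ideal.Quotient.mk (augIdeal f) r else 0 := by
  rw [aug, Finsupp.linearCombination_single]
  split_ifs
  · change Ideal.Quotient.mk (augIdeal f) (r * 1) = _
    rw [mul_one]
  · simp

lemma hdeg_eq_zero {b : Symb n s} (h : hdeg b = 0) : b = (∅, 0) := by
  obtain ⟨I, l⟩ := b
  simp only [hdeg, Nat.add_eq_zero_iff, Finset.card_eq_zero, mul_eq_zero, OfNat.ofNat_ne_zero,
    false_or, Finset.sum_eq_zero_iff, Finset.mem_univ, true_imp_iff] at h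
  ext1
  · exact h.1
  · funext j; exact h.2 j

lemma exists_single_of_mem_piece_zero {A : Type*} [CommRing A] {z : Symb n s →₀ A}
    (hz : z ∈ piece A hdeg 0) : ∃ a, z = Finsupp.single (∅, 0) a := by
  refine piece_induction (P := fun z => ∃ a, z = Finsupp.single (∅, 0) a) ⟨0, by simp⟩ ?_ ?_ hz
  · rintro _ _ ⟨a, rfl⟩ ⟨b, rfl⟩
    exact ⟨a + b, by simp⟩
  · intro b r hb
    exact ⟨r, by rw [hdeg_eq_zero hb]⟩

lemma aug_diff {z : Symb n s →₀ QuotAlg f} (hz : z ∈ piece (QuotAlg f) hdeg 1) :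
    aug f (diff f z) = 0 := by
  refine hom_piece_eq (φ := aug f ∘ₗ diff f) (ψ := 0) (fun b hb => ?_) hz
  rw [LinearMap.zero_apply, LinearMap.comp_apply, diff_eq]
  simp only [genDiff, LinearMap.add_apply, LinearMap.sum_apply, LinearMap.smul_apply,
    Module.End.mul_apply, map_add, map_sum, map_smul]
  rw [Finset.sum_eq_zero, Finset.sum_eq_zero, add_zero]
  · intro j _
    refine Finset.sum_eq_zero fun p _ => ?_
    rw [lower_zero (by omega : 1 < 2) (single_mem_piece hb _), map_zero, map_zero, smul_zero]
  · intro i _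
    rw [← map_smul, contr_single]
    split_ifs with h
    · rw [Finsupp.smul_single, smul_eq_mul, aug_single]
      split_ifs
      · rw [Ideal.Quotient.eq_zero_iff_mem]
        exact Ideal.mul_mem_right _ _ (Ideal.subset_span ⟨i, rfl⟩)
      · rfl
    · simp

lemma diff_single_singleton (i : Fin n) :
    diff f (Finsupp.single ({i}, 0) 1) = Finsupp.single (∅, 0) (var f i) := by
  rw [diff_eq]
  simp only [genDiff, LinearMap.add_apply, LinearMap.sum_apply, LinearMap.smul_apply,
    Module.End.mul_apply]
  rw [Finset.sum_eq_single i, Finset.sum_eq_zero, add_zero, contr_single]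
  · simp
  · intro j _
    refine Finset.sum_eq_zero fun p _ => ?_
    rw [lower_single]
    simp
  · intro j _ hj
    rw [contr_single]
    simp [hj]
  · simp

lemma diff_mem {i : ℕ} {z : Symb n s →₀ QuotAlg f} (hz : z ∈ piece (QuotAlg f) hdeg (i + 1)) :
    diff f z ∈ piece (QuotAlg f) hdeg i := by
  rw [diff_eq]; exact genDiff_mem hz

variable {f}

lemma sum_mk_lastVarPart (h0 : ∀ j, constantCoeff (f j) = 0) (j : Fin s) :
    ∑ p, (Ideal.Quotient.mk _ (lastVarPart p (f j)) : QuotAlg f) * var f p = 0 := by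
  simp only [var, ← map_mul, ← map_sum]
  rw [sum_lastVarPart_mul_X (h0 j), Ideal.Quotient.eq_zero_iff_mem]
  exact Ideal.subset_span ⟨j, rfl⟩

lemma isDGAlgebra_diff (h0 : ∀ j, constantCoeff (f j) = 0) :
    IsDGAlgebra hdeg (mul (QuotAlg f)) (one (QuotAlg f)) (diff f) := by
  rw [diff_eq]
  exact isDGAlgebra_genDiff _ _ (sum_mk_lastVarPart h0)

/-- In positive degrees a cycle over `A` lifts to a chain over `S` that is a cycle modulo the whole
ideal, which is the last stage of Tate's construction. In degree zero the boundaries of the `e_i`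
are the variables, and these generate the kernel of the augmentation. -/
lemma isFreeResolution_diff (h0 : ∀ j, constantCoeff (f j) = 0)
    (hreg : ∀ i : Fin s, ∀ g, g * f i ∈ idealLT f i → g ∈ idealLT f i) :
    IsFreeResolution hdeg (diff f) (aug f) where
  d_mem i z hz := diff_mem f hz
  d_zero z hz := (isDGAlgebra_diff h0).d_zero z hz
  aug_pos i z hz := by
    refine hom_piece_eq (ψ := 0) (fun b hb => ?_) hz
    rw [aug_single, if_neg, LinearMap.zero_apply]
    rintro rfl
    simp [hdeg] at hb
  aug_surjective m := by
    obtain ⟨a, rfl⟩ := Ideal.Quotient.mk_surjective m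
    exact ⟨_, single_mem_piece (b := (∅, 0)) (by simp [hdeg]) a, by simp [aug_single]⟩
  exact_zero z hz := by
    constructor
    · intro h
      obtain ⟨a, rfl⟩ := exists_single_of_mem_piece_zero hz
      rw [aug_single, if_pos rfl, Ideal.Quotient.eq_zero_iff_mem, augIdeal,
        Ideal.mem_span_range_iff_exists_fun] at h
      obtain ⟨c, rfl⟩ := h
      refine ⟨∑ i, c i • Finsupp.single ({i}, 0) 1, sum_mem fun i _ => Submodule.smul_mem _ _
        (single_mem_piece (by simp [hdeg]) _), ?_⟩
      rw [map_sum, Finsupp.single_finsetSum]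
      refine Finset.sum_congr rfl fun i _ => ?_
      rw [map_smul, diff_single_singleton, Finsupp.smul_single, smul_eq_mul]
    · rintro ⟨y, hy, rfl⟩
      exact aug_diff f hy
  exact_succ i z hz := by
    constructor
    · intro h
      obtain ⟨z, hz', rfl⟩ := exists_mapCoeff_eq (Ideal.Quotient.mk _) Ideal.Quotient.mk_surjective hz
      rw [mapCoeff_diff, mapCoeff_eq_zero_iff, Ideal.mk_ker, ← idealLT_eq] at h
      change z ∈ piece _ hdeg (i + 1) at hz'
      rw [← stage_eq_piece le_rfl] at hz'
      obtain ⟨u, hu, hzu⟩ := stageExact (x := X) (T := fun p j => lastVarPart p (f j)) (f := f)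
        (fun j => sum_lastVarPart_mul_X (h0 j)) hreg
        (stageExact_zero fun m z hz h => koszul_exact hz h) s le_rfl i z hz' h
      rw [stage_eq_piece le_rfl] at hu
      refine ⟨_, mapCoeff_mem (Ideal.Quotient.mk _) hu, ?_⟩
      rw [idealLT_eq, ← Ideal.mk_ker (I := Ideal.span (Set.range f)), ← mapCoeff_eq_zero_iff, map_sub,
        sub_eq_zero] at hzu
      rw [hzu, mapCoeff_diff]
    · rintro ⟨y, -, rfl⟩
      exact (isDGAlgebra_diff h0).d_d y

end Resolution

end BachComm

namespace BachComm

open MvPolynomial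

variable {k : Type*} [Field k] {n s : ℕ} {f : Fin s → MvPolynomial (Fin n) k}

/-! ### Minimality -/

section Minimal

lemma mk_mem_augIdeal {g : MvPolynomial (Fin n) k} (hg : constantCoeff g = 0) :
    Ideal.Quotient.mk _ g ∈ augIdeal f := by
  rw [← sum_lastVarPart_mul_X hg, map_sum]
  refine sum_mem fun p _ => ?_
  rw [map_mul]
  exact Ideal.mul_mem_left _ _ (Ideal.subset_span ⟨p, rfl⟩)

lemma sub_single_add_single {α : Fin n →₀ ℕ} {p : Fin n}
    (h : α.support.max = (p : WithBot (Fin n))) :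
    α - Finsupp.single p 1 + Finsupp.single p 1 = α := by
  rw [tsub_add_cancel_of_le]
  rw [Finsupp.single_le_iff]
  exact Nat.one_le_iff_ne_zero.2 (Finsupp.mem_support_iff.1 (Finset.mem_of_max h))

/-- A constant term of `T_p(g)` could only come from the linear monomial `x_p`. -/
lemma constantCoeff_lastVarPart {g : MvPolynomial (Fin n) k}
    (hg : ∀ i, coeff (Finsupp.single i 1) g = 0) (p : Fin n) :
    constantCoeff (lastVarPart p g) = 0 := by
  classical
  rw [lastVarPart, map_sum]
  refine Finset.sum_eq_zero fun α hα => ?_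
  rw [Finset.mem_filter] at hα
  rw [constantCoeff_monomial, if_neg]
  intro h
  have h1 := sub_single_add_single hα.2
  rw [h, zero_add] at h1
  rw [mem_support_iff, ← h1, hg] at hα
  exact hα.1 rfl

lemma diff_mem_coeffSub (hlin : ∀ j i, coeff (Finsupp.single i 1) (f j) = 0)
    (z : Symb n s →₀ QuotAlg f) : diff f z ∈ coeffSub _ (augIdeal f) := by
  rw [diff_eq]
  simp only [genDiff, LinearMap.add_apply, LinearMap.sum_apply, LinearMap.smul_apply]
  exact add_mem (sum_mem fun i _ => smul_mem_coeffSub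
      (Ideal.subset_span (Set.mem_range_self i)) _)
    (sum_mem fun j _ => sum_mem fun p _ => smul_mem_coeffSub
      (mk_mem_augIdeal (constantCoeff_lastVarPart (hlin j) p)) _)

lemma isMinimal_diff (hlin : ∀ j i, coeff (Finsupp.single i 1) (f j) = 0) :
    IsMinimal (augIdeal f) (diff f) := fun b c => diff_mem_coeffSub hlin (Finsupp.single b 1) c

end Minimal

/-! ### Gradings of `A` and of free modules over it -/

section Grading

variable {Γ : Type*} [AddCommMonoid Γ] (w : Fin n → Γ)

variable (f) in
/-- The classes of the polynomials all of whose terms have weight in `D`. -/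
noncomputable def weightPart (D : Set Γ) : Submodule k (QuotAlg f) :=
  ⨆ (δ : Γ) (_ : δ ∈ D), homogeneousPart f w δ

variable {w}

lemma mk_monomial_mem_weightPart {D : Set Γ} {α : Fin n →₀ ℕ} (h : Finsupp.weight w α ∈ D) (c : k) :
    Ideal.Quotient.mk _ (monomial α c) ∈ weightPart f w D := by
  refine Submodule.mem_iSup_of_mem _ (Submodule.mem_iSup_of_mem h ?_)
  exact ⟨_, (mem_weightedHomogeneousSubmodule _ _ _ _).2
    (isWeightedHomogeneous_monomial _ _ _ rfl), rfl⟩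

lemma mk_mem_weightPart {D : Set Γ} {g : MvPolynomial (Fin n) k}
    (h : ∀ α ∈ g.support, Finsupp.weight w α ∈ D) :
    Ideal.Quotient.mk _ g ∈ weightPart f w D := by
  rw [g.as_sum, map_sum]
  exact sum_mem fun α hα => mk_monomial_mem_weightPart (h α hα) _

/-- Sets of weights are needed because `{δ | δ + deg c = deg b}` may have several elements when `Γ`
is not cancellative. -/
lemma mem_weightPart_iff {D : Set Γ} {a : QuotAlg f} : a ∈ weightPart f w D ↔
    ∃ g : MvPolynomial (Fin n) k, (∀ α ∈ g.support, Finsupp.weight w α ∈ D) ∧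
      Ideal.Quotient.mk _ g = a := by
  classical
  constructor
  · intro h
    refine Submodule.iSup_induction' (fun δ => ⨆ (_ : δ ∈ D), homogeneousPart f w δ)
      (motive := fun a _ => ∃ g : MvPolynomial (Fin n) k,
        (∀ α ∈ g.support, Finsupp.weight w α ∈ D) ∧ Ideal.Quotient.mk _ g = a) ?_ ?_ ?_ h
    · intro δ a ha
      by_cases hδ : δ ∈ D
      · simp only [hδ, iSup_pos] at ha
        obtain ⟨g, hg, rfl⟩ := ha
        refine ⟨g, fun α hα => ?_, rfl⟩
        rw [(mem_weightedHomogeneousSubmodule _ _ _ _).1 hg (mem_support_iff.1 hα)]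
        exact hδ
      · simp only [hδ, iSup_false] at ha
        rw [Submodule.mem_bot] at ha
        exact ⟨0, by simp, by simp [ha]⟩
    · exact ⟨0, by simp, by simp⟩
    · rintro _ _ _ _ ⟨g, hg, rfl⟩ ⟨h, hh, rfl⟩
      refine ⟨g + h, fun α hα => ?_, map_add _ _ _⟩
      rcases Finset.mem_union.1 (support_add hα) with hα | hα
      exacts [hg α hα, hh α hα]
  · rintro ⟨g, hg, rfl⟩
    exact mk_mem_weightPart hg

lemma mul_mem_weightPart {D D' E : Set Γ} (h : ∀ δ ∈ D, ∀ δ' ∈ D', δ + δ' ∈ E)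
    {a a' : QuotAlg f} (ha : a ∈ weightPart f w D) (ha' : a' ∈ weightPart f w D') :
    a * a' ∈ weightPart f w E := by
  classical
  obtain ⟨g, hg, rfl⟩ := mem_weightPart_iff.1 ha
  obtain ⟨g', hg', rfl⟩ := mem_weightPart_iff.1 ha'
  rw [← map_mul]
  refine mk_mem_weightPart fun α hα => ?_
  obtain ⟨β, hβ, β', hβ', rfl⟩ := Finset.mem_add.1 (support_mul _ _ hα)
  rw [map_add]
  exact h _ (hg _ hβ) _ (hg' _ hβ')

variable {B C : Type*} (deg : B → Γ) (degC : C → Γ)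

variable (f w) in
/-- The homogeneous elements of degree `γ` of a graded free module. -/
def homPart (γ : Γ) : Submodule k (B →₀ QuotAlg f) where
  carrier := {z | ∀ b, z b ∈ weightPart f w {δ | δ + deg b = γ}}
  zero_mem' b := by simp
  add_mem' hy hz b := add_mem (hy b) (hz b)
  smul_mem' r z hz b := Submodule.smul_mem _ r (hz b)

variable {deg degC}

lemma single_mem_homPart {γ : Γ} {b : B} {a : QuotAlg f}
    (ha : a ∈ weightPart f w {δ | δ + deg b = γ}) : Finsupp.single b a ∈ homPart f w deg γ := by
  classical
  intro c
  rw [Finsupp.single_apply]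
  split_ifs with h
  · exact h ▸ ha
  · exact zero_mem _

lemma smul_mem_homPart {D : Set Γ} {ρ γ : Γ} (h : ∀ δ ∈ D, δ + ρ = γ) {a : QuotAlg f}
    (ha : a ∈ weightPart f w D) {y : C →₀ QuotAlg f} (hy : y ∈ homPart f w degC ρ) :
    a • y ∈ homPart f w degC γ := by
  intro c
  rw [Finsupp.smul_apply, smul_eq_mul]
  refine mul_mem_weightPart (fun δ hδ δ' hδ' => ?_) ha (hy c)
  rw [Set.mem_ofPred_eq] at hδ' ⊢
  rw [add_assoc, hδ', h δ hδ]

lemma map_mem_homPart {φ : (B →₀ QuotAlg f) →ₗ[QuotAlg f] (C →₀ QuotAlg f)}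
    (hφ : ∀ b, φ (Finsupp.single b 1) ∈ homPart f w degC (deg b)) {γ : Γ} {z : B →₀ QuotAlg f}
    (hz : z ∈ homPart f w deg γ) : φ z ∈ homPart f w degC γ := by
  rw [← Finsupp.sum_single z, Finsupp.sum, map_sum]
  refine sum_mem fun b _ => ?_
  rw [single_eq_smul, map_smul]
  exact smul_mem_homPart (fun δ hδ => hδ) (hz b) (hφ b)

end Grading

/-! ### Projections onto graded parts -/

section Projection

variable {Γ : Type*} [AddCommMonoid Γ] {w : Fin n → Γ}

open Classical in
variable (k w) in
/-- The part of a polynomial consisting of the terms of weight in `D`. -/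
noncomputable def weightRestrict (D : Set Γ) :
    MvPolynomial (Fin n) k →ₗ[k] MvPolynomial (Fin n) k :=
  (basisMonomials (Fin n) k).constr k fun α => if Finsupp.weight w α ∈ D then monomial α 1 else 0

open Classical in
lemma weightRestrict_monomial (D : Set Γ) (α : Fin n →₀ ℕ) (c : k) :
    weightRestrict k w D (monomial α c) = if Finsupp.weight w α ∈ D then monomial α c else 0 := by
  have h1 := (basisMonomials (Fin n) k).constr_basis k
    (fun α => if Finsupp.weight w α ∈ D then monomial α (1 : k) else 0) α
  rw [coe_basisMonomials] at h1
  have : monomial α c = c • monomial α (1 : k) := by simp [smul_monomial]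
  rw [this, map_smul, weightRestrict, h1]
  split_ifs <;> simp

lemma weightRestrict_eq_self {D : Set Γ} {g : MvPolynomial (Fin n) k}
    (h : ∀ α ∈ g.support, Finsupp.weight w α ∈ D) : weightRestrict k w D g = g := by
  rw [g.as_sum, map_sum]
  refine Finset.sum_congr rfl fun α hα => ?_
  rw [weightRestrict_monomial, if_pos (h α hα)]

lemma weightRestrict_eq_zero {D : Set Γ} {g : MvPolynomial (Fin n) k}
    (h : ∀ α ∈ g.support, Finsupp.weight w α ∉ D) : weightRestrict k w D g = 0 := by
  rw [g.as_sum, map_sum]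
  refine Finset.sum_eq_zero fun α hα => ?_
  rw [weightRestrict_monomial, if_neg (h α hα)]

lemma weight_mem_support_weightRestrict (D : Set Γ) (g : MvPolynomial (Fin n) k) :
    ∀ α ∈ (weightRestrict k w D g).support, Finsupp.weight w α ∈ D := by
  classical
  intro α hα
  rw [g.as_sum, map_sum] at hα
  obtain ⟨β, -, hβ⟩ := Finset.mem_biUnion.1 (support_sum hα)
  rw [weightRestrict_monomial] at hβ
  split_ifs at hβ with h
  · rw [Finset.mem_singleton.1 (support_monomial_subset hβ)]
    exact h
  · simp at hβ

variable {I : Ideal (MvPolynomial (Fin n) k)}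

/-- A polynomial is a finite sum of its homogeneous components, and the restriction keeps or kills
each of them as a whole. Hence the projection descends to `A`. -/
lemma weightRestrict_mem (hI : ∀ g ∈ I, ∀ γ, weightedHomogeneousComponent w γ g ∈ I) (D : Set Γ)
    {g : MvPolynomial (Fin n) k} (hg : g ∈ I) : weightRestrict k w D g ∈ I := by
  classical
  obtain ⟨t, ht⟩ := Set.Finite.exists_finset_coe (weightedHomogeneousComponent_finsupp (w := w) g)
  rw [← sum_weightedHomogeneousComponent w g, finsum_eq_sum_of_support_subset _ ht.ge, map_sum]
  refine sum_mem fun γ _ => ?_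
  have hh := weightedHomogeneousComponent_isWeightedHomogeneous (w := w) γ g
  by_cases h : γ ∈ D
  · rw [weightRestrict_eq_self]
    · exact hI g hg γ
    · intro α hα
      rw [hh (mem_support_iff.1 hα)]
      exact h
  · rw [weightRestrict_eq_zero]
    · exact zero_mem _
    · intro α hα
      rw [hh (mem_support_iff.1 hα)]
      exact h

/-- A grading of `S` for which the ideal is homogeneous. -/
def IsHomogeneousFor (f : Fin s → MvPolynomial (Fin n) k) (w : Fin n → Γ) : Prop :=
  ∀ g ∈ Ideal.span (Set.range f), ∀ γ : Γ,
    weightedHomogeneousComponent w γ g ∈ Ideal.span (Set.range f)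

variable (hw : IsHomogeneousFor f w)

/-- The projection of `A` onto the part with weights in `D`. -/
noncomputable def weightProj (D : Set Γ) : QuotAlg f →+ QuotAlg f :=
  AddMonoidHom.liftOfSurjective (Ideal.Quotient.mk (Ideal.span (Set.range f))).toAddMonoidHom
    Ideal.Quotient.mk_surjective
    ⟨(Ideal.Quotient.mk _).toAddMonoidHom.comp (weightRestrict k w D).toAddMonoidHom, by
      intro g hg
      have hg' : g ∈ Ideal.span (Set.range f) := Ideal.Quotient.eq_zero_iff_mem.1 hg
      exact Ideal.Quotient.eq_zero_iff_mem.2 (weightRestrict_mem hw D hg')⟩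

lemma weightProj_mk (D : Set Γ) (g : MvPolynomial (Fin n) k) :
    weightProj hw D (Ideal.Quotient.mk _ g) = Ideal.Quotient.mk _ (weightRestrict k w D g) :=
  AddMonoidHom.liftOfRightInverse_comp_apply _ _ _ _ g

lemma weightProj_mem (D : Set Γ) (a : QuotAlg f) : weightProj hw D a ∈ weightPart f w D := by
  obtain ⟨g, rfl⟩ := Ideal.Quotient.mk_surjective a
  rw [weightProj_mk]
  exact mk_mem_weightPart (weight_mem_support_weightRestrict D g)

lemma weightProj_eq_self {D : Set Γ} {a : QuotAlg f} (ha : a ∈ weightPart f w D) :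
    weightProj hw D a = a := by
  obtain ⟨g, hg, rfl⟩ := mem_weightPart_iff.1 ha
  rw [weightProj_mk, weightRestrict_eq_self hg]

lemma weightProj_eq_zero {D D' : Set Γ} (hD : Disjoint D D') {a : QuotAlg f}
    (ha : a ∈ weightPart f w D') : weightProj hw D a = 0 := by
  obtain ⟨g, hg, rfl⟩ := mem_weightPart_iff.1 ha
  rw [weightProj_mk, weightRestrict_eq_zero, map_zero]
  intro α hα h
  exact Set.disjoint_left.1 hD h (hg α hα)

variable {B C : Type*} {deg : B → Γ} {degC : C → Γ}

variable (deg) in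
/-- The projection of a graded free module onto its part of degree `γ`. -/
noncomputable def homProj (γ : Γ) : (B →₀ QuotAlg f) →+ (B →₀ QuotAlg f) :=
  Finsupp.liftAddHom fun b => (Finsupp.singleAddHom b).comp (weightProj hw {δ | δ + deg b = γ})

lemma homProj_apply (γ : Γ) (z : B →₀ QuotAlg f) (b : B) :
    homProj hw deg γ z b = weightProj hw {δ | δ + deg b = γ} (z b) := by
  classical
  rw [homProj, Finsupp.liftAddHom_apply, Finsupp.sum, Finsupp.finsetSum_apply,
    Finset.sum_eq_single b]
  · simp
  · intro c _ hc
    simp [hc]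
  · intro hb
    simp [Finsupp.notMem_support_iff.1 hb]

lemma homProj_mem (γ : Γ) (z : B →₀ QuotAlg f) : homProj hw deg γ z ∈ homPart f w deg γ := by
  intro b
  rw [homProj_apply]
  exact weightProj_mem hw _ _

lemma homProj_eq_self {γ : Γ} {z : B →₀ QuotAlg f} (hz : z ∈ homPart f w deg γ) :
    homProj hw deg γ z = z := by
  ext b
  rw [homProj_apply, weightProj_eq_self hw (hz b)]

lemma homProj_eq_zero {γ ρ : Γ} (h : ρ ≠ γ) {z : B →₀ QuotAlg f} (hz : z ∈ homPart f w deg ρ) :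
    homProj hw deg γ z = 0 := by
  ext b
  rw [homProj_apply, weightProj_eq_zero hw _ (hz b), Finsupp.zero_apply]
  rw [Set.disjoint_left]
  intro δ h1 h2
  rw [Set.mem_ofPred_eq] at h1 h2
  exact h (h2.symm.trans h1)

lemma homProj_mem_supported {γ : Γ} {t : Set B} {z : B →₀ QuotAlg f}
    (hz : z ∈ Finsupp.supported (QuotAlg f) (QuotAlg f) t) :
    homProj hw deg γ z ∈ Finsupp.supported (QuotAlg f) (QuotAlg f) t := by
  rw [Finsupp.mem_supported'] at hz ⊢
  intro b hb
  rw [homProj_apply, hz b hb, map_zero]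

/-- To prove a property closed under sums for all elements of a graded free module, it is enough
to consider multiples of basis elements by monomials. -/
lemma monomial_induction {P : (B →₀ QuotAlg f) → Prop} (h0 : P 0)
    (hadd : ∀ y z, P y → P z → P (y + z))
    (hs : ∀ b α c, P (Finsupp.single b (Ideal.Quotient.mk _ (monomial α c)))) (z : B →₀ QuotAlg f) :
    P z := by
  induction z using Finsupp.induction_linear with
  | zero => exact h0
  | add y z hy hz => exact hadd y z hy hz
  | single b r =>
    obtain ⟨g, rfl⟩ := Ideal.Quotient.mk_surjective r
    induction g using MvPolynomial.induction_on' with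
    | add p q hp hq =>
      rw [map_add, Finsupp.single_add]
      exact hadd _ _ hp hq
    | monomial α c => exact hs b α c

lemma single_monomial_mem_homPart (b : B) (α : Fin n →₀ ℕ) (c : k) :
    (Finsupp.single b (Ideal.Quotient.mk _ (monomial α c)) : B →₀ QuotAlg f) ∈
      homPart f w deg (Finsupp.weight w α + deg b) :=
  single_mem_homPart (mk_monomial_mem_weightPart (by exact rfl) c)

/-- Monomial multiples of basis elements are homogeneous, and a graded map preserves their degree;
on such an element each projection is the identity or zero, and these elements span. -/
lemma map_homProj {φ : (B →₀ QuotAlg f) →ₗ[QuotAlg f] (C →₀ QuotAlg f)}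
    (hφ : ∀ b, φ (Finsupp.single b 1) ∈ homPart f w degC (deg b)) (γ : Γ) (z : B →₀ QuotAlg f) :
    φ (homProj hw deg γ z) = homProj hw degC γ (φ z) := by
  refine monomial_induction (P := fun z => φ (homProj hw deg γ z) = homProj hw degC γ (φ z))
    (by simp) (fun y z hy hz => by simp only [map_add, hy, hz]) (fun b α c => ?_) z
  have h := single_monomial_mem_homPart (f := f) (w := w) (deg := deg) b α c
  by_cases hγ : Finsupp.weight w α + deg b = γ
  · rw [hγ] at h
    rw [homProj_eq_self hw h, homProj_eq_self hw (map_mem_homPart hφ h)]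
  · rw [homProj_eq_zero hw hγ h, homProj_eq_zero hw hγ (map_mem_homPart hφ h), map_zero]

/-- The augmentation only sees the part of degree `0`. -/
lemma aug_homProj {ε : (B →₀ QuotAlg f) →ₗ[QuotAlg f] ResField f}
    (hε : ∀ b, deg b ≠ 0 → ε (Finsupp.single b 1) = 0) (z : B →₀ QuotAlg f) :
    ε (homProj hw deg 0 z) = ε z := by
  refine monomial_induction (P := fun z => ε (homProj hw deg 0 z) = ε z)
    (by simp) (fun y z hy hz => by simp only [map_add, hy, hz]) (fun b α c => ?_) z
  have h := single_monomial_mem_homPart (f := f) (w := w) (deg := deg) b α c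
  by_cases hγ : Finsupp.weight w α + deg b = 0
  · rw [hγ] at h
    rw [homProj_eq_self hw h]
  · rw [homProj_eq_zero hw hγ h, map_zero, single_eq_smul, map_smul]
    -- If `b` has degree zero, the total degree is nonzero only because `α ≠ 0`, and then the
    -- monomial acts as zero on the residue field.
    by_cases hb : deg b = 0
    · have hα : α ≠ 0 := by
        rintro rfl
        simp [hb] at hγ
      symm
      obtain ⟨r, hr⟩ := Ideal.Quotient.mk_surjective (ε (Finsupp.single b 1))
      rw [← hr]
      change Ideal.Quotient.mk (augIdeal f) (_ * r) = 0
      rw [Ideal.Quotient.eq_zero_iff_mem]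
      refine Ideal.mul_mem_right _ _ (mk_mem_augIdeal ?_)
      classical
      rw [constantCoeff_monomial, if_neg hα]
    · rw [hε b hb, smul_zero]

end Projection

/-! ### The grading of the complex -/

section GradedComplex

variable {Γ : Type*} [AddCommMonoid Γ] {w : Fin n → Γ}

/-- The elements of a reduced Gröbner basis of a homogeneous ideal are homogeneous. -/
lemma IsReducedGroebnerBasis.weight_eq {m : MonomialOrder (Fin n)}
    (hf : IsReducedGroebnerBasis m f) (hw : IsHomogeneousFor f w) (j : Fin s)
    {α : Fin n →₀ ℕ} (hα : α ∈ (f j).support) :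
    Finsupp.weight w α = Finsupp.weight w (m.degree (f j)) := by
  classical
  by_contra hne
  -- A component of a weight other than that of the leading monomial would lie in the ideal, and its
  -- leading monomial, a term of `f j`, would be divisible by some leading monomial. Reducedness
  -- leaves only that of `f j` itself, so the two monomials coincide, although their weights differ.
  set g := weightedHomogeneousComponent w (Finsupp.weight w α) (f j) with hg
  have hgI : g ∈ Ideal.span (Set.range f) := hw _ (Ideal.subset_span ⟨j, rfl⟩) _
  have hg0 : g ≠ 0 := by
    intro h
    have h1 := congrArg (coeff α) h
    rw [hg, coeff_weightedHomogeneousComponent, if_pos rfl, coeff_zero] at h1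
    exact mem_support_iff.1 hα h1
  have hdeg := m.degree_mem_support hg0
  have hdeg' := mem_support_iff.1 hdeg
  rw [hg, coeff_weightedHomogeneousComponent] at hdeg'
  split_ifs at hdeg' with hwt
  · have h1 : monomial (m.degree g) (1 : k) ∈ initialIdeal m (Ideal.span (Set.range f)) :=
      Ideal.subset_span ⟨g, hgI, hg0, rfl⟩
    rw [hf.groebner, mem_span_range_monomial_iff] at h1
    obtain ⟨l, hl⟩ := h1 (m.degree g) (by simp [mem_support_iff])
    have hsupp : m.degree g ∈ (f j).support := mem_support_iff.2 hdeg'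
    have hlj : l = j := by
      by_contra hlj
      exact hf.reduced j l (Ne.symm hlj) _ hsupp hl
    subst hlj
    have h2 : m.degree g = m.degree (f l) :=
      m.toSyn.injective (le_antisymm (m.le_degree hsupp) (m.toSyn_monotone hl))
    rw [h2] at hwt
    exact hne hwt.symm
  · exact hdeg' rfl

lemma weight_sub_single_add {α : Fin n →₀ ℕ} {p : Fin n}
    (h : α.support.max = (p : WithBot (Fin n))) :
    Finsupp.weight w (α - Finsupp.single p 1) + w p = Finsupp.weight w α := by
  conv_rhs => rw [← sub_single_add_single h]
  rw [map_add, Finsupp.weight_single, one_smul]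

lemma sgn_smul_mem {B : Type*} {deg : B → Γ} {γ : Γ} (I J : Finset (Fin n))
    {z : B →₀ QuotAlg f} (hz : z ∈ homPart f w deg γ) :
    sgn (QuotAlg f) I J • z ∈ homPart f w deg γ := by
  rw [sgn]
  rcases neg_one_pow_eq_or (QuotAlg f) ((I ×ˢ J).filter fun q => q.1 < q.2).card with h | h
  · simpa [h] using hz
  · simpa [h] using hz

/-- Each `f j` is homogeneous of the weight of its leading monomial, so `T_p(f_j) e_p` has exactly
the degree lost in lowering `t_j`. -/
lemma isGradedBy_diff {m : MonomialOrder (Fin n)} (hf : IsReducedGroebnerBasis m f)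
    (hw : IsHomogeneousFor f w) :
    IsGradedBy f w (intDeg w fun j => Finsupp.weight w (m.degree (f j))) (diff f) (aug f) where
  d_homogeneous := by
    intro b
    set deg : Symb n s → Γ := intDeg w fun j => Finsupp.weight w (m.degree (f j)) with hdeg
    suffices h : diff f (Finsupp.single b 1) ∈ homPart f w deg (deg b) from h
    rw [diff_eq]
    simp only [genDiff, LinearMap.add_apply, LinearMap.sum_apply, LinearMap.smul_apply,
      Module.End.mul_apply]
    refine add_mem (sum_mem fun i _ => ?_) (sum_mem fun j _ => sum_mem fun p _ => ?_)
    · rw [contr_single]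
      split_ifs with h
      · rw [single_eq_smul, smul_comm, Finsupp.smul_single, smul_eq_mul, mul_one]
        refine sgn_smul_mem _ _ (single_mem_homPart
          (mk_monomial_mem_weightPart (D := {δ | δ + _ = _}) ?_ 1))
        rw [Finsupp.weight_single, one_smul, Set.mem_ofPred_eq, hdeg]
        simp only [intDeg]
        rw [← add_assoc, Finset.add_sum_erase _ _ h]
      · rw [smul_zero]; exact zero_mem _
    · rw [lower_single]
      split_ifs with hj
      · rw [extMul_single]
        by_cases hp : p ∈ b.1
        · rw [if_neg (by simpa using hp), smul_zero]; exact zero_mem _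
        · rw [if_pos (by simpa using hp), single_eq_smul, smul_comm, Finsupp.smul_single, smul_eq_mul, mul_one]
          refine sgn_smul_mem _ _ (single_mem_homPart ?_)
          rw [lastVarPart, map_sum]
          refine sum_mem fun α hα => mk_monomial_mem_weightPart ?_ _
          rw [Finset.mem_filter] at hα
          rw [Set.mem_ofPred_eq, hdeg]
          simp only [intDeg]
          rw [Finset.sum_insert hp, ← add_assoc, ← add_assoc, weight_sub_single_add hα.2,
            hf.weight_eq hw j hα.1, add_comm (Finsupp.weight w _), add_assoc]
          congr 1
          rw [← Finset.add_sum_erase _ _ (Finset.mem_univ j),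
            ← Finset.add_sum_erase _ (fun i => b.2 i • _) (Finset.mem_univ j), ← add_assoc]
          congr 1
          · rw [← succ_nsmul']
            congr 1
            simp; omega
          · refine Finset.sum_congr rfl fun i hi => ?_
            simp [Finset.ne_of_mem_erase hi]
      · rw [map_zero, smul_zero]; exact zero_mem _
  aug_homogeneous := by
    intro b hb
    rw [aug_single, if_neg]
    rintro rfl
    simp [intDeg] at hb

end GradedComplex

end BachComm

namespace BachComm

/-! ### Recursive construction of linear maps and contractions -/

section Recursion

variable {A : Type*} [CommRing A]

/-- Construction of a linear map by recursion on the degree of basis elements. -/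
lemma exists_linearMap_of_rec {E M N : Type*} [AddCommGroup M] [Module A M] [AddCommGroup N]
    [Module A N] (b : Module.Basis E A M) (h : E → ℕ) (Q : E → (M →ₗ[A] N) → N → Prop)
    (hlocal : ∀ e φ ψ y, (∀ e', h e' < h e → φ (b e') = ψ (b e')) → Q e φ y → Q e ψ y)
    (hex : ∀ e φ, (∀ e', h e' < h e → Q e' φ (φ (b e'))) → ∃ y, Q e φ y) :
    ∃ φ : M →ₗ[A] N, ∀ e, Q e φ (φ (b e)) := by
  classical
  -- `Φ i` is correct on basis elements of degree less than `i`, and later steps do not change it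
  -- there. The default value zero is never used where a solution exists.
  let step : ℕ → (M →ₗ[A] N) → (M →ₗ[A] N) := fun i φ => b.constr A fun e =>
    if h e = i then (if hy : ∃ y, Q e φ y then hy.choose else 0) else φ (b e)
  let Φ : ℕ → (M →ₗ[A] N) := fun i => Nat.rec 0 (fun i φ => step i φ) i
  have hΦ : ∀ i e, Φ (i + 1) (b e) =
      if h e = i then (if hy : ∃ y, Q e (Φ i) y then hy.choose else 0) else Φ i (b e) :=
    fun i e => b.constr_basis A _ e
  have hst : ∀ e j, Φ (h e + 1 + j) (b e) = Φ (h e + 1) (b e) := by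
    intro e j
    induction j with
    | zero => rfl
    | succ j ih =>
      rw [← add_assoc, hΦ, if_neg (by omega), ih]
  have hP : ∀ i e, h e < i → Q e (Φ i) (Φ i (b e)) := by
    intro i
    induction i with
    | zero => intro e he; omega
    | succ i ih =>
      intro e he
      have hagree : ∀ e', h e' < h e → Φ i (b e') = Φ (i + 1) (b e') := fun e' he' => by
        rw [hΦ, if_neg (by omega)]
      refine hlocal e (Φ i) _ _ hagree ?_
      rw [hΦ]
      split_ifs with h1 h2
      · exact h2.choose_spec
      · exact absurd (hex e (Φ i) fun e' he' => ih e' (by omega)) h2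
      · exact ih e (by omega)
  refine ⟨b.constr A fun e => Φ (h e + 1) (b e), fun e => ?_⟩
  rw [b.constr_basis]
  refine hlocal e _ _ _ (fun e' he' => ?_) (hP (h e + 1) e (by omega))
  obtain ⟨j, hj⟩ := Nat.exists_eq_add_of_le (show h e' + 1 ≤ h e + 1 by omega)
  exact ((congrArg (fun t => Φ t (b e')) hj).trans (hst e' j)).trans 
    (b.constr_basis A (fun e => Φ (h e + 1) (b e)) e').symm

/-- A bounded below exact complex of free modules is contractible. -/
lemma exists_contraction {E M : Type*} [AddCommGroup M] [Module A M] (b : Module.Basis E A M)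
    (h : E → ℕ) (P : ℕ → Submodule A M) (hb : ∀ e, b e ∈ P (h e))
    (hspan : ∀ i, P i ≤ Submodule.span A (b '' {e | h e = i})) (D : M →ₗ[A] M)
    (hD : ∀ i, ∀ z ∈ P (i + 1), D z ∈ P i) (hD0 : ∀ z ∈ P 0, D z = 0)
    (hDD : ∀ z, D (D z) = 0) (hex : ∀ i, ∀ z ∈ P i, D z = 0 → ∃ y ∈ P (i + 1), D y = z) :
    ∃ H : M →ₗ[A] M, ∀ z, D (H z) + H (D z) = z := by
  have hagree : ∀ i (φ ψ : M →ₗ[A] M), (∀ e, h e = i → φ (b e) = ψ (b e)) →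
      ∀ z ∈ P i, φ z = ψ z := by
    intro i φ ψ hφ z hz
    refine LinearMap.eqOn_span (s := b '' {e | h e = i}) ?_ (hspan i hz)
    rintro _ ⟨e, he, rfl⟩
    exact hφ e he
  -- `H e` is a preimage under `D` of `e - H (D e)`, which is a cycle by the homotopy identity in
  -- lower degrees.
  obtain ⟨H, hH⟩ := exists_linearMap_of_rec b h
    (fun e H y => y ∈ P (h e + 1) ∧ D y = b e - H (D (b e))) (by
      rintro e φ ψ y hφψ ⟨hy, hDy⟩
      refine ⟨hy, ?_⟩
      rw [hDy]
      rcases he : h e with _ | i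
      · rw [hD0 _ (he ▸ hb e), map_zero, map_zero]
      · rw [hagree i φ ψ (fun e' he' => hφψ e' (by omega)) _ (hD i _ (he ▸ hb e))]) (by
      intro e H ih
      refine hex (h e) _ ?_ ?_
      · have hbe := hb e
        rcases he : h e with _ | i <;> rw [he] at hbe
        · rw [hD0 _ hbe, map_zero, sub_zero]
          exact hbe
        · refine sub_mem hbe ?_
          have h1 : P i ≤ (P (i + 1)).comap H := by
            refine (hspan i).trans (Submodule.span_le.2 ?_)
            rintro _ ⟨e', he', rfl⟩
            have he' : h e' = i := he'
            have := (ih e' (by omega)).1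
            rw [he'] at this
            exact this
          exact h1 (hD i _ hbe)
      · have hbe := hb e
        rcases he : h e with _ | i <;> rw [he] at hbe
        · rw [hD0 _ hbe, map_zero, sub_zero, hD0 _ hbe]
        · have := hagree i (D ∘ₗ H + H ∘ₗ D) LinearMap.id (fun e' he' => by
            simp [(ih e' (by omega)).2]) _ (hD i _ hbe)
          simp only [LinearMap.add_apply, LinearMap.comp_apply, hDD, map_zero, add_zero,
            LinearMap.id_apply] at this
          rw [map_sub, this, sub_self])
  refine ⟨H, fun z => ?_⟩
  suffices h : D ∘ₗ H + H ∘ₗ D = LinearMap.id from LinearMap.congr_fun h z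
  refine b.ext fun e => ?_
  simp [(hH e).2]

end Recursion

/-! ### Homotopy inverses from the mapping cone -/

section Cone

variable {A : Type*} [CommRing A] {B C N : Type*} [AddCommGroup N] [Module A N]
  {hB : B → ℕ} {dB : (B →₀ A) →ₗ[A] (B →₀ A)} {εB : (B →₀ A) →ₗ[A] N}
  {hC : C → ℕ} {dC : (C →₀ A) →ₗ[A] (C →₀ A)} {εC : (C →₀ A) →ₗ[A] N}

lemma IsFreeResolution.d_d (F : IsFreeResolution hB dB εB) (z : B →₀ A) : dB (dB z) = 0 := by
  suffices h : dB ∘ₗ dB = 0 from LinearMap.congr_fun h z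
  refine finsupp_hom_ext fun b => ?_
  have hb : Finsupp.single b (1 : A) ∈ piece A hB (hB b) := single_mem_piece rfl _
  rw [LinearMap.comp_apply, LinearMap.zero_apply]
  rcases he : hB b with _ | _ | i <;> rw [he] at hb
  · rw [F.d_zero _ hb, map_zero]
  · exact F.d_zero _ (F.d_mem 0 _ hb)
  · exact (F.exact_succ i _ (F.d_mem (i + 1) _ hb)).2 ⟨_, hb, rfl⟩

/-- The pieces of a complex, shifted by one. -/
noncomputable def shiftPiece (A : Type*) [CommRing A] {B : Type*} (hB : B → ℕ) : ℕ → Submodule A (B →₀ A)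
  | 0 => ⊥
  | i + 1 => piece A hB i

lemma piece_le_span (i : ℕ) : piece A hB i ≤
    Submodule.span A ((fun b => Finsupp.single b (1 : A)) '' {b | hB b = i}) := by
  rw [piece, Finsupp.supported_eq_span_single]

/-- A chain map between free resolutions lifting the identity is a homotopy equivalence. -/
lemma exists_homotopy_inverse (F : IsFreeResolution hB dB εB) (G : IsFreeResolution hC dC εC)
    (α : (B →₀ A) →ₗ[A] (C →₀ A)) (hα : ∀ i, ∀ z ∈ piece A hB i, α z ∈ piece A hC i)
    (hαd : ∀ z, dC (α z) = α (dB z)) (hαε : ∀ z, εC (α z) = εB z) :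
    ∃ (β : (C →₀ A) →ₗ[A] (B →₀ A)) (h₁ : (B →₀ A) →ₗ[A] (B →₀ A))
      (h₂ : (C →₀ A) →ₗ[A] (C →₀ A)), dB ∘ₗ β = β ∘ₗ dC ∧
        β ∘ₗ α = LinearMap.id + dB ∘ₗ h₁ + h₁ ∘ₗ dB ∧
        α ∘ₗ β + dC ∘ₗ h₂ + h₂ ∘ₗ dC = LinearMap.id := by
  -- `D` is the differential of the mapping cone of `α`. The cone is exact because both complexes
  -- resolve the same module and `α` lifts the identity.
  let D : ((B →₀ A) × (C →₀ A)) →ₗ[A] ((B →₀ A) × (C →₀ A)) :=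
    LinearMap.prod (-(dB ∘ₗ LinearMap.fst A _ _))
      (α ∘ₗ LinearMap.fst A _ _ + dC ∘ₗ LinearMap.snd A _ _)
  have hDa : ∀ z y, D (z, y) = (-dB z, α z + dC y) := fun z y => rfl
  let bas : Module.Basis (B ⊕ C) A ((B →₀ A) × (C →₀ A)) :=
    (Finsupp.basisSingleOne (R := A) (ι := B)).prod (Finsupp.basisSingleOne (R := A) (ι := C))
  have hinl : ∀ b, bas (Sum.inl b) = (Finsupp.single b 1, 0) := fun b => by
    simp [bas]
  have hinr : ∀ c, bas (Sum.inr c) = (0, Finsupp.single c 1) := fun c => by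
    simp [bas]
  have hdε : ∀ y ∈ piece A hC 1, εC (dC y) = 0 := fun y hy =>
    (G.exact_zero _ (G.d_mem 0 _ hy)).2 ⟨y, hy, rfl⟩
  obtain ⟨H, hH⟩ := exists_contraction bas (Sum.elim (fun b => hB b + 1) hC)
    (fun i => (shiftPiece A hB i).prod (piece A hC i)) (by
      rintro (b | c)
      · rw [hinl]
        exact ⟨single_mem_piece rfl _, zero_mem _⟩
      · rw [hinr]
        exact ⟨zero_mem _, single_mem_piece rfl _⟩) (by
      rintro i ⟨z, y⟩ ⟨hz, hy⟩
      have e : (z, y) = LinearMap.inl A (B →₀ A) (C →₀ A) z +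
        LinearMap.inr A (B →₀ A) (C →₀ A) y := by simp
      rw [e]
      refine add_mem ?_ ?_
      · rcases i with _ | i
        · have hz : z = 0 := hz
          rw [hz, map_zero]
          exact zero_mem _
        · have h1 := Submodule.mem_map_of_mem (f := LinearMap.inl A (B →₀ A) (C →₀ A))
            (piece_le_span i hz)
          rw [Submodule.map_span] at h1
          refine Submodule.span_mono ?_ h1
          rintro _ ⟨_, ⟨b, hb, rfl⟩, rfl⟩
          have hb : hB b = i := hb
          exact ⟨Sum.inl b, by simp [hb], by simp [hinl]⟩
      · have h1 := Submodule.mem_map_of_mem (f := LinearMap.inr A (B →₀ A) (C →₀ A))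
          (piece_le_span i hy)
        rw [Submodule.map_span] at h1
        refine Submodule.span_mono ?_ h1
        rintro _ ⟨_, ⟨c, hc, rfl⟩, rfl⟩
        have hc : hC c = i := hc
        exact ⟨Sum.inr c, by simp [hc], by simp [hinr]⟩) D (by
      rintro i ⟨z, y⟩ ⟨hz, hy⟩
      rw [hDa]
      refine ⟨?_, add_mem (hα i _ hz) (G.d_mem i _ hy)⟩
      rcases i with _ | i
      · change -dB z = 0
        rw [F.d_zero _ hz, neg_zero]
      · exact neg_mem (F.d_mem i _ hz)) (by
      rintro ⟨z, y⟩ ⟨hz, hy⟩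
      have hz : z = 0 := hz
      rw [hDa, hz, map_zero, map_zero, zero_add, neg_zero, G.d_zero _ hy]
      rfl) (by
      rintro ⟨z, y⟩
      rw [hDa, hDa, map_neg, map_neg, map_add, F.d_d, G.d_d, hαd, add_zero, neg_add_cancel,
        neg_zero, neg_zero]
      rfl) (by
      rintro i ⟨z, y⟩ ⟨hz, hy⟩ h0
      rcases i with _ | i
      · have hz : z = 0 := hz
        subst hz
        obtain ⟨z', hz', hz'ε⟩ := F.aug_surjective (εC y)
        obtain ⟨y', hy', hy'd⟩ := (G.exact_zero (y - α z') (sub_mem hy (hα 0 _ hz'))).1 (by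
          rw [map_sub, hαε, hz'ε, sub_self])
        refine ⟨(z', y'), ⟨hz', hy'⟩, ?_⟩
        rw [hDa, F.d_zero _ hz', hy'd, neg_zero, add_sub_cancel]
      · rw [hDa, Prod.mk_eq_zero, neg_eq_zero] at h0
        obtain ⟨h1, h2⟩ := h0
        have hz : z ∈ piece A hB i := hz
        obtain ⟨z₁, hz₁, rfl⟩ : ∃ z₁ ∈ piece A hB (i + 1), dB z₁ = z := by
          rcases i with _ | i
          · refine (F.exact_zero z hz).1 ?_
            rw [← hαε, eq_neg_of_add_eq_zero_left h2, map_neg, hdε y hy, neg_zero]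
          · exact (F.exact_succ i z hz).1 h1
        obtain ⟨y₁, hy₁, hy₁d⟩ := (G.exact_succ i (y + α z₁)
          (add_mem hy (hα _ _ hz₁))).1 (by rw [map_add, hαd, add_comm, h2])
        refine ⟨(-z₁, y₁), ⟨neg_mem hz₁, hy₁⟩, ?_⟩
        rw [hDa, map_neg, map_neg, neg_neg, hy₁d, neg_add_cancel_comm_assoc])
  -- The entries of the contraction matrix are the inverse and the two homotopies; the three
  -- identities are entries of `D H + H D = 1`.
  refine ⟨LinearMap.fst A _ _ ∘ₗ H ∘ₗ LinearMap.inr A _ _,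
    LinearMap.fst A _ _ ∘ₗ H ∘ₗ LinearMap.inl A _ _,
    LinearMap.snd A _ _ ∘ₗ H ∘ₗ LinearMap.inr A _ _, ?_, ?_, ?_⟩
  · ext1 c
    refine LinearMap.ext fun r => ?_
    have h1 := congrArg Prod.fst (hH (0, Finsupp.single c r))
    rw [hDa 0, show H (0, Finsupp.single c r) = ((H (0, Finsupp.single c r)).1,
      (H (0, Finsupp.single c r)).2) from rfl, hDa] at h1
    simp only [map_zero, neg_zero, zero_add, Prod.fst_add] at h1
    simpa [neg_add_eq_zero] using h1
  · refine LinearMap.ext fun z => ?_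
    have h1 := congrArg Prod.fst (hH (z, 0))
    rw [hDa z, show H (z, 0) = ((H (z, 0)).1, (H (z, 0)).2) from rfl, hDa] at h1
    have h2 : H (-dB z, α z) = -H (dB z, 0) + H (0, α z) := by
      have h3 : (-dB z, α z) = -(dB z, (0 : C →₀ A)) + (0, α z) := by simp
      rw [h3, map_add, map_neg]
    simp only [map_zero, add_zero, h2, Prod.fst_add, Prod.fst_neg] at h1
    simp only [LinearMap.comp_apply, LinearMap.add_apply, LinearMap.id_apply, LinearMap.inl_apply,
      LinearMap.inr_apply, LinearMap.fst_apply]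
    nth_rw 2 [← h1]
    abel
  · refine LinearMap.ext fun y => ?_
    have h1 := congrArg Prod.snd (hH (0, y))
    rw [hDa 0, show H (0, y) = ((H (0, y)).1, (H (0, y)).2) from rfl, hDa] at h1
    simp only [map_zero, zero_add, neg_zero, Prod.snd_add] at h1
    simpa using h1

end Cone

end BachComm

namespace BachComm

open MvPolynomial

/-! ### Graded comparison of resolutions -/

section Comparison

variable {k : Type*} [Field k] {n s : ℕ} {f : Fin s → MvPolynomial (Fin n) k}
  {Γ : Type*} [AddCommMonoid Γ] {w : Fin n → Γ} {B C : Type*} {degB : B → Γ} {degC : C → Γ}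

lemma map_mem_homPart_of_supported {φ : (B →₀ QuotAlg f) →ₗ[QuotAlg f] (C →₀ QuotAlg f)}
    {t : Set B} (hφ : ∀ b ∈ t, φ (Finsupp.single b 1) ∈ homPart f w degC (degB b)) {γ : Γ}
    {z : B →₀ QuotAlg f} (hz : z ∈ homPart f w degB γ)
    (ht : z ∈ Finsupp.supported (QuotAlg f) (QuotAlg f) t) : φ z ∈ homPart f w degC γ := by
  rw [← Finsupp.sum_single z, Finsupp.sum, map_sum]
  refine sum_mem fun b hb => ?_
  rw [single_eq_smul, map_smul]
  exact smul_mem_homPart (fun δ hδ => hδ) (hz b) (hφ b (ht hb))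

variable {hB : B → ℕ} {dB : (B →₀ QuotAlg f) →ₗ[QuotAlg f] (B →₀ QuotAlg f)}
  {εB : (B →₀ QuotAlg f) →ₗ[QuotAlg f] ResField f}
  {hC : C → ℕ} {dC : (C →₀ QuotAlg f) →ₗ[QuotAlg f] (C →₀ QuotAlg f)}
  {εC : (C →₀ QuotAlg f) →ₗ[QuotAlg f] ResField f}

variable (hB degB dB εB hC degC dC εC) in
/-- The conditions on the value `y` of a comparison map `φ` at the basis element `b`. -/
def IsComparisonValue (w : Fin n → Γ) (b : B) (φ : (B →₀ QuotAlg f) →ₗ[QuotAlg f] (C →₀ QuotAlg f))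
    (y : C →₀ QuotAlg f) : Prop :=
  y ∈ piece _ hC (hB b) ∧ y ∈ homPart f w degC (degB b) ∧
    dC y = φ (dB (Finsupp.single b 1)) ∧ εC y = εB (Finsupp.single b 1)

lemma IsComparisonValue.congr (F : IsFreeResolution hB dB εB) {b : B}
    {φ ψ : (B →₀ QuotAlg f) →ₗ[QuotAlg f] (C →₀ QuotAlg f)} {y : C →₀ QuotAlg f}
    (h : ∀ c, hB c < hB b → φ (Finsupp.single c 1) = ψ (Finsupp.single c 1))
    (hφ : IsComparisonValue degB degC hB dB εB hC dC εC w b φ y) :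
    IsComparisonValue degB degC hB dB εB hC dC εC w b ψ y := by
  obtain ⟨h1, h2, h3, h4⟩ := hφ
  refine ⟨h1, h2, h3.trans ?_, h4⟩
  have hb : Finsupp.single b (1 : QuotAlg f) ∈ piece _ hB (hB b) := single_mem_piece rfl _
  rcases he : hB b with _ | i <;> rw [he] at hb
  · rw [F.d_zero _ hb, map_zero, map_zero]
  · exact hom_piece_eq (fun c hc => h c (by omega)) (F.d_mem _ _ hb)

lemma exists_isComparisonValue_zero (hw : IsHomogeneousFor f w) (F : IsFreeResolution hB dB εB)
    (G : IsFreeResolution hC dC εC) (gF : IsGradedBy f w degB dB εB)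
    (gG : IsGradedBy f w degC dC εC) {b : B} (he : hB b = 0)
    (φ : (B →₀ QuotAlg f) →ₗ[QuotAlg f] (C →₀ QuotAlg f)) :
    ∃ y, IsComparisonValue degB degC hB dB εB hC dC εC w b φ y := by
  have hb : Finsupp.single b (1 : QuotAlg f) ∈ piece _ hB 0 := single_mem_piece he _
  by_cases h0 : degB b = 0
  · obtain ⟨y, hy, hyε⟩ := G.aug_surjective (εB (Finsupp.single b 1))
    have hy' : homProj hw degC 0 y ∈ piece _ hC 0 := homProj_mem_supported hw hy
    have h1 : homProj hw degC 0 y ∈ homPart f w degC (degB b) := by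
      rw [h0]
      exact homProj_mem hw 0 y
    have h2 : εC (homProj hw degC 0 y) = εB (Finsupp.single b 1) := by
      rw [aug_homProj hw gG.aug_homogeneous, hyε]
    refine ⟨homProj hw degC 0 y, by rwa [he], h1, ?_, h2⟩
    rw [F.d_zero _ hb, map_zero]
    exact G.d_zero _ hy'
  · refine ⟨0, zero_mem _, zero_mem _, ?_, ?_⟩
    · rw [F.d_zero _ hb, map_zero, map_zero]
    · rw [gF.aug_homogeneous b h0, map_zero]

/-- Exactness of the target gives a lift, possibly inhomogeneous. Its projection to degree `degB b`
is still a lift, since the projection commutes with the differential and fixes the homogeneous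
element being lifted. -/
lemma exists_isComparisonValue_succ (hw : IsHomogeneousFor f w) (F : IsFreeResolution hB dB εB)
    (G : IsFreeResolution hC dC εC) (gF : IsGradedBy f w degB dB εB)
    (gG : IsGradedBy f w degC dC εC) {b : B} {i : ℕ} (he : hB b = i + 1)
    {φ : (B →₀ QuotAlg f) →ₗ[QuotAlg f] (C →₀ QuotAlg f)}
    (ih : ∀ c, hB c < hB b →
      IsComparisonValue degB degC hB dB εB hC dC εC w c φ (φ (Finsupp.single c 1))) :
    ∃ y, IsComparisonValue degB degC hB dB εB hC dC εC w b φ y := by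
  have hb : Finsupp.single b (1 : QuotAlg f) ∈ piece _ hB (i + 1) := single_mem_piece he _
  have hdb := F.d_mem _ _ hb
  have hz : φ (dB (Finsupp.single b 1)) ∈ piece _ hC i := by
    refine hom_piece (fun c hc => ?_) hdb
    have := (ih c (by omega)).1
    rwa [hc] at this
  have hzγ : φ (dB (Finsupp.single b 1)) ∈ homPart f w degC (degB b) := by
    refine map_mem_homPart_of_supported (degB := degB) (fun c hc => ?_) (gF.d_homogeneous b) hdb
    have hc : hB c = i := hc
    exact (ih c (by omega)).2.1
  obtain ⟨y, hy, hyd⟩ : ∃ y ∈ piece _ hC (i + 1), dC y = φ (dB (Finsupp.single b 1)) := by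
    rcases i with _ | i
    · refine (G.exact_zero _ hz).1 ?_
      have h1 : (εC ∘ₗ φ) (dB (Finsupp.single b 1)) = εB (dB (Finsupp.single b 1)) :=
        hom_piece_eq (fun c hc => (ih c (by omega)).2.2.2) hdb
      exact h1.trans ((F.exact_zero _ hdb).2 ⟨_, hb, rfl⟩)
    · refine (G.exact_succ _ _ hz).1 ?_
      have h1 : (dC ∘ₗ φ) (dB (Finsupp.single b 1)) = (φ ∘ₗ dB) (dB (Finsupp.single b 1)) :=
        hom_piece_eq (fun c hc => (ih c (by omega)).2.2.1) hdb
      refine h1.trans ?_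
      rw [LinearMap.comp_apply, F.d_d, map_zero]
  have hy' : homProj hw degC (degB b) y ∈ piece _ hC (i + 1) := homProj_mem_supported hw hy
  refine ⟨homProj hw degC (degB b) y, by rwa [he], homProj_mem hw _ y, ?_, ?_⟩
  · rw [map_homProj hw gG.d_homogeneous, hyd, homProj_eq_self hw hzγ]
  · rw [G.aug_pos _ _ hy', F.aug_pos _ _ hb]

/-- The comparison map between graded free resolutions. -/
lemma exists_graded_comparison (hw : IsHomogeneousFor f w) (F : IsFreeResolution hB dB εB)
    (G : IsFreeResolution hC dC εC) (gF : IsGradedBy f w degB dB εB)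
    (gG : IsGradedBy f w degC dC εC) :
    ∃ α : (B →₀ QuotAlg f) →ₗ[QuotAlg f] (C →₀ QuotAlg f),
      (∀ b, α (Finsupp.single b 1) ∈ piece _ hC (hB b)) ∧
      (∀ b, α (Finsupp.single b 1) ∈ homPart f w degC (degB b)) ∧
      (∀ z, dC (α z) = α (dB z)) ∧ ∀ z, εC (α z) = εB z := by
  obtain ⟨α, hα⟩ := exists_linearMap_of_rec (Finsupp.basisSingleOne (R := QuotAlg f) (ι := B)) hB
    (IsComparisonValue degB degC hB dB εB hC dC εC w)
    (fun b φ ψ y hφψ h => IsComparisonValue.congr F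
      (by simpa only [Finsupp.coe_basisSingleOne] using hφψ) h) (fun b φ ih => by
      rw [Finsupp.coe_basisSingleOne] at ih
      rcases he : hB b with _ | i
      · exact exists_isComparisonValue_zero hw F G gF gG he φ
      · exact exists_isComparisonValue_succ hw F G gF gG he ih)
  rw [Finsupp.coe_basisSingleOne] at hα
  refine ⟨α, fun b => (hα b).1, fun b => (hα b).2.1, fun z => ?_, fun z => ?_⟩
  · exact LinearMap.congr_fun (finsupp_hom_ext (φ := dC ∘ₗ α) (ψ := α ∘ₗ dB)
      fun b => (hα b).2.2.1) z
  · exact LinearMap.congr_fun (finsupp_hom_ext (φ := εC ∘ₗ α) (ψ := εB)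
      fun b => (hα b).2.2.2) z

/-- A constant term would have weight zero. Consequently the entries of a graded map between basis
elements of different degrees die in the residue field, even if some variables have weight zero. -/
lemma mem_augIdeal_of_mem_weightPart {D : Set Γ} (hD : (0 : Γ) ∉ D) {a : QuotAlg f}
    (ha : a ∈ weightPart f w D) : a ∈ augIdeal f := by
  obtain ⟨g, hg, rfl⟩ := mem_weightPart_iff.1 ha
  refine mk_mem_augIdeal ?_
  by_contra h
  refine hD ?_
  have := hg 0 (mem_support_iff.2 h)
  rwa [map_zero] at this

end Comparison

/-! ### Graded parts after tensoring with the residue field -/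

section TensorPart

variable {A : Type*} [CommRing A] {J : Ideal A} {B C : Type*}

/-- The projection of a free module onto the span of some of its basis elements. -/
noncomputable def partProj (A : Type*) [CommRing A] {B : Type*} (S : Set B) :
    (B →₀ A) →ₗ[A] (B →₀ A) := by
  classical
  exact (Finsupp.supported A A S).subtype ∘ₗ Finsupp.restrictDom A A S

open Classical in
lemma partProj_apply (S : Set B) (z : B →₀ A) (b : B) :
    partProj A S z b = if b ∈ S then z b else 0 := by
  simp [partProj, Finsupp.filter_apply]

lemma partProj_comp_subtype (S : Set B) :
    partProj A S ∘ₗ (Finsupp.supported A A S).subtype = (Finsupp.supported A A S).subtype := by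
  classical
  refine LinearMap.ext fun z => Finsupp.ext fun b => ?_
  rw [LinearMap.comp_apply, partProj_apply]
  split_ifs with h
  · rfl
  · exact ((Finsupp.mem_supported' A _).1 z.2 b h).symm

variable {M : Type*} [AddCommGroup M] [Module A M]

lemma partProj_mem_tensorPart (S : Set B) (x : M ⊗[A] (B →₀ A)) :
    (partProj A S).lTensor M x ∈ tensorPart M S := by
  classical
  rw [partProj, LinearMap.lTensor_comp]
  exact ⟨_, rfl⟩

lemma partProj_eq_self {S : Set B} {x : M ⊗[A] (B →₀ A)} (hx : x ∈ tensorPart M S) :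
    (partProj A S).lTensor M x = x := by
  obtain ⟨y, rfl⟩ := hx
  rw [← LinearMap.comp_apply, ← LinearMap.lTensor_comp, partProj_comp_subtype]

lemma lTensor_quotient_eq_zero {φ : (B →₀ A) →ₗ[A] (C →₀ A)}
    (h : ∀ b c, φ (Finsupp.single b 1) c ∈ J) : φ.lTensor (A ⧸ J) = 0 := by
  refine TensorProduct.ext' fun m z => ?_
  rw [LinearMap.lTensor_tmul, LinearMap.zero_apply]
  suffices hz : φ z ∈ coeffSub C J by
    rw [← Finsupp.sum_single (φ z), Finsupp.sum, TensorProduct.tmul_sum]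
    refine Finset.sum_eq_zero fun c _ => ?_
    obtain ⟨r, rfl⟩ := Ideal.Quotient.mk_surjective m
    rw [single_eq_smul, ← TensorProduct.smul_tmul]
    have : φ z c • (Ideal.Quotient.mk J r) = 0 :=
      Ideal.Quotient.eq_zero_iff_mem.2 (Ideal.mul_mem_right _ _ (hz c))
    rw [this, TensorProduct.zero_tmul]
  rw [← Finsupp.sum_single z, Finsupp.sum, map_sum]
  refine sum_mem fun b _ => ?_
  rw [single_eq_smul, map_smul]
  exact Submodule.smul_mem _ _ (h b)

lemma lTensor_partProj_comm {φ : (B →₀ A) →ₗ[A] (C →₀ A)} {S : Set B} {S' : Set C}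
    (h : ∀ b c, ¬ (b ∈ S ↔ c ∈ S') → φ (Finsupp.single b 1) c ∈ J) (x : (A ⧸ J) ⊗[A] (B →₀ A)) :
    (partProj A S').lTensor (A ⧸ J) (φ.lTensor (A ⧸ J) x) =
      φ.lTensor (A ⧸ J) ((partProj A S).lTensor (A ⧸ J) x) := by
  classical
  suffices hφ : (partProj A S' ∘ₗ φ - φ ∘ₗ partProj A S).lTensor (A ⧸ J) = 0 by
    have h1 : partProj A S' ∘ₗ φ = φ ∘ₗ partProj A S + (partProj A S' ∘ₗ φ - φ ∘ₗ partProj A S) := by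
      abel
    rw [← LinearMap.comp_apply, ← LinearMap.lTensor_comp, h1, LinearMap.lTensor_add, hφ, add_zero,
      LinearMap.lTensor_comp, LinearMap.comp_apply]
  refine lTensor_quotient_eq_zero fun b c => ?_
  have hb : partProj A S (Finsupp.single b 1) = if b ∈ S then Finsupp.single b 1 else 0 := by
    ext b'
    rw [partProj_apply]
    by_cases hbb : b = b'
    · subst hbb
      split_ifs <;> simp
    · split_ifs <;> simp [hbb]
  rw [LinearMap.sub_apply, LinearMap.comp_apply, LinearMap.comp_apply, Finsupp.sub_apply,
    partProj_apply, hb]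
  have := h b c
  by_cases h1 : b ∈ S <;> by_cases h2 : c ∈ S' <;> simp_all

lemma lTensor_supported_injective (M : Type*) [AddCommGroup M] [Module A M]
    (S : Set B) :
    Function.Injective ((Finsupp.supported A A S).subtype.lTensor M) := by
  classical
  have h : Finsupp.restrictDom A A S ∘ₗ (Finsupp.supported A A S).subtype = LinearMap.id :=
    Finsupp.restrictDom_comp_subtype S
  refine Function.LeftInverse.injective (g := (Finsupp.restrictDom A A S).lTensor M) fun x => ?_
  rw [← LinearMap.comp_apply, ← LinearMap.lTensor_comp, h, LinearMap.lTensor_id,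
    LinearMap.id_apply]

/-- The part of `M ⊗ F` spanned by some basis elements is a direct sum of copies of `M`. -/
noncomputable def tensorPartEquiv (M : Type*) [AddCommGroup M] [Module A M] (S : Set B) :
    tensorPart (A := A) M S ≃ₗ[A] (S →₀ M) := by
  classical
  exact (LinearEquiv.ofInjective _ (lTensor_supported_injective M S)).symm ≪≫ₗ
    (Finsupp.supportedEquivFinsupp S).lTensor M ≪≫ₗ TensorProduct.finsuppScalarRight A A M S

end TensorPart

section Subquotient

/-- The map `b` is a retraction of `a` on `T` that vanishes on the boundaries `W`, which gives
injectivity into the subquotient. -/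
lemma nonempty_equiv_subquotient {A X Y : Type*} [CommRing A] [AddCommGroup X] [Module A X]
    [AddCommGroup Y] [Module A Y] {T : Submodule A X} {Z W : Submodule A Y} {a : X →ₗ[A] Y}
    {b : Y →ₗ[A] X} (haZ : ∀ x ∈ T, a x ∈ Z) (hba : ∀ x ∈ T, b (a x) = x) (hb : ∀ y ∈ W, b y = 0)
    (hZ : ∀ z ∈ Z, ∃ x ∈ T, z - a x ∈ W) : Nonempty (T ≃ₗ[A] (Z ⧸ W.comap Z.subtype)) := by
  refine ⟨LinearEquiv.ofBijective (Submodule.mkQ _ ∘ₗ a.restrict haZ) ⟨?_, ?_⟩⟩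
  · intro x y h
    have h1 : a x - a y ∈ W := (Submodule.Quotient.eq (W.comap Z.subtype)).1 h
    have h2 := hb _ h1
    rw [map_sub, hba x x.2, hba y y.2, sub_eq_zero] at h2
    exact Subtype.ext h2
  · intro y
    obtain ⟨⟨y, hy⟩, rfl⟩ := Submodule.mkQ_surjective _ y
    obtain ⟨x, hx, hxy⟩ := hZ y hy
    exact ⟨⟨x, hx⟩, ((Submodule.Quotient.eq (W.comap Z.subtype)).2 hxy).symm⟩

end Subquotient

/-! ### Graded `Tor` from an arbitrary graded resolution -/

section TorPart

variable {k : Type*} [Field k] {n s : ℕ} {f : Fin s → MvPolynomial (Fin n) k}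
  {Γ : Type*} [AddCommMonoid Γ] {w : Fin n → Γ} {B C : Type*} {degB : B → Γ} {degC : C → Γ}
  {hB : B → ℕ} {dB : (B →₀ QuotAlg f) →ₗ[QuotAlg f] (B →₀ QuotAlg f)}
  {εB : (B →₀ QuotAlg f) →ₗ[QuotAlg f] ResField f}
  {hC : C → ℕ} {dC : (C →₀ QuotAlg f) →ₗ[QuotAlg f] (C →₀ QuotAlg f)}
  {εC : (C →₀ QuotAlg f) →ₗ[QuotAlg f] ResField f}

lemma graded_comm {φ : (B →₀ QuotAlg f) →ₗ[QuotAlg f] (C →₀ QuotAlg f)} {i j : ℕ} {γ : Γ}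
    (hφ : ∀ b c, φ (Finsupp.single b 1) c ≠ 0 → (hB b = i ↔ hC c = j))
    (hφ' : ∀ b, φ (Finsupp.single b 1) ∈ homPart f w degC (degB b))
    (x : ResField f ⊗[QuotAlg f] (B →₀ QuotAlg f)) :
    (partProj (QuotAlg f) {c | hC c = j ∧ degC c = γ}).lTensor (ResField f)
        (φ.lTensor (ResField f) x) =
      φ.lTensor (ResField f)
        ((partProj (QuotAlg f) {b | hB b = i ∧ degB b = γ}).lTensor (ResField f) x) := by
  refine lTensor_partProj_comm (fun b c h => ?_) x
  by_cases h0 : φ (Finsupp.single b 1) c = 0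
  · rw [h0]
    exact zero_mem _
  · refine mem_augIdeal_of_mem_weightPart (fun h1 => h ?_) (hφ' b c)
    rw [Set.mem_ofPred_eq, zero_add] at h1
    rw [Set.mem_ofPred_eq, Set.mem_ofPred_eq, hφ b c h0, h1]

lemma IsFreeResolution.hdeg_of_ne_zero (G : IsFreeResolution hC dC εC) {b c : C}
    (h : dC (Finsupp.single b 1) c ≠ 0) : hC b = hC c + 1 := by
  have hb : Finsupp.single b (1 : QuotAlg f) ∈ piece _ hC (hC b) := single_mem_piece rfl _
  rcases he : hC b with _ | i <;> rw [he] at hb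
  · rw [G.d_zero _ hb] at h
    exact absurd rfl h
  · have := G.d_mem _ _ hb (Finsupp.mem_support_iff.2 h)
    rw [Set.mem_ofPred_eq] at this
    rw [this]

lemma lTensor_graded_comm (G : IsFreeResolution hC dC εC) (gG : IsGradedBy f w degC dC εC)
    (i : ℕ) (γ : Γ) (x : ResField f ⊗[QuotAlg f] (C →₀ QuotAlg f)) :
    (partProj (QuotAlg f) {c | hC c = i ∧ degC c = γ}).lTensor (ResField f)
        (dC.lTensor (ResField f) x) =
      dC.lTensor (ResField f)
        ((partProj (QuotAlg f) {b | hC b = i + 1 ∧ degC b = γ}).lTensor (ResField f) x) :=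
  graded_comm (fun b c h => by rw [G.hdeg_of_ne_zero h, Nat.add_right_cancel_iff])
    gG.d_homogeneous x

/-- `Tor` computed from a graded free resolution agrees with `k ⊗ F` for any graded minimal free
resolution `F`. -/
lemma exists_torPart_equiv (hw : IsHomogeneousFor f w) (F : IsFreeResolution hB dB εB)
    (G : IsFreeResolution hC dC εC) (gF : IsGradedBy f w degB dB εB)
    (gG : IsGradedBy f w degC dC εC) (hmin : IsMinimal (augIdeal f) dB) (i : ℕ) (γ : Γ) :
    Nonempty (tensorPart (A := QuotAlg f) (ResField f) {b | hB b = i ∧ degB b = γ} ≃ₗ[QuotAlg f]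
      torPart (ResField f) hC degC dC i γ) := by
  obtain ⟨α, hα, hαγ, hαd, hαε⟩ := exists_graded_comparison hw F G gF gG
  obtain ⟨β, h₁, h₂, hβ, hβα, hαβ⟩ := exists_homotopy_inverse F G α
    (fun i z hz => hom_piece (fun b hb => hb ▸ hα b) hz) hαd hαε
  set M := ResField f
  have hd0 : dB.lTensor M = 0 := lTensor_quotient_eq_zero hmin
  have hα' : ∀ x, (partProj (QuotAlg f) {c | hC c = i ∧ degC c = γ}).lTensor M (α.lTensor M x) =
      α.lTensor M ((partProj (QuotAlg f) {b | hB b = i ∧ degB b = γ}).lTensor M x) :=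
    graded_comm (fun b c h => by rw [hα b (Finsupp.mem_support_iff.2 h)]) hαγ
  have hdα : ∀ x, dC.lTensor M (α.lTensor M x) = 0 := fun x => by
    rw [← LinearMap.comp_apply, ← LinearMap.lTensor_comp, show dC ∘ₗ α = α ∘ₗ dB from
      LinearMap.ext hαd, LinearMap.lTensor_comp, hd0, LinearMap.comp_zero, LinearMap.zero_apply]
  have hβd : ∀ x, β.lTensor M (dC.lTensor M x) = 0 := fun x => by
    rw [← LinearMap.comp_apply, ← LinearMap.lTensor_comp, ← hβ, LinearMap.lTensor_comp, hd0,
      LinearMap.zero_comp, LinearMap.zero_apply]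
  have hβα' : ∀ x, β.lTensor M (α.lTensor M x) = x := fun x => by
    rw [← LinearMap.comp_apply, ← LinearMap.lTensor_comp, hβα]
    simp [LinearMap.lTensor_add, LinearMap.lTensor_comp, hd0]
  have hαβ' : ∀ y, dC.lTensor M y = 0 →
      α.lTensor M (β.lTensor M y) + dC.lTensor M (h₂.lTensor M y) = y := fun y hy => by
    have h := LinearMap.congr_fun (congrArg (LinearMap.lTensor M) hαβ) y
    simpa [LinearMap.lTensor_add, LinearMap.lTensor_comp, hy] using h
  refine nonempty_equiv_subquotient (a := α.lTensor M) (b := β.lTensor M) (fun x hx => ⟨?_, hdα x⟩)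
    (fun x _ => hβα' x) ?_ ?_
  · rw [← partProj_eq_self hx, ← hα']
    exact partProj_mem_tensorPart _ _
  · rintro _ ⟨y, -, rfl⟩
    exact hβd y
  · rintro y ⟨hy, hyd⟩
    refine ⟨_, partProj_mem_tensorPart _ (β.lTensor M y), _,
      partProj_mem_tensorPart _ (h₂.lTensor M y), ?_⟩
    -- Neither `β` nor `h₂` is known to be graded. Projecting the identity `y = α β y + d h₂ y` onto
    -- the part of `y` repairs this, as `α` and `d` are graded and commute with the projections.
    have h1 := congrArg ((partProj (QuotAlg f) {c | hC c = i ∧ degC c = γ}).lTensor M)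
      (hαβ' y hyd)
    rw [map_add, hα', partProj_eq_self hy, lTensor_graded_comm G gG] at h1
    exact eq_sub_of_add_eq' h1

end TorPart

end BachComm

namespace BachComm

open CategoryTheory

/-! ### Free resolutions as projective resolutions in the category of modules -/

section ProjectiveResolution

variable {A : Type u} [CommRing A] {B : Type} {M : Type u} [AddCommGroup M] [Module A M]
  {hB : B → ℕ} {d : (B →₀ A) →ₗ[A] (B →₀ A)} {ε : (B →₀ A) →ₗ[A] M}

instance piece_free (i : ℕ) : Module.Free A (piece A hB i) :=
  Module.Free.of_equiv (Finsupp.supportedEquivFinsupp (R := A) (M := A) {b | hB b = i}).symm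

/-- The chain complex of modules underlying a free resolution. -/
noncomputable def IsFreeResolution.complex (F : IsFreeResolution hB d ε) :
    ChainComplex (ModuleCat.{u} A) ℕ :=
  ChainComplex.of (fun i => ModuleCat.of A (piece A hB i))
    (fun i => ModuleCat.ofHom (d.restrict (F.d_mem i))) (fun i => by
      refine ModuleCat.hom_ext (LinearMap.ext fun z => Subtype.ext ?_)
      exact F.d_d _)

lemma IsFreeResolution.complex_d (F : IsFreeResolution hB d ε) (i : ℕ) :
    F.complex.d (i + 1) i = ModuleCat.ofHom (d.restrict (F.d_mem i)) :=
  ChainComplex.of_d (fun i => ModuleCat.of A (piece A hB i))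
    (fun i => ModuleCat.ofHom (d.restrict (F.d_mem i))) i

/-- The augmentation of a free resolution as a map of chain complexes. -/
noncomputable def IsFreeResolution.augmentation (F : IsFreeResolution hB d ε) :
    F.complex ⟶ (ChainComplex.single₀ (ModuleCat.{u} A)).obj (ModuleCat.of A M) :=
  (F.complex.toSingle₀Equiv _).symm
    ⟨ModuleCat.ofHom (ε ∘ₗ (piece A hB 0).subtype), by
      rw [F.complex_d]
      refine ModuleCat.hom_ext (LinearMap.ext fun (z : piece A hB 1) => ?_)
      exact (F.exact_zero _ (F.d_mem 0 _ z.2)).2 ⟨z, z.2, rfl⟩⟩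

lemma IsFreeResolution.quasiIso_augmentation (F : IsFreeResolution hB d ε) :
    QuasiIso F.augmentation where
  quasiIsoAt m := by
    rcases m with _ | m
    · rw [ChainComplex.quasiIsoAt₀_iff, ShortComplex.quasiIso_iff_of_zeros' _ rfl rfl rfl]
      have h0 : F.augmentation.f 0 = ModuleCat.ofHom (ε ∘ₗ (piece A hB 0).subtype) :=
        ChainComplex.toSingle₀Equiv_symm_apply_f_zero _ _
      constructor
      · rw [ShortComplex.moduleCat_exact_iff]
        intro z hz
        have hz : F.augmentation.f 0 z = 0 := hz
        rw [h0] at hz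
        obtain ⟨y, hy, hyz⟩ := (F.exact_zero z.1 z.2).1 hz
        refine ⟨(⟨y, hy⟩ : piece A hB 1), ?_⟩
        change F.complex.d 1 0 (⟨y, hy⟩ : piece A hB 1) = z
        rw [F.complex_d]
        exact Subtype.ext hyz
      · change Epi (F.augmentation.f 0)
        rw [h0]
        refine (ModuleCat.epi_iff_surjective (X := ModuleCat.of A (piece A hB 0))
          (Y := ModuleCat.of A M) _).2 ?_
        intro m
        obtain ⟨z, hz, rfl⟩ := F.aug_surjective m
        exact ⟨(⟨z, hz⟩ : piece A hB 0), rfl⟩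
    · rw [quasiIsoAt_iff_exactAt' (hL := ChainComplex.exactAt_succ_single_obj ..),
        HomologicalComplex.exactAt_iff' _ (m + 2) (m + 1) m (by simp) (by simp),
        ShortComplex.moduleCat_exact_iff]
      intro z hz
      have hz : F.complex.d (m + 1) m z = 0 := hz
      rw [F.complex_d] at hz
      obtain ⟨y, hy, hyz⟩ := (F.exact_succ m z.1 z.2).1 (congrArg Subtype.val hz)
      refine ⟨(⟨y, hy⟩ : piece A hB (m + 2)), ?_⟩
      change F.complex.d (m + 2) (m + 1) (⟨y, hy⟩ : piece A hB (m + 2)) = z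
      rw [F.complex_d]
      exact Subtype.ext hyz

/-- A free resolution is a projective resolution. -/
noncomputable def IsFreeResolution.projectiveResolution (F : IsFreeResolution hB d ε) :
    ProjectiveResolution (ModuleCat.of A M) where
  complex := F.complex
  projective i := (IsProjective.iff_projective (piece A hB i)).1 inferInstance
  π := F.augmentation
  quasiIso := F.quasiIso_augmentation

end ProjectiveResolution

/-! ### `Tor` from a minimal resolution -/

section Tor

variable {A : Type u} [CommRing A] {J : Ideal A} {B : Type} {M : Type u} [AddCommGroup M]
  [Module A M] {hB : B → ℕ} {d : (B →₀ A) →ₗ[A] (B →₀ A)} {ε : (B →₀ A) →ₗ[A] M}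

/-- The inclusion of a piece is split, hence stays injective after tensoring, so the vanishing can
be tested in the whole module. -/
lemma IsFreeResolution.lTensor_restrict_eq_zero (F : IsFreeResolution hB d ε)
    (hmin : IsMinimal J d) (i : ℕ) : (d.restrict (F.d_mem i)).lTensor (A ⧸ J) = 0 := by
  refine LinearMap.ext fun x => lTensor_supported_injective (A ⧸ J) {b | hB b = i} ?_
  have h : (Finsupp.supported A A {b | hB b = i}).subtype ∘ₗ d.restrict (F.d_mem i) =
      d ∘ₗ (piece A hB (i + 1)).subtype := rfl
  have h1 := LinearMap.congr_fun (congrArg (LinearMap.lTensor (A ⧸ J)) h) x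
  rw [LinearMap.lTensor_comp, LinearMap.lTensor_comp, lTensor_quotient_eq_zero hmin,
    LinearMap.zero_comp] at h1
  exact h1.trans (map_zero _).symm

/-- `Tor` of a residue ring is computed by a minimal free resolution. -/
lemma IsFreeResolution.nonempty_tor_iso (F : IsFreeResolution hB d ε) (hmin : IsMinimal J d)
    (i : ℕ) : Nonempty (((Tor (ModuleCat.{u} A) i).obj (ModuleCat.of A (A ⧸ J))).obj
      (ModuleCat.of A M) ≅ ModuleCat.of A ((A ⧸ J) ⊗[A] piece A hB i)) := by
  let T : ModuleCat.{u} A ⥤ ModuleCat.{u} A :=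
    (MonoidalCategory.tensoringLeft (ModuleCat.{u} A)).obj (ModuleCat.of A (A ⧸ J))
  let K := (T.mapHomologicalComplex (ComplexShape.down ℕ)).obj F.projectiveResolution.complex
  have hK : ∀ i j, K.d i j = 0 := by
    intro i j
    by_cases hij : j + 1 = i
    · subst hij
      change T.map (F.complex.d (j + 1) j) = 0
      rw [F.complex_d]
      exact ModuleCat.hom_ext (F.lTensor_restrict_eq_zero hmin j)
    · exact K.shape _ _ hij
  exact ⟨F.projectiveResolution.isoLeftDerivedObj T i ≪≫
    (ShortComplex.HomologyData.ofZeros (K.sc i) (hK _ _) (hK _ _)).left.homologyIso⟩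

end Tor

/-! ### `Tor` of the residue field as a vector space -/

section TorResField

open MvPolynomial

variable {k : Type u} [Field k] {n s : ℕ} {f : Fin s → MvPolynomial (Fin n) k}

/-- Evaluation at the origin kills the `f j`, and a polynomial without constant term lies in the
ideal of the variables. -/
lemma finrank_resField (h0 : ∀ j, constantCoeff (f j) = 0) : Module.finrank k (ResField f) = 1 := by
  let ev : QuotAlg f →ₐ[k] k := Ideal.Quotient.liftₐ _ (aeval fun _ => (0 : k)) (by
    intro a ha
    change a ∈ RingHom.ker (aeval fun _ => (0 : k) : MvPolynomial (Fin n) k →ₐ[k] k)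
    refine (Ideal.span_le.2 ?_) ha
    rintro _ ⟨j, rfl⟩
    have := h0 j
    simpa [RingHom.mem_ker, aeval_zero'] using this)
  have hev : ∀ g, ev (Ideal.Quotient.mk _ g) = constantCoeff g := fun g => by
    change aeval (fun _ => (0 : k)) g = _
    rw [aeval_zero']
    rfl
  let ev' : ResField f →ₐ[k] k := Ideal.Quotient.liftₐ _ ev (by
    intro a ha
    change a ∈ RingHom.ker ev
    refine (Ideal.span_le.2 ?_) ha
    rintro _ ⟨j, rfl⟩
    change ev (Ideal.Quotient.mk _ (X j)) = 0
    rw [hev, constantCoeff_X])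
  have hinj : Function.Injective ev' := by
    rw [injective_iff_map_eq_zero]
    intro a ha
    obtain ⟨a, rfl⟩ := Ideal.Quotient.mk_surjective a
    obtain ⟨g, rfl⟩ := Ideal.Quotient.mk_surjective a
    rw [Ideal.Quotient.eq_zero_iff_mem]
    exact mk_mem_augIdeal ((hev g).symm.trans ha)
  have hsurj : Function.Surjective ev' := fun c => ⟨algebraMap k _ c, ev'.commutes c⟩
  rw [(LinearEquiv.ofBijective ev'.toLinearMap ⟨hinj, hsurj⟩).finrank_eq, Module.finrank_self]

lemma nonempty_torResField_equiv {d : (Symb n s →₀ QuotAlg f) →ₗ[QuotAlg f] (Symb n s →₀ QuotAlg f)}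
    {ε : (Symb n s →₀ QuotAlg f) →ₗ[QuotAlg f] ResField f} (F : IsFreeResolution hdeg d ε)
    (hmin : IsMinimal (augIdeal f) d) (i : ℕ) :
    Nonempty (torResField f i ≃ₗ[k] ({b : Symb n s | hdeg b = i} →₀ ResField f)) := by
  classical
  obtain ⟨e⟩ := F.nonempty_tor_iso hmin i
  let E := e.toLinearEquiv ≪≫ₗ
    (Finsupp.supportedEquivFinsupp (R := QuotAlg f) (M := QuotAlg f)
      {b : Symb n s | hdeg b = i}).lTensor (ResField f) ≪≫ₗ
    TensorProduct.finsuppScalarRight (QuotAlg f) (QuotAlg f) (ResField f) {b : Symb n s | hdeg b = i}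
  exact ⟨{ E.toAddEquiv with
    map_smul' := fun c x => (E.map_smul (algebraMap k (QuotAlg f) c) x).trans
      (algebraMap_smul (QuotAlg f) c (E x)) }⟩

end TorResField

end BachComm

namespace BachComm

/-! ### The generating function of the symbols -/

section GeneratingFunction

variable {n s : ℕ}

/-- The symbols of homological degree `i`. -/
def symbolsOfDeg (n s i : ℕ) : Finset (Symb n s) :=
  -- In degree `i` no exponent exceeds `i`, so the box loses nothing and makes the set finite.
  (Finset.univ ×ˢ Fintype.piFinset fun _ => Finset.range (i + 1)).filter fun b => hdeg b = i

@[simp] lemma mem_symbolsOfDeg {i : ℕ} {b : Symb n s} : b ∈ symbolsOfDeg n s i ↔ hdeg b = i := by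
  simp only [symbolsOfDeg, Finset.mem_filter, Finset.mem_product, Finset.mem_univ, true_and,
    Fintype.mem_piFinset, Finset.mem_range, and_iff_right_iff_imp]
  intro h j
  have := Finset.single_le_sum (f := b.2) (fun _ _ => Nat.zero_le _) (Finset.mem_univ j)
  rw [hdeg] at h
  omega

variable {R : Type*} [CommRing R] (a : Fin n → R) (c : Fin s → R)

/-- The monomial attached to a symbol. -/
def symbMonomial (b : Symb n s) : R := (∏ i ∈ b.1, a i) * ∏ j, c j ^ b.2 j

/-- The generating function of the symbols in which no `t_j` with `j ∈ t` occurs. -/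
def symbSeries (t : Finset (Fin s)) : PowerSeries R :=
  PowerSeries.mk fun i => ∑ b ∈ (symbolsOfDeg n s i).filter fun b => ∀ j ∈ t, b.2 j = 0,
    symbMonomial a c b

lemma hdeg_add_single (b : Symb n s) (j : Fin s) :
    hdeg ((b.1, b.2 + Pi.single j 1) : Symb n s) = hdeg b + 2 := by
  simp only [hdeg, Pi.add_apply, Finset.sum_add_distrib, Finset.sum_pi_single', Finset.mem_univ,
    if_true]
  ring

lemma symbMonomial_add_single (b : Symb n s) (j : Fin s) :
    symbMonomial a c (b.1, b.2 + Pi.single j 1) = c j * symbMonomial a c b := by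
  have : ∏ j', c j' ^ (Pi.single j 1 : Fin s → ℕ) j' = c j := by
    rw [Finset.prod_eq_single j] <;> simp +contextual
  simp only [symbMonomial, Pi.add_apply, pow_add, Finset.prod_mul_distrib, this]
  ring

/-- Symbols containing `t_j` correspond bijectively to symbols of degree smaller by two, through
raising the exponent of `t_j`; their series is therefore `c j * X ^ 2` times the whole one. -/
lemma symbSeries_insert {t : Finset (Fin s)} {j : Fin s} (hj : j ∉ t) :
    symbSeries a c t * (1 - PowerSeries.C (c j) * PowerSeries.X ^ 2) =
      symbSeries a c (insert j t) := by
  ext i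
  rw [mul_sub, mul_one, map_sub, ← mul_assoc, PowerSeries.coeff_mul_X_pow', sub_eq_iff_eq_add]
  simp only [symbSeries, PowerSeries.coeff_mk, PowerSeries.coeff_mul_C, Finset.forall_mem_insert]
  rw [← Finset.sum_filter_add_sum_filter_not ((symbolsOfDeg n s i).filter _) (fun b => b.2 j = 0)]
  congr 1
  · rw [Finset.filter_filter]
    refine Finset.sum_congr (Finset.filter_congr fun b _ => and_comm) fun _ _ => rfl
  · split_ifs with hi
    · rw [Finset.sum_mul]
      symm
      refine Finset.sum_bij (fun b _ => (b.1, b.2 + Pi.single j 1)) ?_ ?_ ?_ ?_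
      · intro b hb
        simp only [Finset.mem_filter, mem_symbolsOfDeg] at hb ⊢
        refine ⟨⟨by rw [hdeg_add_single]; omega, fun j' hj' => ?_⟩, by simp⟩
        have : j' ≠ j := fun h => hj (h ▸ hj')
        simp [hb.2 j' hj', this]
      · intro b _ b' _ h
        rw [Prod.mk.injEq] at h
        exact Prod.ext h.1 (add_right_cancel h.2)
      · intro b hb
        simp only [Finset.mem_filter, mem_symbolsOfDeg] at hb
        have h1 : b.2 - Pi.single j 1 + Pi.single j 1 = b.2 := by
          refine tsub_add_cancel_of_le fun j' => ?_
          by_cases h : j' = j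
          · subst h
            simpa using Nat.one_le_iff_ne_zero.2 hb.2
          · simp [h]
        have h2 := hdeg_add_single ((b.1, b.2 - Pi.single j 1) : Symb n s) j
        simp only [h1] at h2
        refine ⟨(b.1, b.2 - Pi.single j 1), ?_, by simp only [h1]⟩
        simp only [Finset.mem_filter, mem_symbolsOfDeg]
        refine ⟨?_, fun j' hj' => ?_⟩
        · have : hdeg b = _ := h2
          omega
        · simp [hb.1.2 j' hj']
      · intro b _
        rw [symbMonomial_add_single, mul_comm]
    · refine Finset.sum_eq_zero fun b hb => ?_
      simp only [Finset.mem_filter, mem_symbolsOfDeg, hdeg] at hb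
      have := Finset.single_le_sum (f := b.2) (fun _ _ => Nat.zero_le _) (Finset.mem_univ j)
      omega

lemma symbSeries_univ :
    symbSeries a c Finset.univ = ∏ i, (1 + PowerSeries.C (a i) * PowerSeries.X) := by
  rw [Finset.prod_one_add]
  ext i
  rw [map_sum, symbSeries, PowerSeries.coeff_mk]
  have h : ∀ I ∈ (Finset.univ : Finset (Fin n)).powerset,
      PowerSeries.coeff i (∏ p ∈ I, PowerSeries.C (a p) * PowerSeries.X) =
        if I.card = i then ∏ p ∈ I, a p else 0 := by
    intro I _
    rw [Finset.prod_mul_distrib, Finset.prod_const, ← map_prod, PowerSeries.coeff_C_mul,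
      PowerSeries.coeff_X_pow]
    simp [eq_comm]
  rw [Finset.sum_congr rfl h, ← Finset.sum_filter]
  refine Finset.sum_bij (fun b _ => b.1) ?_ ?_ ?_ ?_
  · intro b hb
    simp only [Finset.mem_filter, mem_symbolsOfDeg, Finset.mem_univ, true_imp_iff] at hb
    simpa [hdeg, hb.2] using hb.1
  · intro b hb b' hb' h
    simp only [Finset.mem_filter, mem_symbolsOfDeg, Finset.mem_univ, true_imp_iff] at hb hb'
    exact Prod.ext h (funext fun j => (hb.2 j).trans (hb'.2 j).symm)
  · intro I hI
    simp only [Finset.mem_filter] at hI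
    exact ⟨(I, 0), by simp [hdeg, hI.2], rfl⟩
  · intro b hb
    simp only [Finset.mem_filter, Finset.mem_univ, true_imp_iff] at hb
    simp [symbMonomial, hb.2]

/-- The generating function of all symbols. -/
lemma symbSeries_mul_prod :
    symbSeries a c ∅ * ∏ j, (1 - PowerSeries.C (c j) * PowerSeries.X ^ 2) =
      ∏ i, (1 + PowerSeries.C (a i) * PowerSeries.X) := by
  rw [← symbSeries_univ a c]
  have h : ∀ t : Finset (Fin s), symbSeries a c ∅ *
      ∏ j ∈ t, (1 - PowerSeries.C (c j) * PowerSeries.X ^ 2) = symbSeries a c t := by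
    intro t
    induction t using Finset.induction_on with
    | empty => rw [Finset.prod_empty, mul_one]
    | insert j t hj ih =>
      rw [Finset.prod_insert hj, mul_left_comm, mul_comm _ (symbSeries a c ∅ * _), ih,
        symbSeries_insert a c hj]
  exact h _

lemma coeff_symbSeries_empty (i : ℕ) :
    PowerSeries.coeff i (symbSeries a c ∅) = ∑ b ∈ symbolsOfDeg n s i, symbMonomial a c b := by
  simp [symbSeries]

lemma symbMonomial_one (b : Symb n s) : symbMonomial (fun _ => (1 : R)) (fun _ => 1) b = 1 := by
  simp [symbMonomial]

lemma symbMonomial_single {Γ : Type*} [AddCommMonoid Γ] (w : Fin n → Γ) (v : Fin s → Γ)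
    (b : Symb n s) :
    symbMonomial (fun i => AddMonoidAlgebra.single (w i) (1 : ℤ))
      (fun j => AddMonoidAlgebra.single (v j) 1) b = AddMonoidAlgebra.single (intDeg w v b) 1 := by
  have h : ∀ {ι : Type} (t : Finset ι) (g : ι → Γ), ∏ i ∈ t, AddMonoidAlgebra.single (g i) (1 : ℤ) =
      AddMonoidAlgebra.single (∑ i ∈ t, g i) 1 := by
    intro ι t g
    classical
    induction t using Finset.induction_on with
    | empty => rfl
    | insert i t hi ih => rw [Finset.prod_insert hi, ih, AddMonoidAlgebra.single_mul_single,
        Finset.sum_insert hi, mul_one]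
  simp only [symbMonomial, AddMonoidAlgebra.single_pow, one_pow]
  rw [h, h, AddMonoidAlgebra.single_mul_single, mul_one]
  rfl

end GeneratingFunction

/-! ### Dimensions of `Tor` -/

section Dimension

open MvPolynomial

variable {k : Type u} [Field k] {n s : ℕ} {f : Fin s → MvPolynomial (Fin n) k}

lemma finrank_finsupp_of_finrank_eq_one {M B : Type*} [AddCommGroup M] [Module k M]
    (h : Module.finrank k M = 1) (t : Finset B) : Module.finrank k ((t : Set B) →₀ M) = t.card := by
  have : Module.Finite k M := Module.finite_of_finrank_pos (by rw [h]; exact one_pos)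
  let e : ((t : Set B) →₀ M) ≃ₗ[k] ((t : Set B) →₀ k) := Finsupp.mapRange.linearEquiv
    (LinearEquiv.ofFinrankEq M k (h.trans (Module.finrank_self k).symm))
  rw [e.finrank_eq, Module.finrank_finsupp_self]
  simp

lemma finite_finsupp_of_finrank_eq_one {M B : Type*} [AddCommGroup M] [Module k M]
    (h : Module.finrank k M = 1) (t : Finset B) : Module.Finite k ((t : Set B) →₀ M) := by
  have : Module.Finite k M := Module.finite_of_finrank_pos (by rw [h]; exact one_pos)
  infer_instance

lemma torResField_finite_and_finrank (h0 : ∀ j, constantCoeff (f j) = 0)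
    (F : IsFreeResolution hdeg (diff f) (aug f)) (hmin : IsMinimal (augIdeal f) (diff f)) (i : ℕ) :
    Module.Finite k (torResField f i) ∧
      Module.finrank k (torResField f i) = (symbolsOfDeg n s i).card := by
  obtain ⟨e⟩ := nonempty_torResField_equiv F hmin i
  have hS : {b : Symb n s | hdeg b = i} = (symbolsOfDeg n s i : Set (Symb n s)) := by
    ext b
    simp
  rw [hS] at e
  have := finite_finsupp_of_finrank_eq_one (finrank_resField h0) (symbolsOfDeg n s i)
  exact ⟨Module.Finite.equiv e.symm,
    e.finrank_eq.trans (finrank_finsupp_of_finrank_eq_one (finrank_resField h0) _)⟩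

open Classical in
lemma torPart_finite_and_finrank {Γ C : Type*} [AddCommMonoid Γ] {w : Fin n → Γ}
    {degB : Symb n s → Γ} {degC : C → Γ}
    {hC : C → ℕ} {dC : (C →₀ QuotAlg f) →ₗ[QuotAlg f] (C →₀ QuotAlg f)}
    {εC : (C →₀ QuotAlg f) →ₗ[QuotAlg f] ResField f} (h0 : ∀ j, constantCoeff (f j) = 0)
    (hw : IsHomogeneousFor f w) (F : IsFreeResolution hdeg (diff f) (aug f))
    (hmin : IsMinimal (augIdeal f) (diff f)) (gF : IsGradedBy f w degB (diff f) (aug f))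
    (G : IsFreeResolution hC dC εC) (gG : IsGradedBy f w degC dC εC) (i : ℕ) (γ : Γ) :
    Module.Finite k (torPart (ResField f) hC degC dC i γ) ∧
      Module.finrank k (torPart (ResField f) hC degC dC i γ) =
        ((symbolsOfDeg n s i).filter fun b => degB b = γ).card := by
  obtain ⟨e⟩ := exists_torPart_equiv hw F G gF gG hmin i γ
  have e' := ((tensorPartEquiv (ResField f) _).symm ≪≫ₗ e).restrictScalars k
  have hS : {b : Symb n s | hdeg b = i ∧ degB b = γ} =
      (((symbolsOfDeg n s i).filter fun b => degB b = γ : Finset (Symb n s)) : Set (Symb n s)) := by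
    ext b
    simp
  rw [hS] at e'
  have := finite_finsupp_of_finrank_eq_one (finrank_resField h0)
    ((symbolsOfDeg n s i).filter fun b => degB b = γ)
  exact ⟨Module.Finite.equiv e',
    e'.finrank_eq.symm.trans (finrank_finsupp_of_finrank_eq_one (finrank_resField h0) _)⟩

end Dimension

end BachComm

/-! ### The main theorem -/

theorem theorem3p7 {k : Type u} [Field k] {n s : ℕ}
    (f : Fin s → MvPolynomial (Fin n) k)
    (hf : BachComm.IsReducedGroebnerBasis MonomialOrder.degLex f)
    (hci : BachComm.IsCompleteIntersection
      (BachComm.initialIdeal MonomialOrder.degLex (Ideal.span (Set.range f))))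
    (h0 : ∀ j, MvPolynomial.constantCoeff (f j) = 0) :
    -- the complex is a free resolution of `k` and a DG-algebra
    BachComm.IsFreeResolution BachComm.hdeg (BachComm.diff f) (BachComm.aug f) ∧
    BachComm.IsDGAlgebra BachComm.hdeg (BachComm.mul (BachComm.QuotAlg f))
      (BachComm.one (BachComm.QuotAlg f)) (BachComm.diff f) ∧
    -- if moreover the `f_j` have no linear terms:
    ((∀ j i, MvPolynomial.coeff (Finsupp.single i 1) (f j) = 0) →
      -- the resolution is minimal
      BachComm.IsMinimal (BachComm.augIdeal f) (BachComm.diff f) ∧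
      -- the Poincaré-Betti series in the variable `t` alone
      (∀ i, Module.Finite k (BachComm.torResField f i)) ∧
      (PowerSeries.mk fun i => (Module.finrank k (BachComm.torResField f i) : ℤ)) *
          (1 - PowerSeries.X ^ 2) ^ s = (1 + PowerSeries.X) ^ n ∧
      -- the multigraded Poincaré-Betti series, for every grading `deg x_i = w i` of `A`
      (∀ (Γ : Type v) [AddCommMonoid Γ] (w : Fin n → Γ),
        (∀ g ∈ Ideal.span (Set.range f), ∀ γ : Γ,
          MvPolynomial.weightedHomogeneousComponent w γ g ∈ Ideal.span (Set.range f)) →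
        -- the complex is graded, `t_j` having the degree of the leading monomial of `f_j`
        BachComm.IsGradedBy f w
          (BachComm.intDeg w fun j => Finsupp.weight w (MonomialOrder.degLex.degree (f j)))
          (BachComm.diff f) (BachComm.aug f) ∧
        -- `Tor` is computed from an arbitrary graded free resolution of `k`
        ∀ (B : Type w) (hd : B → ℕ) (deg : B → Γ)
          (d : (B →₀ BachComm.QuotAlg f) →ₗ[BachComm.QuotAlg f] (B →₀ BachComm.QuotAlg f))
          (ε : (B →₀ BachComm.QuotAlg f) →ₗ[BachComm.QuotAlg f] BachComm.ResField f),
          BachComm.IsFreeResolution hd d ε → BachComm.IsGradedBy f w deg d ε →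
          (∀ i γ, Module.Finite k (BachComm.torPart (BachComm.ResField f) hd deg d i γ)) ∧
          ∃ P : PowerSeries (AddMonoidAlgebra ℤ Γ),
            (∀ i γ, (PowerSeries.coeff i P).coeff γ =
              (Module.finrank k (BachComm.torPart (BachComm.ResField f) hd deg d i γ) : ℤ)) ∧
            P * ∏ j, (1 - PowerSeries.C (AddMonoidAlgebra.single
                (Finsupp.weight w (MonomialOrder.degLex.degree (f j))) 1) * PowerSeries.X ^ 2) =
              ∏ i, (1 + PowerSeries.C (AddMonoidAlgebra.single (w i) 1) * PowerSeries.X))) := by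
  have hreg := BachComm.mem_idealLT_of_mul_mem _ hf.monic (hf.degree_inf _ hci)
  have F := BachComm.isFreeResolution_diff h0 hreg
  refine ⟨F, BachComm.isDGAlgebra_diff h0, fun hlin => ?_⟩
  have hmin := BachComm.isMinimal_diff hlin
  have hTor := BachComm.torResField_finite_and_finrank h0 F hmin
  refine ⟨hmin, fun i => (hTor i).1, ?_, fun Γ _ w hw => ?_⟩
  -- With all weights one, the series merely counts the symbols of each homological degree.
  · have h := BachComm.symbSeries_mul_prod (fun _ : Fin n => (1 : ℤ)) (fun _ : Fin s => 1)
    simp only [map_one, one_mul, Finset.prod_const, Finset.card_univ, Fintype.card_fin] at h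
    rw [← h]
    congr 1
    ext i
    rw [PowerSeries.coeff_mk, BachComm.coeff_symbSeries_empty, (hTor i).2]
    simp [BachComm.symbMonomial_one]
  · have gF := BachComm.isGradedBy_diff hf hw
    refine ⟨gF, fun B hd deg d ε G gG => ?_⟩
    have hPart := BachComm.torPart_finite_and_finrank h0 hw F hmin gF G gG
    -- The witness is the series of all symbols, its weights in the monoid ring being fixed by the
    -- product formula. Its coefficient at `i` and `γ` counts the symbols of these degrees.
    refine ⟨fun i γ => (hPart i γ).1, BachComm.symbSeries _ _ ∅, fun i γ => ?_,
      BachComm.symbSeries_mul_prod _ _⟩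
    classical
    rw [BachComm.coeff_symbSeries_empty, (hPart i γ).2]
    simp only [BachComm.symbMonomial_single, AddMonoidAlgebra.coeff_sum, Finsupp.finsetSum_apply,
      AddMonoidAlgebra.coeff_single, Finsupp.single_apply, Finset.sum_boole]
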